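/- Let $k$ be an algebraically closed field of characteristic $p>0$, let $c\ge 1$ be an integer divisible by $p-1$, let $K^*=k(x,y)$ be the rational function field in two variables, and put $$u=\frac{x^p}{1-x^{p-1}},\qquad v=y^p-x^cy,\qquad K=k(u,v)\subset K_1=k(x,v)\subset K^*,$$ which is a tower of two Artin–Schreier extensions. Let $S=k[x,y]_{(x,y)}$ and $A=k[x,v]_{(x,v)}$, a local ring of $K_1$. A generating sequence of a valuation $\nu$ dominating a local ring $R$ is a sequence $(P_i)$ in $m_R$ such that for every $\gamma$ the ideal $\{f\in R\mid \nu(f)\ge\gamma\}$ is generated by the monomials in the $P_i$ of value at least $\gamma$. Define $Q_0=x$, $Q_1=y$, $Q_2=y^{p^2}-x$ and $Q_{j+1}=Q_j^{p^2}-x^{p^{2j-2}}Q_{j-1}$ for $j\ge2$; define $U_0=x$, $U_1=v$, $U_2=v^p-x$ and, for $j\ge 2$, $U_{j+1}=U_j^p-x^{p^{2j-2}}U_{j-1}$ if $j$ is odd, $U_{j+1}=U_j^{p^3}-x^{p^{2j-1}}U_{j-1}$ if $j$ is even. There is a unique $k$-valuation $\nu^*$ of $K^*$ with values in $\mathbb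 Q$ that has $(Q_j)$ as a generating sequence in $S$ and satisfies $\nu^*(Q_0)=1$, $\nu^*(Q_1)=p^{-2}$ and $\nu^*(Q_j)=p^{-2}\bigl(p^{2j-2}+\nu^*(Q_{j-1})\bigr)$ for $j\ge2$. Its restriction $\nu_1=\nu^*|_{K_1}$ is a $k$-valuation with generating sequence $(U_j)$ in $A$ and with $\nu_1(U_0)=1$, $\nu_1(U_1)=p^{-1}$ and, for $j\ge 2$, $\nu_1(U_j)=p^{-1}(p^{2j-2}+\nu_1(U_{j-1}))$ if $j$ is odd, $\nu_1(U_j)=p^{-3}(p^{2j-1}+\nu_1(U_{j-1}))$ if $j$ is even. A quadratic transform of a local ring $R$ is a local ring $R[m_R/t]_m$ with $0\ne t\in m_R$ and $m$ a prime ideal with $m\cap R=m_R$; it is along a valuation if the valuation dominates it. The infinite sequences of quadratic transforms of $A$ along $\nu_1$ and of $S$ along $\nu^*$ exist and are unique. Let $A_1=A\to A_2\to\cdots$ be the subsequence of the first in which $A_{j+1}$ is reached from $A_j$ by $p$ quadratic transforms if $j$ is odd and by $p^3$ if $j$ is even, and let $S_1=S\to S_2\to\cdots$ be the subsequence of the second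 in which $S_{j+1}$ is reached from $S_j$ by $p^2$ quadratic transforms. Set $x_{S_1}=x$, $y_{S_1}=y$, $y_{S_2}=Q_2/x$, $y_{S_{j+1}}=Q_{j+1}/(x^{p^{2j-2}}Q_{j-1})$ for $j\ge2$, and $x_{S_{j+1}}=y_{S_j}$ for $j\ge 1$; set $x_{A_1}=x$, $v_{A_1}=v$, $v_{A_2}=U_2/x$, for $j\ge 2$ $v_{A_{j+1}}=U_{j+1}/(x^{e_j}U_{j-1})$ with $e_j=p^{2j-2}$ if $j$ is odd and $e_j=p^{2j-1}$ if $j$ is even, and $x_{A_{j+1}}=v_{A_j}$ for $j\ge1$. **Theorem.** For all $j\ge1$, $A_j$ and $S_j$ are regular local rings of dimension two with regular parameters $x_{A_j},v_{A_j}$ and $x_{S_j},y_{S_j}$ respectively, $S_j$ dominates $A_j$, and $S_j$ is a finite extension of $A_j$. If $j\ge1$ is odd, there are expressions $$x_{A_{j+1}}=\tau_{j+1}x_{S_{j+1}}^p,\qquad v_{A_{j+1}}=\gamma_{j+1}y_{S_{j+1}}+x_{S_{j+1}}\Omega_{j+1},$$ and if $j\ge 2$ is even, there are expressions $$x_{A_{j+1}}=\tau_{j+1}x_{S_{j+1}},\qquad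 v_{A_{j+1}}=\gamma_{j+1}y_{S_{j+1}}^p+x_{S_{j+1}}\Omega_{j+1},$$ where in both cases $\tau_{j+1},\gamma_{j+1}$ are units in $S_{j+1}$ and $\Omega_{j+1}\in S_{j+1}$. Hence for all $j\ge 1$ the parameters above give a stable form $$x_{A_j}=\tau\, x_{S_j}^{\bar a p^{\alpha_j}},\qquad v_{A_j}=x_{S_j}^{b_j}f_j,$$ where $\tau$ is a unit of $S_j$ and the residue of $f_j$ has order $p^{\beta_j}$ in the discrete valuation ring $S_j/x_{S_j}S_j$, with $\bar a=1$, $b_j=0$, and with $\alpha_j=1,\ \beta_j=0$ if $j$ is even and $\alpha_j=0,\ \beta_j=1$ if $j$ is odd. In any family of such stable forms for all large $j$ (for these parameters, with $\bar a$ independent of $j$) the exponents $\alpha_j,\beta_j$ are these ones. In particular neither $\alpha_j$ nor $\beta_j$ is eventually constant. -/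

import Mathlib

open IsLocalRing

namespace DefectTower

noncomputable section

/-! ### Local rings, regular parameters and quadratic transforms inside a field -/

section General

variable {F : Type*} [Field F]

/-- The underlying ring of `R` is a regular local ring of dimension two, and `a`, `b` are regular
parameters in it. -/
def IsRegularParameters (R : LocalSubring F) (a b : F) : Prop :=
  IsRegularLocalRing R.toSubring ∧ ringKrullDim R.toSubring = 2 ∧
    ∃ (ha : a ∈ R.toSubring) (hb : b ∈ R.toSubring),
      maximalIdeal R.toSubring = Ideal.span {⟨a, ha⟩, ⟨b, hb⟩}

/-- The subring `R[m_R / t]` of the field `F`. -/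
def blowupRing (R : LocalSubring F) (t : F) : Subring F :=
  Subring.closure ((R.toSubring : Set F) ∪ {w | ∃ z ∈ maximalIdeal R.toSubring, w = (z : F) / t})

theorem le_blowupRing (R : LocalSubring F) (t : F) : R.toSubring ≤ blowupRing R t :=
  fun _ hz => Subring.subset_closure (Or.inl hz)

/-- `R'` is a quadratic transform of `R`: it is the local ring `R[m_R / t]_m`, where `t ∈ m_R` is
nonzero and `m` is a prime ideal of `R[m_R / t]` with `m ∩ R = m_R`. -/
def IsQuadraticTransform (R R' : LocalSubring F) : Prop :=
  ∃ t ∈ maximalIdeal R.toSubring, t ≠ 0 ∧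
    ∃ (m : Ideal (blowupRing R (t : F))) (_ : m.IsPrime),
      m.comap (Subring.inclusion (le_blowupRing R (t : F))) = maximalIdeal R.toSubring ∧
      R' = LocalSubring.ofPrime (blowupRing R (t : F)) m

/-- The valuation ring `{f | 0 ≤ ν f}` of a rational valued valuation `ν`. -/
def valuationRing (ν : AddValuation F (WithTop ℚ)) : ValuationSubring F :=
  (AddValuation.toValuation ν).valuationSubring

theorem mem_valuationRing (ν : AddValuation F (WithTop ℚ)) (f : F) :
    f ∈ valuationRing ν ↔ 0 ≤ ν f := Iff.rfl

/-- `R 0 → R 1 → R 2 → ⋯` is the infinite sequence of quadratic transforms of `R₀` along `ν`: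
each ring is a quadratic transform of the preceding one, and `ν` dominates each of them.
(`≤` on local subrings is domination.) -/
def IsQuadraticSequence (ν : AddValuation F (WithTop ℚ)) (R₀ : LocalSubring F)
    (R : ℕ → LocalSubring F) : Prop :=
  R 0 = R₀ ∧ (∀ i, R i ≤ (valuationRing ν).toLocalSubring) ∧
    ∀ i, IsQuadraticTransform (R i) (R (i + 1))

/-- `Q` is a generating sequence of `ν` in `R`: the `Q i` lie in `m_R`, and for every `γ` the ideal
`{f ∈ R | γ ≤ ν f}` is generated by the monomials in the `Q i` that have value at least `γ`. -/
def IsGeneratingSequence (ν : AddValuation F (WithTop ℚ)) (R : LocalSubring F) (Q : ℕ → F) :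
    Prop :=
  (∀ i, ∃ h : Q i ∈ R.toSubring, (⟨Q i, h⟩ : R.toSubring) ∈ maximalIdeal R.toSubring) ∧
    ∀ (γ : ℚ) (f : R.toSubring), (γ : WithTop ℚ) ≤ ν (f : F) ↔
      f ∈ Ideal.span {g : R.toSubring | (γ : WithTop ℚ) ≤ ν (g : F) ∧
        ∃ e : ℕ →₀ ℕ, (g : F) = e.prod (fun i m => Q i ^ m)}

/-- `ν` is a `k`-valuation with generating sequence `Q` in `R` such that `ν (Q i) = β i`. -/
def IsValuationGeneratedBy (k : Type*) [Field k] [Algebra k F] (ν : AddValuation F (WithTop ℚ))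
    (R : LocalSubring F) (Q : ℕ → F) (β : ℕ → ℚ) : Prop :=
  (∀ a : k, a ≠ 0 → ν (algebraMap k F a) = 0) ∧ (∀ i, ν (Q i) = (β i : WithTop ℚ)) ∧
    IsGeneratingSequence ν R Q

/-! ### Recursively defined sequences -/

/-- The sequence `a, b, b ^ (n 1) - a, …` with `Q (j + 1) = Q j ^ (n j) - a ^ (e j) * Q (j - 1)` for
`j ≥ 2`. -/
def keySeq (n e : ℕ → ℕ) (a b : F) : ℕ → F
  | 0 => a
  | 1 => b
  | 2 => b ^ n 1 - a
  | j + 3 => keySeq n e a b (j + 2) ^ n (j + 2) - a ^ e (j + 2) * keySeq n e a b (j + 1)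

/-- The values `1, 1 / n 1, …` with `β j = (e j + β (j - 1)) / n j` for `j ≥ 2`. -/
def keyValue (n e : ℕ → ℕ) : ℕ → ℚ
  | 0 => 1
  | 1 => 1 / n 1
  | j + 2 => ((e (j + 2) : ℚ) + keyValue n e (j + 1)) / n (j + 2)

/-- The second regular parameter of the `j`-th ring, for `j ≥ 1`: it is `Q 1` for `j = 1`,
`Q 2 / Q 0` for `j = 2`, and `Q (i + 1) / (Q 0 ^ (e i) * Q (i - 1))` for `j = i + 1 ≥ 3`.
By convention the value at `j = 0` is `Q 0`. -/
def secondParam (e : ℕ → ℕ) (Q : ℕ → F) : ℕ → F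
  | 0 => Q 0
  | 1 => Q 1
  | 2 => Q 2 / Q 0
  | i + 3 => Q (i + 3) / (Q 0 ^ e (i + 2) * Q (i + 1))

/-- The first regular parameter of the `j`-th ring, for `j ≥ 1`: it is `Q 0` for `j = 1`, and the
second regular parameter of the preceding ring for `j ≥ 2`. -/
def firstParam (e : ℕ → ℕ) (Q : ℕ → F) (j : ℕ) : F := secondParam e Q (j - 1)

/-- The number `n 1 + ⋯ + n (j - 1)` of quadratic transforms that lead from the first to the `j`-th
ring, when `n i` quadratic transforms lead from the `i`-th to the `(i + 1)`-st one. -/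
def stage (n : ℕ → ℕ) (j : ℕ) : ℕ := ∑ i ∈ Finset.Ico 1 j, n i

/-! ### Stable forms -/

/-- The regular parameters `x, y` of `S` and `a, w` of a local ring dominated by `S` give the stable
form `a = τ x ^ (ā p ^ α)`, `w = x ^ b f`, where `τ` is a unit of `S` and the residue of `f` in the
discrete valuation ring `S / x S` has order `p ^ β`, i.e. it is a unit times the `p ^ β`-th power
of the residue of the uniformizer `y`. -/
def IsStableForm (p : ℕ) (S : LocalSubring F) (a w x y : F) (abar α b β : ℕ) : Prop :=
  (∃ τ : S.toSubring, IsUnit τ ∧ a = τ * x ^ (abar * p ^ α)) ∧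
    ∃ f : S.toSubring, w = x ^ b * f ∧
      ∃ δ Ω : S.toSubring, IsUnit δ ∧ (f : F) = δ * y ^ p ^ β + x * Ω

end General

/-! ### The tower of fields -/

section Tower

variable (k : Type*) [Field k]

/-- The rational function field `K* = k(x, y)`. -/
abbrev TopField : Type _ := FractionRing (MvPolynomial (Fin 2) k)

/-- The variable `x` of `K*`. -/
def xVar : TopField k := algebraMap (MvPolynomial (Fin 2) k) (TopField k) (MvPolynomial.X 0)

/-- The variable `y` of `K*`. -/
def yVar : TopField k := algebraMap (MvPolynomial (Fin 2) k) (TopField k) (MvPolynomial.X 1)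

variable (p c : ℕ)

/-- `u = x ^ p / (1 - x ^ (p - 1))`. -/
def uElt : TopField k := xVar k ^ p / (1 - xVar k ^ (p - 1))

/-- `v = y ^ p - x ^ c y`. -/
def vElt : TopField k := yVar k ^ p - xVar k ^ c * yVar k

/-- `K = k(u, v)`. -/
def KBase : IntermediateField k (TopField k) := IntermediateField.adjoin k {uElt k p, vElt k p c}

/-- `K₁ = k(x, v)`. -/
def KOne : IntermediateField k (TopField k) := IntermediateField.adjoin k {xVar k, vElt k p c}

/-- `x` as an element of `K₁`. -/
def xOne : KOne k p c := ⟨xVar k, IntermediateField.subset_adjoin k _ (by simp)⟩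

/-- `v` as an element of `K₁`. -/
def vOne : KOne k p c := ⟨vElt k p c, IntermediateField.subset_adjoin k _ (by simp)⟩

/-- `E'` is an Artin–Schreier extension of `E`: it is generated by a root `θ ∉ E` of a polynomial
`T ^ p - T - a` with `a ∈ E`. -/
def IsArtinSchreierExtension {k : Type*} [Field k] {L : Type*} [Field L] [Algebra k L] (p : ℕ)
    (E E' : IntermediateField k L) : Prop :=
  E ≤ E' ∧ ∃ θ : L, θ ^ p - θ ∈ E ∧ θ ∉ E ∧ E' = E ⊔ IntermediateField.adjoin k {θ}

end Tower

/-! ### The local rings at the origin -/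

section Origin

variable {k : Type*} [Field k] {F : Type*} [Field F] [Algebra k F]

/-- The ideal `(a, b)` of the subring `k[a, b]` of `F`. -/
def originIdeal (k : Type*) [Field k] {F : Type*} [Field F] [Algebra k F] (a b : F) :
    Ideal (Algebra.adjoin k {a, b}).toSubring :=
  Ideal.span {⟨a, Algebra.subset_adjoin (by simp)⟩, ⟨b, Algebra.subset_adjoin (by simp)⟩}

/-- The ideal `(a, b)` of `k[a, b]` is prime if `a`, `b` become polynomials without constant term
under an embedding into `K*`. -/
theorem isPrime_originIdeal (j : F →ₐ[k] TopField k) (a b : F) (f g : MvPolynomial (Fin 2) k)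
    (hf : MvPolynomial.constantCoeff f = 0) (hg : MvPolynomial.constantCoeff g = 0)
    (ha : j a = algebraMap _ (TopField k) f) (hb : j b = algebraMap _ (TopField k) g) :
    (originIdeal k a b).IsPrime := by
  set B : Subring F := (Algebra.adjoin k {a, b}).toSubring with hB
  have haB : a ∈ B := Algebra.subset_adjoin (by simp)
  have hbB : b ∈ B := Algebra.subset_adjoin (by simp)
  let i : MvPolynomial (Fin 2) k →+* TopField k := algebraMap _ _
  have hi : Function.Injective i := IsFractionRing.injective _ _
  have hk : ∀ r : k, j (algebraMap k F r) = i (MvPolynomial.C r) := fun r => by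
    rw [AlgHom.commutes, IsScalarTower.algebraMap_apply k (MvPolynomial (Fin 2) k) (TopField k)]
    rfl
  have hmem : ∀ z : B, j z ∈ i.range := by
    rintro ⟨z, hz⟩
    refine Algebra.adjoin_induction (p := fun z _ => j z ∈ i.range) ?_ ?_ ?_ ?_ hz
    · rintro z (rfl | rfl)
      · exact ⟨f, ha.symm⟩
      · exact ⟨g, hb.symm⟩
    · exact fun r => ⟨_, (hk r).symm⟩
    · intro z w _ _ h₁ h₂
      rw [map_add]
      exact i.range.add_mem h₁ h₂
    · intro z w _ _ h₁ h₂
      rw [map_mul]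
      exact i.range.mul_mem h₁ h₂
  let φ : B →+* i.range := ((j : F →+* TopField k).comp B.subtype).codRestrict i.range hmem
  let e : MvPolynomial (Fin 2) k ≃+* i.range := RingEquiv.ofBijective i.rangeRestrict
    ⟨fun z w h => hi (congrArg Subtype.val h), i.rangeRestrict_surjective⟩
  let ε : B →+* k := (MvPolynomial.constantCoeff.comp e.symm.toRingHom).comp φ
  have hε : ∀ (z : B) (q : MvPolynomial (Fin 2) k), j z = i q →
      ε z = MvPolynomial.constantCoeff q := by
    intro z q h
    have : φ z = e q := Subtype.ext h
    simp [ε, this]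
  have hkB : ∀ r : k, algebraMap k F r ∈ B := fun r => Subalgebra.algebraMap_mem _ r
  have hεk : ∀ r : k, ε ⟨algebraMap k F r, hkB r⟩ = r := fun r => by
    rw [hε _ _ (hk r), MvPolynomial.constantCoeff_C]
  have hεa : ε ⟨a, haB⟩ = 0 := by rw [hε _ f ha, hf]
  have hεb : ε ⟨b, hbB⟩ = 0 := by rw [hε _ g hb, hg]
  have key : ∀ z ∈ Algebra.adjoin k {a, b}, ∃ (r : k) (s t : B),
      z = algebraMap k F r + s * a + t * b := by
    intro z hz
    induction hz using Algebra.adjoin_induction with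
    | mem z hz =>
      rcases hz with rfl | rfl
      · exact ⟨0, 1, 0, by simp⟩
      · exact ⟨0, 0, 1, by simp⟩
    | algebraMap r => exact ⟨r, 0, 0, by simp⟩
    | add z w _ _ h₁ h₂ =>
      obtain ⟨r, s, t, rfl⟩ := h₁
      obtain ⟨r', s', t', rfl⟩ := h₂
      exact ⟨r + r', s + s', t + t', by rw [map_add, Subring.coe_add, Subring.coe_add]; ring⟩
    | mul z w hz hw h₁ h₂ =>
      obtain ⟨r, s, t, h⟩ := h₁
      obtain ⟨r', s', t', h'⟩ := h₂
      refine ⟨r * r', s * ⟨w, hw⟩ + ⟨algebraMap k F r, hkB r⟩ * s',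
        t * ⟨w, hw⟩ + ⟨algebraMap k F r, hkB r⟩ * t', ?_⟩
      simp only [map_mul, Subring.coe_add, Subring.coe_mul]
      rw [h]
      linear_combination (algebraMap k F r) * h'
  have hker : originIdeal k a b = RingHom.ker ε := by
    apply le_antisymm
    · refine Ideal.span_le.2 ?_
      rintro _ (rfl | rfl)
      · exact hεa
      · exact hεb
    · rintro ⟨z, hz⟩ h
      obtain ⟨r, s, t, hrst⟩ := key z hz
      have h₁ : (⟨z, hz⟩ : B) = ⟨algebraMap k F r, hkB r⟩ + s * ⟨a, haB⟩ + t * ⟨b, hbB⟩ :=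
        Subtype.ext hrst
      have hr : r = 0 := by
        have h₂ := RingHom.mem_ker.1 h
        rw [h₁, map_add, map_add, map_mul, map_mul, hεk, hεa, hεb] at h₂
        simpa using h₂
      refine Ideal.mem_span_pair.2 ⟨s, t, Subtype.ext ?_⟩
      have : z = s * a + t * b := by rw [hrst, hr]; simp
      exact this.symm
  rw [hker]
  exact RingHom.ker_isPrime ε

variable (k) (p c : ℕ)

instance isPrime_originIdeal_xy : (originIdeal k (xVar k) (yVar k)).IsPrime :=
  isPrime_originIdeal (AlgHom.id k _) _ _ (MvPolynomial.X 0) (MvPolynomial.X 1)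
    (by simp) (by simp) rfl rfl

instance isPrime_originIdeal_xv [hp : Fact p.Prime] :
    (originIdeal k (xOne k p c) (vOne k p c)).IsPrime :=
  isPrime_originIdeal (KOne k p c).val _ _ (MvPolynomial.X 0)
    (MvPolynomial.X 1 ^ p - MvPolynomial.X 0 ^ c * MvPolynomial.X 1)
    (by simp) (by simp [hp.out.ne_zero]) rfl (by simp [vOne, vElt, xVar, yVar])

/-- `S = k[x, y]_(x, y)`. -/
def ringS : LocalSubring (TopField k) :=
  LocalSubring.ofPrime (Algebra.adjoin k {xVar k, yVar k}).toSubring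
    (originIdeal k (xVar k) (yVar k))

/-- `A = k[x, v]_(x, v)`, a local ring of `K₁`. -/
def ringA [Fact p.Prime] : LocalSubring (KOne k p c) :=
  LocalSubring.ofPrime (Algebra.adjoin k {xOne k p c, vOne k p c}).toSubring
    (originIdeal k (xOne k p c) (vOne k p c))

end Origin

/-! ### The generating sequences -/

section Sequences

variable (k : Type*) [Field k] (p c : ℕ)

/-- The exponents `p ^ 2` for the sequence in `S`. -/
def nS (_ : ℕ) : ℕ := p ^ 2

/-- The exponents `p ^ (2 j - 2)` for the sequence in `S` (used for `j ≥ 2`). -/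
def eS (j : ℕ) : ℕ := p ^ (2 * j - 2)

/-- The exponents `p` (`j` odd) and `p ^ 3` (`j` even) for the sequence in `A`. -/
def nA (j : ℕ) : ℕ := if Odd j then p else p ^ 3

/-- The exponents `p ^ (2 j - 2)` (`j` odd) and `p ^ (2 j - 1)` (`j` even) for the sequence in `A`
(used for `j ≥ 2`). -/
def eA (j : ℕ) : ℕ := if Odd j then p ^ (2 * j - 2) else p ^ (2 * j - 1)

/-- `Q₀ = x`, `Q₁ = y`, `Q₂ = y ^ (p ^ 2) - x`,
`Q_{j+1} = Q_j ^ (p ^ 2) - x ^ (p ^ (2 j - 2)) Q_{j-1}` for `j ≥ 2`. -/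
def seqQ : ℕ → TopField k := keySeq (nS p) (eS p) (xVar k) (yVar k)

/-- `U₀ = x`, `U₁ = v`, `U₂ = v ^ p - x`, and for `j ≥ 2`
`U_{j+1} = U_j ^ p - x ^ (p ^ (2 j - 2)) U_{j-1}` if `j` is odd,
`U_{j+1} = U_j ^ (p ^ 3) - x ^ (p ^ (2 j - 1)) U_{j-1}` if `j` is even. -/
def seqU : ℕ → KOne k p c := keySeq (nA p) (eA p) (xOne k p c) (vOne k p c)

/-- The regular parameter `x_{S_j}`. -/
def xS (j : ℕ) : TopField k := firstParam (eS p) (seqQ k p) j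

/-- The regular parameter `y_{S_j}`. -/
def yS (j : ℕ) : TopField k := secondParam (eS p) (seqQ k p) j

/-- The regular parameter `x_{A_j}`. -/
def xA (j : ℕ) : KOne k p c := firstParam (eA p) (seqU k p c) j

/-- The regular parameter `v_{A_j}`. -/
def vA (j : ℕ) : KOne k p c := secondParam (eA p) (seqU k p c) j

/-- The exponent `α_j`: `1` if `j` is even and `0` if `j` is odd. -/
def alphaExp (j : ℕ) : ℕ := if Even j then 1 else 0

/-- The exponent `β_j`: `0` if `j` is even and `1` if `j` is odd. -/
def betaExp (j : ℕ) : ℕ := if Even j then 0 else 1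

end Sequences

end

end DefectTower

/-!
Both towers of quadratic transforms are governed by the same combinatorial pattern, recorded in
`IsKeyExponents`: exponents `n j` that are powers of `p` of period two, and `e j = n 2 ⋯ n j`. A
sequence `Q` in a local ring with the recursion `keySeq` and the values `keyValue` of such exponents
(`IsKeySequence`) is a generating sequence: since the value of the `j`-th member has exact
denominator `n 1 ⋯ n j`, monomials with exponents below `n j` have distinct values, and every
monomial reduces to such a one modulo higher values
(`IsKeySequence.isValuationGeneratedBy`). Moreover the `j`-th second parameter `y` and the first
parameter `x` satisfy `y ^ n * w = x (1 + y')` with a unit `w` and the next second parameter `y'`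
(`IsKeySequence.secondParam_pow_mul`), so that `n` quadratic transforms lead from `x, y` to `y, y'`
(`IsKeySequence.generatesCenter_stage`). All rings in such a sequence are localizations of
polynomial rings `k[a, b]` at the origin (`IsModel`), hence regular and factorial of dimension two.

The valuation of `k(x, y)` is unique because a generating sequence determines the values on `S`. It
exists by an embedding of `k(x, y)` into Hahn series that sends `x` to the variable and `y` to
`∑ C_{m - 1} X ^ (p⁻² + p⁻⁶ + ⋯ + p ^ (2 - 4 m))` with the Catalan numbers `C_m`. The Frobenius map
shifts these exponents, so `Q_j` becomes the series with the coefficients of `λ ^ j`, where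
`λ ^ 2 + X = λ` (`keySeq_catHahn`), and its order is the required one. The series is transcendental
since the values of the `Q_j` have unbounded denominators (`transcendental_of_denominators`).

Let `ε_j = p` for odd `j` and `ε_j = 1` for even `j`. Frobenius turns the recursion for `Q` into the
one for `U`: the `ε_j`-th powers of the `Q_j` satisfy the recursion of the `U_j` with `y ^ p` in
place of `v` (`pow_powExp_keySeq`). As `v - y ^ p = -x ^ c y` has weight at least one, `U_j` differs from
`Q_j ^ ε_j` only by terms of larger value (`keySeq_sub_keySeq_mem`), which are divisible by
`x_{S_i} Q_j ^ ε_j` in the rings `S_i` that matter. This gives the values of the `U_j` and the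
formulas for the parameters (`exists_params_eq`). The same perturbation argument applied to the
generator `y ↦ y + x ^ d`, `c = (p - 1) d`, of the Galois group of `K*` over `K₁` shows that it
preserves the valuation (`val_shift`), and so it maps every `S_j` into itself.

By the formulas, `S_j` dominates `A_j` and the maximal ideal of `S_j` is the only prime ideal over
that of `A_j`. A fraction `g / h` of `A_j` in lowest terms that lies in `S_j` has a unit `h`, as
otherwise a prime ideal of height one of `S_j` would lie over the maximal ideal of `A_j`
(`dvd_of_map_eq_mul`). So `S_j ∩ K₁ = A_j`, hence `S_j` is integral over `A_j`, and it is finite as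
it is generated by two elements (`finite_stage`). Finally the values of the first parameters determine
`ā p ^ α_j`, and since `ā` is independent of `j`, both `ā` and `α_j`; the exponents `b_j` and `β_j`
are determined because no power of `y_{S_j}` is divisible by `x_{S_j}`
(`IsStableForm.exponents_eq`).
-/

namespace DefectTower

noncomputable section

/-! ### Local rings at the centre of a valuation -/

section Center

variable {F : Type*} [Field F] {ν : AddValuation F (WithTop ℚ)}

theorem exists_val_eq_coe (ν : AddValuation F (WithTop ℚ)) {f : F} (hf : f ≠ 0) :
    ∃ q : ℚ, ν f = q :=
  ⟨_, (WithTop.coe_untop _ ((AddValuation.ne_top_iff ν).2 hf)).symm⟩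

theorem ne_zero_of_val {f : F} {q : ℚ} (h : ν f = q) : f ≠ 0 := by
  rintro rfl
  rw [AddValuation.map_zero] at h
  exact WithTop.coe_ne_top h.symm

theorem val_mul {f g : F} {q r : ℚ} (hf : ν f = q) (hg : ν g = r) :
    ν (f * g) = ((q + r : ℚ) : WithTop ℚ) := by
  rw [AddValuation.map_mul, hf, hg, WithTop.coe_add]

theorem val_pow {f : F} {q : ℚ} (hf : ν f = q) (n : ℕ) :
    ν (f ^ n) = ((n * q : ℚ) : WithTop ℚ) := by
  rw [AddValuation.map_pow, hf, ← WithTop.coe_nsmul, nsmul_eq_mul]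

theorem val_div {f g : F} {q r : ℚ} (hf : ν f = q) (hg : ν g = r) :
    ν (f / g) = ((q - r : ℚ) : WithTop ℚ) := by
  have hg0 := ne_zero_of_val hg
  obtain ⟨s, hs⟩ := exists_val_eq_coe ν (div_ne_zero (ne_zero_of_val hf) hg0)
  have h := val_mul hs hg
  rw [div_mul_cancel₀ _ hg0, hf, WithTop.coe_eq_coe] at h
  rw [hs, h, add_sub_cancel_right]

theorem val_inv_of_val_eq_zero {f : F} (hf : ν f = 0) : ν f⁻¹ = 0 := by
  have h := val_div (f := 1) (g := f) (q := 0) (r := 0) (AddValuation.map_one ν) hf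
  rwa [one_div, sub_zero] at h

theorem le_val_div {f g : F} {q r : ℚ} (hf : (q : WithTop ℚ) ≤ ν f) (hg : ν g = r) :
    ((q - r : ℚ) : WithTop ℚ) ≤ ν (f / g) := by
  rcases eq_or_ne f 0 with rfl | h
  · rw [zero_div, AddValuation.map_zero]
    exact le_top
  · obtain ⟨s, hs⟩ := exists_val_eq_coe ν h
    rw [hs, WithTop.coe_le_coe] at hf
    rw [val_div hs hg, WithTop.coe_le_coe]
    linarith

theorem val_div_nonneg {f g : F} (hg : g ≠ 0) (h : ν g ≤ ν f) : 0 ≤ ν (f / g) := by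
  obtain ⟨r, hr⟩ := exists_val_eq_coe ν hg
  have := le_val_div (hr ▸ h) hr
  rwa [sub_self] at this

theorem val_eq_zero_of_sub {f g : F} (hg : ν g = 0) (h : 0 < ν (f - g)) : ν f = 0 := by
  rw [← hg]
  exact AddValuation.map_eq_of_lt_sub ν (by rwa [hg])

theorem val_one_add {f : F} (h : 0 < ν f) : ν (1 + f) = 0 :=
  val_eq_zero_of_sub (g := 1) (AddValuation.map_one ν) (by rwa [add_sub_cancel_left])

theorem val_mul_pos {f g : F} (hf : 0 ≤ ν f) (hg : 0 < ν g) : 0 < ν (f * g) := by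
  rw [AddValuation.map_mul]
  exact hg.trans_le (le_add_of_nonneg_left hf)

/-- Domination by the valuation ring in terms of values: the values on `R` are nonnegative, and the
elements of value zero are units. -/
theorem le_valuationRing_iff (R : LocalSubring F) :
    R ≤ (valuationRing ν).toLocalSubring ↔
      (∀ f ∈ R.toSubring, 0 ≤ ν f) ∧ ∀ f ∈ R.toSubring, ν f = 0 → f⁻¹ ∈ R.toSubring := by
  constructor
  · rintro ⟨h, hloc⟩
    refine ⟨fun f hf => h hf, fun f hf h0 => ?_⟩
    have hf0 : f ≠ 0 := ne_zero_of_val (q := 0) h0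
    have hu : IsUnit (Subring.inclusion h ⟨f, hf⟩) := by
      refine IsUnit.of_mul_eq_one
        (⟨f⁻¹, (val_inv_of_val_eq_zero h0).ge⟩ : (valuationRing ν).toSubring) ?_
      exact Subtype.ext (mul_inv_cancel₀ hf0)
    obtain ⟨w, hw⟩ := (hloc.map_nonunit _ hu).exists_right_inv
    rw [inv_eq_of_mul_eq_one_right (congrArg Subtype.val hw : f * w = 1)]
    exact w.2
  · rintro ⟨h, hinv⟩
    refine ⟨fun f hf => h f hf, ⟨fun ⟨f, hf⟩ hu => ?_⟩⟩
    obtain ⟨⟨w, hw'⟩, hw⟩ := hu.exists_right_inv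
    have hw : f * w = 1 := congrArg Subtype.val hw
    have hf0 : f ≠ 0 := left_ne_zero_of_mul_eq_one hw
    obtain ⟨q, hq⟩ := exists_val_eq_coe ν hf0
    obtain ⟨r, hr⟩ := exists_val_eq_coe ν (right_ne_zero_of_mul_eq_one hw)
    have hqr := val_mul hq hr
    rw [hw, AddValuation.map_one, ← WithTop.coe_zero, WithTop.coe_eq_coe] at hqr
    have h1 : (0 : WithTop ℚ) ≤ ν f := h f hf
    have h2 : (0 : WithTop ℚ) ≤ ν w := hw'
    rw [hq, ← WithTop.coe_zero, WithTop.coe_le_coe] at h1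
    rw [hr, ← WithTop.coe_zero, WithTop.coe_le_coe] at h2
    have h3 : ν f = 0 := by
      rw [hq, ← WithTop.coe_zero, WithTop.coe_eq_coe]
      linarith
    exact IsUnit.of_mul_eq_one (⟨f⁻¹, hinv f hf h3⟩ : R.toSubring)
      (Subtype.ext (mul_inv_cancel₀ hf0))

theorem val_nonneg_of_mem {R : LocalSubring F} (h : R ≤ (valuationRing ν).toLocalSubring) {f : F}
    (hf : f ∈ R.toSubring) : 0 ≤ ν f :=
  ((le_valuationRing_iff R).1 h).1 f hf

theorem inv_mem_of_val_eq_zero {R : LocalSubring F} (h : R ≤ (valuationRing ν).toLocalSubring)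
    {f : F} (hf : f ∈ R.toSubring) (h0 : ν f = 0) : f⁻¹ ∈ R.toSubring :=
  ((le_valuationRing_iff R).1 h).2 f hf h0

theorem isUnit_iff_val_eq_zero {R : LocalSubring F} (h : R ≤ (valuationRing ν).toLocalSubring)
    (f : R.toSubring) : IsUnit f ↔ ν (f : F) = 0 := by
  constructor
  · intro hu
    obtain ⟨w, hw⟩ := hu.exists_right_inv
    have h1 := congrArg (fun z : R.toSubring => ν (z : F)) hw
    simp only [Subring.coe_mul, AddValuation.map_mul, Subring.coe_one, AddValuation.map_one] at h1
    exact le_antisymm (h1 ▸ le_add_of_nonneg_right (val_nonneg_of_mem h w.2))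
      (val_nonneg_of_mem h f.2)
  · intro h0
    exact IsUnit.of_mul_eq_one (⟨_, inv_mem_of_val_eq_zero h f.2 h0⟩ : R.toSubring)
      (Subtype.ext (mul_inv_cancel₀ (ne_zero_of_val (q := 0) h0)))

theorem mem_maximalIdeal_iff_val_pos {R : LocalSubring F}
    (h : R ≤ (valuationRing ν).toLocalSubring) (f : R.toSubring) :
    f ∈ maximalIdeal R.toSubring ↔ 0 < ν (f : F) := by
  rw [mem_maximalIdeal, mem_nonunits_iff, isUnit_iff_val_eq_zero h]
  exact ⟨fun h1 => lt_of_le_of_ne (val_nonneg_of_mem h f.2) (Ne.symm h1), fun h1 => h1.ne'⟩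

theorem le_of_toSubring_le {R R' : LocalSubring F} (h : R ≤ (valuationRing ν).toLocalSubring)
    (h' : R' ≤ (valuationRing ν).toLocalSubring) (hle : R.toSubring ≤ R'.toSubring) : R ≤ R' := by
  refine ⟨hle, ⟨fun f hf => ?_⟩⟩
  rw [isUnit_iff_val_eq_zero h]
  exact (isUnit_iff_val_eq_zero h' _).1 hf

/-- The ring of fractions `g / h` with `g, h ∈ B` and `ν h = 0`. If `ν` is nonnegative on `B`, this
is the localization of `B` at the centre of `ν`. -/
def locSubring (ν : AddValuation F (WithTop ℚ)) (B : Subring F) : Subring F where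
  carrier := {f | ∃ g ∈ B, ∃ h ∈ B, ν h = 0 ∧ f = g / h}
  mul_mem' := by
    rintro _ _ ⟨g, hg, h, hh, h0, rfl⟩ ⟨g', hg', h', hh', h0', rfl⟩
    exact ⟨g * g', B.mul_mem hg hg', h * h', B.mul_mem hh hh',
      by rw [AddValuation.map_mul, h0, h0', add_zero], (mul_div_mul_comm g g' h h').symm⟩
  one_mem' := ⟨1, B.one_mem, 1, B.one_mem, AddValuation.map_one ν, (div_one 1).symm⟩
  add_mem' := by
    rintro _ _ ⟨g, hg, h, hh, h0, rfl⟩ ⟨g', hg', h', hh', h0', rfl⟩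
    exact ⟨g * h' + h * g', B.add_mem (B.mul_mem hg hh') (B.mul_mem hh hg'), h * h',
      B.mul_mem hh hh', by rw [AddValuation.map_mul, h0, h0', add_zero],
      div_add_div g g' (ne_zero_of_val (q := 0) h0) (ne_zero_of_val (q := 0) h0')⟩
  zero_mem' := ⟨0, B.zero_mem, 1, B.one_mem, AddValuation.map_one ν, (div_one 0).symm⟩
  neg_mem' := by
    rintro _ ⟨g, hg, h, hh, h0, rfl⟩
    exact ⟨-g, B.neg_mem hg, h, hh, h0, (neg_div h g).symm⟩

theorem le_locSubring (B : Subring F) : B ≤ locSubring ν B := fun f hf =>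
  ⟨f, hf, 1, B.one_mem, AddValuation.map_one ν, (div_one f).symm⟩

theorem val_nonneg_of_mem_locSubring {B : Subring F} (hB : ∀ f ∈ B, 0 ≤ ν f) {f : F}
    (hf : f ∈ locSubring ν B) : 0 ≤ ν f := by
  obtain ⟨g, hg, h, hh, h0, rfl⟩ := hf
  exact val_div_nonneg (ne_zero_of_val (q := 0) h0) (h0 ▸ hB g hg)

theorem inv_mem_locSubring {B : Subring F} {f : F} (hf : f ∈ locSubring ν B) (h0 : ν f = 0) :
    f⁻¹ ∈ locSubring ν B := by
  obtain ⟨g, hg, h, hh, hh0, rfl⟩ := hf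
  refine ⟨h, hh, g, hg, ?_, inv_div g h⟩
  have h1 : h ≠ 0 := ne_zero_of_val (q := 0) hh0
  rw [← div_mul_cancel₀ g h1, AddValuation.map_mul, h0, hh0, add_zero]

theorem locSubring_le {B C : Subring F} (hBC : B ≤ C) (hC : ∀ f ∈ C, ν f = 0 → f⁻¹ ∈ C) :
    locSubring ν B ≤ C := by
  rintro _ ⟨g, hg, h, hh, h0, rfl⟩
  rw [div_eq_mul_inv]
  exact C.mul_mem (hBC hg) (hC h (hBC hh) h0)

theorem locSubring_le_of_le {B C : Subring F} (hBC : B ≤ locSubring ν C) :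
    locSubring ν B ≤ locSubring ν C :=
  locSubring_le hBC fun _ => inv_mem_locSubring

theorem locSubring_le_toSubring {B : Subring F} {R : LocalSubring F}
    (hR : R ≤ (valuationRing ν).toLocalSubring) (hB : B ≤ R.toSubring) :
    locSubring ν B ≤ R.toSubring :=
  locSubring_le hB fun _ => inv_mem_of_val_eq_zero hR

theorem toSubring_ofPrime_eq_locSubring {B : Subring F} (m : Ideal B) [m.IsPrime]
    (hm : ∀ f : B, f ∈ m ↔ ν (f : F) ≠ 0) :
    (LocalSubring.ofPrime B m).toSubring = locSubring ν B := by
  apply le_antisymm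
  · intro f hf
    obtain ⟨⟨g, h⟩, e⟩ := IsLocalization.surj m.primeCompl
      (⟨f, hf⟩ : (LocalSubring.ofPrime B m).toSubring)
    have e' : f * (h : B) = (g : F) := congrArg Subtype.val e
    have h0 : ν ((h : B) : F) = 0 := by
      by_contra hne
      exact h.2 ((hm _).2 hne)
    exact ⟨g, g.2, _, (h : B).2, h0, by rw [← e', mul_div_cancel_right₀ _
      (ne_zero_of_val (q := 0) h0)]⟩
  · refine locSubring_le (LocalSubring.le_ofPrime B m) ?_
    intro f hf h0
    obtain ⟨⟨g, h⟩, e⟩ := IsLocalization.surj m.primeCompl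
      (⟨f, hf⟩ : (LocalSubring.ofPrime B m).toSubring)
    have e' : f * (h : B) = (g : F) := congrArg Subtype.val e
    have hh0 : ν ((h : B) : F) = 0 := by
      by_contra hne
      exact h.2 ((hm _).2 hne)
    have hg : g ∉ m := by
      rw [hm, not_not, ← e', AddValuation.map_mul, h0, hh0, add_zero]
    obtain ⟨w, hw⟩ := (IsLocalization.map_units (LocalSubring.ofPrime B m).toSubring
      (⟨g, hg⟩ : m.primeCompl)).exists_right_inv
    have hw' : (g : F) * w = 1 := congrArg Subtype.val hw
    have : f⁻¹ = (h : B) * (w : F) := by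
      refine inv_eq_of_mul_eq_one_right ?_
      rw [← mul_assoc, e', hw']
    rw [this]
    exact Subring.mul_mem _ (LocalSubring.le_ofPrime B m (h : B).2) w.2

/-- The centre of `ν` on a subring of its valuation ring. -/
def centerIdeal (ν : AddValuation F (WithTop ℚ)) (B : Subring F)
    (hB : B ≤ (valuationRing ν).toSubring) : Ideal B :=
  (maximalIdeal (valuationRing ν).toLocalSubring.toSubring).comap (Subring.inclusion hB)

instance (B : Subring F) (hB : B ≤ (valuationRing ν).toSubring) :
    (centerIdeal ν B hB).IsPrime :=
  Ideal.IsPrime.comap _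

theorem mem_centerIdeal {B : Subring F} (hB : B ≤ (valuationRing ν).toSubring) (f : B) :
    f ∈ centerIdeal ν B hB ↔ 0 < ν (f : F) :=
  mem_maximalIdeal_iff_val_pos (R := (valuationRing ν).toLocalSubring) le_rfl _

theorem ofPrime_le_valuationRing {B : Subring F} (hB : ∀ f ∈ B, 0 ≤ ν f) (m : Ideal B) [m.IsPrime]
    (hm : ∀ f : B, f ∈ m ↔ ν (f : F) ≠ 0) :
    LocalSubring.ofPrime B m ≤ (valuationRing ν).toLocalSubring := by
  rw [le_valuationRing_iff, toSubring_ofPrime_eq_locSubring m hm]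
  exact ⟨fun f => val_nonneg_of_mem_locSubring hB, fun f => inv_mem_locSubring⟩

end Center

/-! ### Quadratic transforms along a valuation -/

section Quadratic

variable {F : Type*} [Field F] {ν : AddValuation F (WithTop ℚ)}

/-- `t` is a nonzero element of the maximal ideal of `R` of least value. -/
def IsMinimalParam (ν : AddValuation F (WithTop ℚ)) (R : LocalSubring F) (t : F) : Prop :=
  t ∈ R.toSubring ∧ t ≠ 0 ∧ 0 < ν t ∧ ∀ z ∈ R.toSubring, 0 < ν z → ν t ≤ ν z

theorem blowupRing_le {R : LocalSubring F} (hR : R ≤ (valuationRing ν).toLocalSubring) {t : F}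
    {C : Subring F} (hC : R.toSubring ≤ C) (h : ∀ z ∈ R.toSubring, 0 < ν z → z / t ∈ C) :
    blowupRing R t ≤ C := by
  refine Subring.closure_le.2 ?_
  rintro w (hw | ⟨z, hz, rfl⟩)
  · exact hC hw
  · exact h z z.2 ((mem_maximalIdeal_iff_val_pos hR z).1 hz)

theorem div_mem_blowupRing {R : LocalSubring F} (hR : R ≤ (valuationRing ν).toLocalSubring)
    {z : F} (t : F) (hz : z ∈ R.toSubring) (h : 0 < ν z) : z / t ∈ blowupRing R t :=
  Subring.subset_closure (Or.inr ⟨⟨z, hz⟩, (mem_maximalIdeal_iff_val_pos hR _).2 h, rfl⟩)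

theorem val_nonneg_of_mem_blowupRing {R : LocalSubring F}
    (hR : R ≤ (valuationRing ν).toLocalSubring) {t : F} (ht : IsMinimalParam ν R t) {f : F}
    (hf : f ∈ blowupRing R t) : 0 ≤ ν f :=
  blowupRing_le (C := (valuationRing ν).toSubring) hR (fun _ h => val_nonneg_of_mem hR h)
    (fun z hz h => val_div_nonneg ht.2.1 (ht.2.2.2 z hz h)) hf

/-- A quadratic transform of `R` along `ν` is `R[m_R / t]` localized at the centre of `ν`, where `t`
has least value in the maximal ideal: the quotients `z / t` must have nonnegative value. -/
theorem IsQuadraticTransform.exists_minimalParam {R R' : LocalSubring F}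
    (hR : R ≤ (valuationRing ν).toLocalSubring) (hR' : R' ≤ (valuationRing ν).toLocalSubring)
    (h : IsQuadraticTransform R R') :
    ∃ t, IsMinimalParam ν R t ∧ R'.toSubring = locSubring ν (blowupRing R t) := by
  obtain ⟨t, ht, ht0, m, hm, -, rfl⟩ := h
  have ht0' : (t : F) ≠ 0 := fun h => ht0 (Subtype.ext h)
  have hle := LocalSubring.le_ofPrime (blowupRing R (t : F)) m
  have hnn : ∀ f ∈ blowupRing R (t : F), 0 ≤ ν f := fun f hf => val_nonneg_of_mem hR' (hle hf)
  refine ⟨t, ⟨t.2, ht0', (mem_maximalIdeal_iff_val_pos hR t).1 ht, fun z hz h => ?_⟩,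
    toSubring_ofPrime_eq_locSubring m fun f => ?_⟩
  · have h1 := hnn _ (div_mem_blowupRing hR (t : F) hz h)
    have h2 : ν z = ν (z / t) + ν (t : F) := by
      rw [← AddValuation.map_mul, div_mul_cancel₀ _ ht0']
    rw [h2]
    exact le_add_of_nonneg_left h1
  · have h1 := IsLocalization.AtPrime.to_map_mem_maximal_iff
      (LocalSubring.ofPrime (blowupRing R (t : F)) m).toSubring m f
    rw [← h1, mem_maximalIdeal_iff_val_pos hR']
    exact ⟨fun h => h.ne', fun h => lt_of_le_of_ne (hnn f f.2) (Ne.symm h)⟩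

/-- The localization of `R[m_R / t]` at the centre does not depend on the choice of `t` of least
value, as two choices differ by a unit of the localization. -/
theorem locSubring_blowupRing_le {R : LocalSubring F} (hR : R ≤ (valuationRing ν).toLocalSubring)
    {s t : F} (hs : IsMinimalParam ν R s) (ht : IsMinimalParam ν R t) :
    locSubring ν (blowupRing R s) ≤ locSubring ν (blowupRing R t) := by
  refine locSubring_le_of_le (blowupRing_le hR ((le_blowupRing R t).trans (le_locSubring _)) ?_)
  intro z hz h
  refine ⟨z / t, div_mem_blowupRing hR t hz h, s / t, div_mem_blowupRing hR t hs.1 hs.2.2.1, ?_,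
    (div_div_div_cancel_right₀ ht.2.1 z s).symm⟩
  obtain ⟨q, hq⟩ := exists_val_eq_coe ν hs.2.1
  have h1 : ν t = q := by
    rw [← hq]
    exact le_antisymm (ht.2.2.2 s hs.1 hs.2.2.1) (hs.2.2.2 t ht.1 ht.2.2.1)
  rw [val_div hq h1, sub_self, WithTop.coe_zero]

theorem IsQuadraticTransform.toSubring_eq {R R' : LocalSubring F}
    (hR : R ≤ (valuationRing ν).toLocalSubring) (hR' : R' ≤ (valuationRing ν).toLocalSubring)
    (h : IsQuadraticTransform R R') {t : F} (ht : IsMinimalParam ν R t) :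
    R'.toSubring = locSubring ν (blowupRing R t) := by
  obtain ⟨s, hs, e⟩ := h.exists_minimalParam hR hR'
  rw [e]
  exact le_antisymm (locSubring_blowupRing_le hR hs ht) (locSubring_blowupRing_le hR ht hs)

theorem IsQuadraticTransform.unique {R R' R'' : LocalSubring F}
    (hR : R ≤ (valuationRing ν).toLocalSubring) (hR' : R' ≤ (valuationRing ν).toLocalSubring)
    (hR'' : R'' ≤ (valuationRing ν).toLocalSubring) (h' : IsQuadraticTransform R R')
    (h'' : IsQuadraticTransform R R'') : R' = R'' := by
  obtain ⟨t, ht, e⟩ := h'.exists_minimalParam hR hR'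
  exact LocalSubring.toSubring_injective (e.trans (h''.toSubring_eq hR hR'' ht).symm)

theorem exists_isQuadraticTransform {R : LocalSubring F}
    (hR : R ≤ (valuationRing ν).toLocalSubring) {t : F} (ht : IsMinimalParam ν R t) :
    ∃ R', IsQuadraticTransform R R' ∧ R' ≤ (valuationRing ν).toLocalSubring := by
  have hnn : ∀ f ∈ blowupRing R t, 0 ≤ ν f := fun f => val_nonneg_of_mem_blowupRing hR ht
  have hle : blowupRing R t ≤ (valuationRing ν).toSubring := hnn
  have hm : ∀ f : blowupRing R t, f ∈ centerIdeal ν _ hle ↔ ν (f : F) ≠ 0 := fun f => by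
    rw [mem_centerIdeal]
    exact ⟨fun h => h.ne', fun h => lt_of_le_of_ne (hnn f f.2) (Ne.symm h)⟩
  refine ⟨LocalSubring.ofPrime _ (centerIdeal ν _ hle), ⟨⟨t, ht.1⟩,
    (mem_maximalIdeal_iff_val_pos hR _).2 ht.2.2.1, fun h => ht.2.1 (congrArg Subtype.val h),
    _, inferInstance, ?_, rfl⟩, ofPrime_le_valuationRing hnn _ hm⟩
  ext z
  rw [Ideal.mem_comap, mem_centerIdeal, mem_maximalIdeal_iff_val_pos hR]
  rfl

theorem IsQuadraticSequence.unique {R₀ : LocalSubring F} {R R' : ℕ → LocalSubring F}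
    (h : IsQuadraticSequence ν R₀ R) (h' : IsQuadraticSequence ν R₀ R') : R = R' := by
  funext i
  induction i with
  | zero => rw [h.1, h'.1]
  | succ i ih =>
    refine (h.2.2 i).unique (h.2.1 i) (h.2.1 (i + 1)) (h'.2.1 (i + 1)) ?_
    rw [ih]
    exact h'.2.2 i

/-- The quadratic sequence of `R₀` along `ν` exists if some property of local rings dominated by
`ν` provides an element of least value in the maximal ideal and passes to quadratic transforms. -/
theorem exists_isQuadraticSequence {R₀ : LocalSubring F} (P : LocalSubring F → Prop) (h₀ : P R₀)
    (hR₀ : R₀ ≤ (valuationRing ν).toLocalSubring)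
    (hmin : ∀ R, R ≤ (valuationRing ν).toLocalSubring → P R → ∃ t, IsMinimalParam ν R t)
    (hP : ∀ R R', R ≤ (valuationRing ν).toLocalSubring → R' ≤ (valuationRing ν).toLocalSubring →
      P R → IsQuadraticTransform R R' → P R') : ∃ R, IsQuadraticSequence ν R₀ R := by
  let T := {R : LocalSubring F // P R ∧ R ≤ (valuationRing ν).toLocalSubring}
  have step : ∀ R : T, ∃ R' : T, IsQuadraticTransform R.1 R'.1 := by
    rintro ⟨R, hPR, hR⟩
    obtain ⟨t, ht⟩ := hmin R hR hPR
    obtain ⟨R', h1, h2⟩ := exists_isQuadraticTransform hR ht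
    exact ⟨⟨R', hP R R' hR h2 hPR h1, h2⟩, h1⟩
  choose next hnext using step
  let seq : ℕ → T := fun i => Nat.rec ⟨R₀, h₀, hR₀⟩ (fun _ R => next R) i
  exact ⟨fun i => (seq i).1, rfl, fun i => (seq i).2.2, fun i => hnext (seq i)⟩

end Quadratic

/-! ### Generators of the maximal ideal under quadratic transforms -/

section Generators

variable {k : Type*} [Field k] {F : Type*} [Field F] [Algebra k F]
  {ν : AddValuation F (WithTop ℚ)}

/-- `ν` is trivial on `k` and its residue field is `k`. -/
structure IsResidueRational (k : Type*) [Field k] {F : Type*} [Field F] [Algebra k F]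
    (ν : AddValuation F (WithTop ℚ)) : Prop where
  val_algebraMap : ∀ c : k, c ≠ 0 → ν (algebraMap k F c) = 0
  exists_residue : ∀ f, 0 ≤ ν f → ∃ c : k, 0 < ν (f - algebraMap k F c)

theorem IsResidueRational.val_algebraMap_nonneg (h : IsResidueRational k ν) (c : k) :
    0 ≤ ν (algebraMap k F c) := by
  rcases eq_or_ne c 0 with rfl | hc
  · rw [map_zero, AddValuation.map_zero]
    exact le_top
  · rw [h.val_algebraMap c hc]

/-- The elements `a`, `b` of the ring `B` have positive value and generate the ideal of all elements
of positive value. -/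
structure GeneratesCenter (ν : AddValuation F (WithTop ℚ)) (B : Subring F) (a b : F) : Prop where
  left_mem : a ∈ B
  right_mem : b ∈ B
  left_pos : 0 < ν a
  right_pos : 0 < ν b
  exists_eq : ∀ f ∈ B, 0 < ν f → ∃ r ∈ B, ∃ s ∈ B, f = r * a + s * b

theorem GeneratesCenter.symm {B : Subring F} {a b : F} (h : GeneratesCenter ν B a b) :
    GeneratesCenter ν B b a where
  left_mem := h.right_mem
  right_mem := h.left_mem
  left_pos := h.right_pos
  right_pos := h.left_pos
  exists_eq f hf h0 := by
    obtain ⟨r, hr, s, hs, e⟩ := h.exists_eq f hf h0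
    exact ⟨s, hs, r, hr, by rw [e, add_comm]⟩

theorem GeneratesCenter.mul_unit {B : Subring F} {a b w : F} (h : GeneratesCenter ν B a b)
    (hw : w ∈ B) (hw' : w⁻¹ ∈ B) (hw0 : ν w = 0) : GeneratesCenter ν B a (w * b) where
  left_mem := h.left_mem
  right_mem := B.mul_mem hw h.right_mem
  left_pos := h.left_pos
  right_pos := val_mul_pos hw0.ge h.right_pos
  exists_eq f hf h0 := by
    obtain ⟨r, hr, s, hs, e⟩ := h.exists_eq f hf h0
    refine ⟨r, hr, s * w⁻¹, B.mul_mem hs hw', ?_⟩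
    rw [e, mul_assoc s, inv_mul_cancel_left₀ (ne_zero_of_val (q := 0) hw0)]

theorem GeneratesCenter.maximalIdeal_eq {R : LocalSubring F} {a b : F}
    (hR : R ≤ (valuationRing ν).toLocalSubring) (h : GeneratesCenter ν R.toSubring a b) :
    maximalIdeal R.toSubring = Ideal.span {⟨a, h.left_mem⟩, ⟨b, h.right_mem⟩} := by
  apply le_antisymm
  · intro f hf
    obtain ⟨r, hr, s, hs, e⟩ := h.exists_eq f f.2 ((mem_maximalIdeal_iff_val_pos hR f).1 hf)
    exact Ideal.mem_span_pair.2 ⟨⟨r, hr⟩, ⟨s, hs⟩, Subtype.ext e.symm⟩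
  · refine Ideal.span_le.2 ?_
    rintro f (rfl | rfl)
    · exact (mem_maximalIdeal_iff_val_pos hR _).2 h.left_pos
    · exact (mem_maximalIdeal_iff_val_pos hR _).2 h.right_pos

theorem GeneratesCenter.isMinimalParam {R : LocalSubring F} {a b : F}
    (hR : R ≤ (valuationRing ν).toLocalSubring) (h : GeneratesCenter ν R.toSubring a b)
    (ha : a ≠ 0) (hab : ν a ≤ ν b) : IsMinimalParam ν R a := by
  refine ⟨h.left_mem, ha, h.left_pos, fun z hz hz0 => ?_⟩
  obtain ⟨r, hr, s, hs, rfl⟩ := h.exists_eq z hz hz0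
  refine AddValuation.map_le_add ν ?_ ?_
  · rw [AddValuation.map_mul]
    exact le_add_of_nonneg_left (val_nonneg_of_mem hR hr)
  · rw [AddValuation.map_mul]
    exact hab.trans (le_add_of_nonneg_left (val_nonneg_of_mem hR hs))

/-- If every generator of the ring `B` is congruent to a constant modulo `(a, b)`, then so is every
element of `B`. -/
theorem exists_eq_algebraMap_add_of_mem_closure {s : Set F} {a b : F}
    (hk : ∀ c : k, algebraMap k F c ∈ Subring.closure s)
    (hs : ∀ f ∈ s, ∃ c : k, ∃ r ∈ Subring.closure s, ∃ t ∈ Subring.closure s,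
      f = algebraMap k F c + r * a + t * b) :
    ∀ f ∈ Subring.closure s, ∃ c : k, ∃ r ∈ Subring.closure s, ∃ t ∈ Subring.closure s,
      f = algebraMap k F c + r * a + t * b := by
  set B := Subring.closure s
  intro f hf
  induction hf using Subring.closure_induction with
  | mem f hf => exact hs f hf
  | zero => exact ⟨0, 0, B.zero_mem, 0, B.zero_mem, by simp⟩
  | one => exact ⟨1, 0, B.zero_mem, 0, B.zero_mem, by simp⟩
  | add f g _ _ hf hg =>
    obtain ⟨c, r, hr, t, ht, rfl⟩ := hf
    obtain ⟨c', r', hr', t', ht', rfl⟩ := hg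
    exact ⟨c + c', r + r', B.add_mem hr hr', t + t', B.add_mem ht ht', by rw [map_add]; ring⟩
  | neg f _ hf =>
    obtain ⟨c, r, hr, t, ht, rfl⟩ := hf
    exact ⟨-c, -r, B.neg_mem hr, -t, B.neg_mem ht, by rw [map_neg]; ring⟩
  | mul f g hf' hg' hf hg =>
    obtain ⟨c, r, hr, t, ht, e⟩ := hf
    obtain ⟨c', r', hr', t', ht', e'⟩ := hg
    refine ⟨c * c', r * g + algebraMap k F c * r', B.add_mem (B.mul_mem hr hg')
      (B.mul_mem (hk c) hr'), t * g + algebraMap k F c * t', B.add_mem (B.mul_mem ht hg')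
      (B.mul_mem (hk c) ht'), ?_⟩
    rw [map_mul, e]
    linear_combination (algebraMap k F c) * e'

theorem generatesCenter_locSubring (hν : IsResidueRational k ν) {B : Subring F} {a b : F}
    (hnn : ∀ f ∈ B, 0 ≤ ν f) (ha : a ∈ B) (hb : b ∈ B) (ha0 : 0 < ν a) (hb0 : 0 < ν b)
    (h : ∀ f ∈ B, ∃ c : k, ∃ r ∈ B, ∃ t ∈ B, f = algebraMap k F c + r * a + t * b) :
    GeneratesCenter ν (locSubring ν B) a b where
  left_mem := le_locSubring B ha
  right_mem := le_locSubring B hb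
  left_pos := ha0
  right_pos := hb0
  exists_eq := by
    rintro _ ⟨g, hg, w, hw, hw0, rfl⟩ h0
    have hw1 := ne_zero_of_val (q := 0) hw0
    have hg0 : 0 < ν g := by
      rwa [← div_mul_cancel₀ g hw1, AddValuation.map_mul, hw0, add_zero]
    obtain ⟨c, r, hr, t, ht, rfl⟩ := h g hg
    have hrt : 0 < ν (r * a + t * b) :=
      AddValuation.map_lt_add ν (val_mul_pos (hnn r hr) ha0) (val_mul_pos (hnn t ht) hb0)
    have hc : c = 0 := by
      by_contra hc
      have h1 := val_eq_zero_of_sub (f := algebraMap k F c + r * a + t * b)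
        (hν.val_algebraMap c hc) (by convert hrt using 2; ring)
      rw [h1] at hg0
      exact lt_irrefl _ hg0
    refine ⟨r / w, ⟨r, hr, w, hw, hw0, rfl⟩, t / w, ⟨t, ht, w, hw, hw0, rfl⟩, ?_⟩
    rw [hc, map_zero]
    field_simp
    ring

theorem blowupRing_eq_closure {R : LocalSubring F} (hR : R ≤ (valuationRing ν).toLocalSubring)
    {a b : F} (h : GeneratesCenter ν R.toSubring a b) (ha : a ≠ 0) :
    blowupRing R a = Subring.closure (insert (b / a) (R.toSubring : Set F)) := by
  apply le_antisymm
  · have hle : R.toSubring ≤ Subring.closure (insert (b / a) (R.toSubring : Set F)) :=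
      fun f hf => Subring.subset_closure (Or.inr hf)
    refine blowupRing_le hR hle fun z hz hz0 => ?_
    obtain ⟨r, hr, s, hs, rfl⟩ := h.exists_eq z hz hz0
    rw [add_div, mul_div_cancel_right₀ r ha, mul_div_assoc]
    exact Subring.add_mem _ (hle hr)
      (Subring.mul_mem _ (hle hs) (Subring.subset_closure (Or.inl rfl)))
  · refine Subring.closure_le.2 ?_
    rintro f (rfl | hf)
    · exact div_mem_blowupRing hR a h.right_mem h.right_pos
    · exact le_blowupRing R a hf

/-- The elements `a`, `b / a - c` generate the maximal ideal of the quadratic transform when `a`, `b`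
generate the maximal ideal of `R`, `ν a ≤ ν b`, and `c ∈ R` has the residue of `b / a`. -/
theorem IsQuadraticTransform.generatesCenter (hν : IsResidueRational k ν) {R R' : LocalSubring F}
    (hR : R ≤ (valuationRing ν).toLocalSubring) (hR' : R' ≤ (valuationRing ν).toLocalSubring)
    (hk : ∀ c : k, algebraMap k F c ∈ R.toSubring)
    (h : IsQuadraticTransform R R') {a b c : F} (hab : GeneratesCenter ν R.toSubring a b)
    (ha : a ≠ 0) (hle : ν a ≤ ν b) (hc : c ∈ R.toSubring) (hpos : 0 < ν (b / a - c)) :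
    GeneratesCenter ν R'.toSubring a (b / a - c) := by
  have hmin := hab.isMinimalParam hR ha hle
  have hnn := fun f => val_nonneg_of_mem_blowupRing (f := f) hR hmin
  rw [h.toSubring_eq hR hR' hmin]
  rw [blowupRing_eq_closure hR hab ha] at hnn ⊢
  set s : Set F := insert (b / a) (R.toSubring : Set F) with hs
  have hRB : ∀ f ∈ R.toSubring, f ∈ Subring.closure s :=
    fun f hf => Subring.subset_closure (Or.inr hf)
  have hba : b / a ∈ Subring.closure s := Subring.subset_closure (Or.inl rfl)
  have hbac : b / a - c ∈ Subring.closure s := Subring.sub_mem _ hba (hRB c hc)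
  have hRa : ∀ f ∈ R.toSubring, ∃ c : k, ∃ r ∈ Subring.closure s,
      f = algebraMap k F c + r * a := by
    intro f hf
    obtain ⟨e, he⟩ := hν.exists_residue f (val_nonneg_of_mem hR hf)
    obtain ⟨r, hr, t, ht, h1⟩ := hab.exists_eq _ (Subring.sub_mem _ hf (hk e)) he
    refine ⟨e, r + t * (b / a), Subring.add_mem _ (hRB r hr)
      (Subring.mul_mem _ (hRB t ht) hba), ?_⟩
    rw [← sub_eq_iff_eq_add', h1]
    field_simp
  refine generatesCenter_locSubring hν hnn (hRB a hab.left_mem) hbac hab.left_pos hpos ?_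
  refine exists_eq_algebraMap_add_of_mem_closure
    (fun c => hRB _ (hk c)) ?_
  rintro f (rfl | hf)
  · obtain ⟨e, r, hr, h1⟩ := hRa c hc
    exact ⟨e, r, hr, 1, Subring.one_mem _, by rw [← h1]; ring⟩
  · obtain ⟨e, r, hr, h1⟩ := hRa f hf
    exact ⟨e, r, hr, 0, Subring.zero_mem _, by rw [zero_mul, add_zero]; exact h1⟩

theorem IsQuadraticTransform.toSubring_le {R R' : LocalSubring F}
    (hR : R ≤ (valuationRing ν).toLocalSubring) (hR' : R' ≤ (valuationRing ν).toLocalSubring)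
    (h : IsQuadraticTransform R R') : R.toSubring ≤ R'.toSubring := by
  obtain ⟨t, -, e⟩ := h.exists_minimalParam hR hR'
  rw [e]
  exact (le_blowupRing R t).trans (le_locSubring _)

theorem IsQuadraticTransform.div_mem {R R' : LocalSubring F}
    (hR : R ≤ (valuationRing ν).toLocalSubring) (hR' : R' ≤ (valuationRing ν).toLocalSubring)
    (h : IsQuadraticTransform R R') {a b : F} (hab : GeneratesCenter ν R.toSubring a b)
    (ha : a ≠ 0) (hle : ν a ≤ ν b) : b / a ∈ R'.toSubring := by
  rw [h.toSubring_eq hR hR' (hab.isMinimalParam hR ha hle)]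
  exact le_locSubring _ (div_mem_blowupRing hR a hab.right_mem hab.right_pos)

end Generators

/-! ### Localized polynomial rings -/

section Model

variable {k : Type*} [Field k] {F : Type*} [Field F] [Algebra k F]
  {ν : AddValuation F (WithTop ℚ)}

/-- `R` is the localization of `k[a, b]` at the centre of `ν`, which is the origin, and `a`, `b`
generate `F` over `k`. When `F` has transcendence degree two, `k[a, b]` is a polynomial ring. -/
structure IsModel (k : Type*) [Field k] {F : Type*} [Field F] [Algebra k F]
    (ν : AddValuation F (WithTop ℚ)) (R : LocalSubring F) (a b : F) : Prop where
  left_pos : 0 < ν a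
  right_pos : 0 < ν b
  adjoin_eq_top : IntermediateField.adjoin k {a, b} = ⊤
  toSubring_eq : R.toSubring = locSubring ν (Algebra.adjoin k {a, b}).toSubring

theorem val_nonneg_of_mem_adjoin (hν : IsResidueRational k ν) {s : Set F} (hs : ∀ f ∈ s, 0 ≤ ν f)
    {f : F} (hf : f ∈ Algebra.adjoin k s) : 0 ≤ ν f := by
  induction hf using Algebra.adjoin_induction with
  | mem f hf => exact hs f hf
  | algebraMap c => exact hν.val_algebraMap_nonneg c
  | add f g _ _ hf hg => exact AddValuation.map_le_add ν hf hg
  | mul f g _ _ hf hg =>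
    rw [AddValuation.map_mul]
    exact add_nonneg hf hg

theorem exists_eq_algebraMap_add_of_mem_adjoin {a b f : F}
    (hf : f ∈ Algebra.adjoin k ({a, b} : Set F)) :
    ∃ c : k, ∃ r ∈ (Algebra.adjoin k ({a, b} : Set F)).toSubring,
      ∃ t ∈ (Algebra.adjoin k ({a, b} : Set F)).toSubring,
      f = algebraMap k F c + r * a + t * b := by
  have hk : ∀ c : k, algebraMap k F c ∈ (Algebra.adjoin k ({a, b} : Set F)).toSubring :=
    fun c => Subalgebra.algebraMap_mem _ c
  have hf' : f ∈ (Algebra.adjoin k ({a, b} : Set F)).toSubring := hf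
  rw [Algebra.adjoin_eq_ring_closure] at hk hf' ⊢
  refine exists_eq_algebraMap_add_of_mem_closure hk ?_ f hf'
  rintro f (⟨c, rfl⟩ | rfl | rfl)
  · exact ⟨c, 0, Subring.zero_mem _, 0, Subring.zero_mem _, by simp⟩
  · exact ⟨0, 1, Subring.one_mem _, 0, Subring.zero_mem _, by simp⟩
  · exact ⟨0, 0, Subring.zero_mem _, 1, Subring.one_mem _, by simp⟩

namespace IsModel

variable {R : LocalSubring F} {a b : F}

theorem symm (h : IsModel k ν R a b) : IsModel k ν R b a where
  left_pos := h.right_pos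
  right_pos := h.left_pos
  adjoin_eq_top := by rw [Set.pair_comm, h.adjoin_eq_top]
  toSubring_eq := by rw [h.toSubring_eq, Set.pair_comm]

theorem val_nonneg (h : IsModel k ν R a b) (hν : IsResidueRational k ν) {f : F}
    (hf : f ∈ Algebra.adjoin k ({a, b} : Set F)) : 0 ≤ ν f := by
  refine val_nonneg_of_mem_adjoin hν ?_ hf
  rintro f (rfl | rfl)
  · exact h.left_pos.le
  · exact h.right_pos.le

theorem adjoin_le (h : IsModel k ν R a b) :
    (Algebra.adjoin k ({a, b} : Set F)).toSubring ≤ R.toSubring :=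
  h.toSubring_eq ▸ le_locSubring _

theorem algebraMap_mem (h : IsModel k ν R a b) (c : k) : algebraMap k F c ∈ R.toSubring :=
  h.adjoin_le (Subalgebra.algebraMap_mem _ c)

theorem le_valuationRing (h : IsModel k ν R a b) (hν : IsResidueRational k ν) :
    R ≤ (valuationRing ν).toLocalSubring := by
  rw [le_valuationRing_iff, h.toSubring_eq]
  exact ⟨fun f => val_nonneg_of_mem_locSubring fun f => h.val_nonneg hν,
    fun f => inv_mem_locSubring⟩

theorem generatesCenter (h : IsModel k ν R a b) (hν : IsResidueRational k ν) :
    GeneratesCenter ν R.toSubring a b := by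
  rw [h.toSubring_eq]
  exact generatesCenter_locSubring hν (fun f => h.val_nonneg hν)
    (Algebra.subset_adjoin (by simp)) (Algebra.subset_adjoin (by simp)) h.left_pos h.right_pos
    fun f => exists_eq_algebraMap_add_of_mem_adjoin

/-- Two generators of a field of transcendence degree at least two are algebraically independent. -/
theorem algebraicIndependent (h : IsModel k ν R a b) (htr : 2 ≤ Algebra.trdeg k F) :
    AlgebraicIndependent k ![a, b] := by
  have hr : Set.range ![a, b] = {a, b} := by simp [Set.pair_comm]
  have : Algebra.IsAlgebraic (Algebra.adjoin k (Set.range ![a, b])) F := by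
    refine ⟨fun f => ?_⟩
    have hf : f ∈ IntermediateField.adjoin k {a, b} := h.adjoin_eq_top ▸ IntermediateField.mem_top
    rw [IntermediateField.mem_adjoin_iff_div, ← hr] at hf
    obtain ⟨r, hr, s, hs, rfl⟩ := hf
    rw [div_eq_mul_inv]
    exact (isAlgebraic_algebraMap (⟨r, hr⟩ : Algebra.adjoin k (Set.range ![a, b]))).mul
      (isAlgebraic_algebraMap (⟨s, hs⟩ : Algebra.adjoin k (Set.range ![a, b]))).inv
  exact (Algebra.IsAlgebraic.isTranscendenceBasis_of_lift_le_trdeg_of_finite k ![a, b]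
    (by simpa using htr)).1

theorem left_ne_zero (h : IsModel k ν R a b) (htr : 2 ≤ Algebra.trdeg k F) : a ≠ 0 :=
  (h.algebraicIndependent htr).ne_zero 0

/-- Under a quadratic transform along `ν`, the coordinates `a`, `b` with `ν a ≤ ν b` are replaced by
`a`, `b / a - c`, where the constant `c` is the residue of `b / a`. -/
theorem exists_quadraticTransform (h : IsModel k ν R a b) (hν : IsResidueRational k ν)
    {R' : LocalSubring F} (hR' : R' ≤ (valuationRing ν).toLocalSubring)
    (hq : IsQuadraticTransform R R') (ha : a ≠ 0) (hle : ν a ≤ ν b) :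
    ∃ c : k, IsModel k ν R' a (b / a - algebraMap k F c) := by
  have hR := h.le_valuationRing hν
  have hgen := h.generatesCenter hν
  obtain ⟨c, hc⟩ := hν.exists_residue (b / a) (val_div_nonneg ha hle)
  have hgen' := hq.generatesCenter hν hR hR' h.algebraMap_mem hgen ha hle (h.algebraMap_mem c) hc
  set b' := b / a - algebraMap k F c with hb'
  have hb : b = a * (b' + algebraMap k F c) := by
    rw [hb']
    field_simp
    ring
  clear_value b'
  have haB : a ∈ Algebra.adjoin k ({a, b'} : Set F) := Algebra.subset_adjoin (by simp)
  have hb'B : b' ∈ Algebra.adjoin k ({a, b'} : Set F) := Algebra.subset_adjoin (by simp)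
  have hcB := Subalgebra.algebraMap_mem (Algebra.adjoin k ({a, b'} : Set F)) c
  have hbB : b ∈ Algebra.adjoin k ({a, b'} : Set F) := by
    rw [hb]
    exact Subalgebra.mul_mem _ haB (Subalgebra.add_mem _ hb'B hcB)
  refine ⟨c, ?_⟩
  rw [← hb']
  refine ⟨h.left_pos, hc, ?_, le_antisymm ?_ ?_⟩
  · rw [eq_top_iff, ← h.adjoin_eq_top, IntermediateField.adjoin_le_iff]
    rintro f (hf | hf)
    · rw [hf]
      exact IntermediateField.subset_adjoin k _ (by simp)
    · rw [hf, hb]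
      refine mul_mem (IntermediateField.subset_adjoin k _ (by simp)) (add_mem
        (IntermediateField.subset_adjoin k _ (by simp)) (IntermediateField.algebraMap_mem _ c))
  · rw [hq.toSubring_eq hR hR' (hgen.isMinimalParam hR ha hle)]
    rw [blowupRing_eq_closure hR hgen ha]
    refine locSubring_le_of_le (Subring.closure_le.2 ?_)
    rintro f (rfl | hf)
    · refine le_locSubring _ ?_
      have : b / a = b' + algebraMap k F c := by rw [hb', sub_add_cancel]
      rw [this]
      exact Subalgebra.add_mem _ hb'B hcB
    · have hf' : f ∈ R.toSubring := hf
      rw [h.toSubring_eq] at hf'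
      refine locSubring_le_of_le (fun g hg => le_locSubring _ ?_) hf'
      refine (Algebra.adjoin_le ?_ : Algebra.adjoin k {a, b} ≤ _) hg
      rintro g (hg | hg)
      · rw [hg]
        exact haB
      · rw [hg]
        exact hbB
  · refine locSubring_le_toSubring hR' ?_
    rw [Algebra.adjoin_eq_ring_closure]
    refine Subring.closure_le.2 ?_
    rintro f (⟨c, rfl⟩ | rfl | rfl)
    · exact hq.toSubring_le hR hR' (h.algebraMap_mem c)
    · exact hgen'.left_mem
    · exact hgen'.right_mem

/-- The elements of `k[X₀, X₁]` whose value at `(a, b)` has value zero under `ν`. -/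
def unitSubmonoid (k : Type*) [Field k] {F : Type*} [Field F] [Algebra k F]
    (ν : AddValuation F (WithTop ℚ)) (a b : F) : Submonoid (MvPolynomial (Fin 2) k) where
  carrier := {P | ν (MvPolynomial.aeval ![a, b] P) = 0}
  mul_mem' := by
    intro P Q (hP : ν _ = 0) (hQ : ν _ = 0)
    rw [Set.mem_ofPred_eq, map_mul, AddValuation.map_mul, hP, hQ, add_zero]
  one_mem' := by rw [Set.mem_ofPred_eq, map_one, AddValuation.map_one]

theorem aeval_mem (h : IsModel k ν R a b) (P : MvPolynomial (Fin 2) k) :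
    MvPolynomial.aeval ![a, b] P ∈ R.toSubring := by
  refine h.adjoin_le ?_
  have : MvPolynomial.aeval ![a, b] P ∈ (MvPolynomial.aeval (R := k) ![a, b]).range := ⟨P, rfl⟩
  rw [← Algebra.adjoin_range_eq_range_aeval] at this
  simpa [Set.pair_comm] using this

theorem exists_aeval_eq {f : F} (hf : f ∈ Algebra.adjoin k ({a, b} : Set F)) :
    ∃ P : MvPolynomial (Fin 2) k, MvPolynomial.aeval ![a, b] P = f := by
  have hr : Set.range ![a, b] = {a, b} := by simp [Set.pair_comm]
  rw [← hr, Algebra.adjoin_range_eq_range_aeval] at hf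
  exact hf

/-- Evaluation at the coordinates, as a homomorphism from the polynomial ring to the local ring. -/
def evalHom (h : IsModel k ν R a b) : MvPolynomial (Fin 2) k →+* R.toSubring :=
  (MvPolynomial.aeval ![a, b] : MvPolynomial (Fin 2) k →ₐ[k] F).toRingHom.codRestrict R.toSubring
    h.aeval_mem

theorem coe_evalHom (h : IsModel k ν R a b) (P : MvPolynomial (Fin 2) k) :
    (h.evalHom P : F) = MvPolynomial.aeval ![a, b] P := rfl

theorem evalHom_injective (h : IsModel k ν R a b) (htr : 2 ≤ Algebra.trdeg k F) :
    Function.Injective h.evalHom := fun _ _ e =>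
  (h.algebraicIndependent htr) (congrArg Subtype.val e)

/-- The local ring is a localization of the polynomial ring, and so Noetherian and factorial. -/
theorem isLocalization (h : IsModel k ν R a b) (hν : IsResidueRational k ν)
    (htr : 2 ≤ Algebra.trdeg k F) :
    letI := h.evalHom.toAlgebra
    IsLocalization (unitSubmonoid k ν a b) R.toSubring := by
  let := h.evalHom.toAlgebra
  refine ⟨fun P => ?_, fun f => ?_, fun e => ⟨1, ?_⟩⟩
  · exact (isUnit_iff_val_eq_zero (h.le_valuationRing hν) (h.evalHom P)).2 P.2
  · obtain ⟨f, hf⟩ := f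
    have hf' := hf
    rw [h.toSubring_eq] at hf'
    obtain ⟨g, hg, w, hw, hw0, rfl⟩ := hf'
    obtain ⟨P, rfl⟩ := exists_aeval_eq hg
    obtain ⟨Q, rfl⟩ := exists_aeval_eq hw
    exact ⟨⟨P, ⟨Q, hw0⟩⟩, Subtype.ext (div_mul_cancel₀ _ (ne_zero_of_val (q := 0) hw0))⟩
  · rw [h.evalHom_injective htr e]

theorem isNoetherianRing (h : IsModel k ν R a b) (hν : IsResidueRational k ν)
    (htr : 2 ≤ Algebra.trdeg k F) : IsNoetherianRing R.toSubring := by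
  let := h.evalHom.toAlgebra
  have := h.isLocalization hν htr
  exact IsLocalization.isNoetherianRing (unitSubmonoid k ν a b) R.toSubring inferInstance

theorem uniqueFactorizationMonoid (h : IsModel k ν R a b) (hν : IsResidueRational k ν)
    (htr : 2 ≤ Algebra.trdeg k F) : UniqueFactorizationMonoid R.toSubring := by
  let := h.evalHom.toAlgebra
  have := h.isLocalization hν htr
  have : IsDomain (MvPolynomial (Fin 2) k) := inferInstance
  exact UniqueFactorizationMonoid.of_isLocalization (unitSubmonoid k ν a b) R.toSubring

theorem prime_left (h : IsModel k ν R a b) (hν : IsResidueRational k ν)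
    (htr : 2 ≤ Algebra.trdeg k F) :
    (Ideal.span {⟨a, (h.generatesCenter hν).left_mem⟩} : Ideal R.toSubring).IsPrime := by
  let := h.evalHom.toAlgebra
  have := h.isLocalization hν htr
  have hX : (Ideal.span {(MvPolynomial.X 0 : MvPolynomial (Fin 2) k)}).IsPrime :=
    (Ideal.span_singleton_prime (MvPolynomial.X_ne_zero 0)).2 MvPolynomial.X_prime
  have hdis : Disjoint (unitSubmonoid k ν a b : Set (MvPolynomial (Fin 2) k))
      (Ideal.span {(MvPolynomial.X 0 : MvPolynomial (Fin 2) k)} : Set _) := by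
    rw [Set.disjoint_left]
    intro P hP hP'
    obtain ⟨Q, rfl⟩ := Ideal.mem_span_singleton'.1 hP'
    have h1 : ν (MvPolynomial.aeval ![a, b] (Q * MvPolynomial.X 0)) = 0 := hP
    rw [map_mul, MvPolynomial.aeval_X] at h1
    have h2 := val_mul_pos (val_nonneg_of_mem (h.le_valuationRing hν) (h.aeval_mem Q)) h.left_pos
    exact h2.ne' h1
  have := IsLocalization.isPrime_of_isPrime_disjoint (unitSubmonoid k ν a b) R.toSubring _ hX hdis
  rw [Ideal.map_span, Set.image_singleton] at this
  have e : (algebraMap (MvPolynomial (Fin 2) k) R.toSubring) (MvPolynomial.X 0) =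
      ⟨a, (h.generatesCenter hν).left_mem⟩ :=
    Subtype.ext ((h.coe_evalHom _).trans (MvPolynomial.aeval_X ![a, b] 0))
  rwa [e] at this

theorem right_notMem_span_left (h : IsModel k ν R a b) (hν : IsResidueRational k ν)
    (htr : 2 ≤ Algebra.trdeg k F) :
    (⟨b, (h.generatesCenter hν).right_mem⟩ : R.toSubring) ∉
      (Ideal.span {⟨a, (h.generatesCenter hν).left_mem⟩} : Ideal R.toSubring) := by
  let := h.evalHom.toAlgebra
  have := h.isLocalization hν htr
  intro hb
  obtain ⟨f, hf⟩ := Ideal.mem_span_singleton'.1 hb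
  obtain ⟨⟨P, Q⟩, e⟩ := IsLocalization.surj (unitSubmonoid k ν a b) f
  have hf' : (f : F) * a = b := congrArg Subtype.val hf
  have e' : (f : F) * MvPolynomial.aeval ![a, b] (Q : MvPolynomial (Fin 2) k) =
    MvPolynomial.aeval ![a, b] P := congrArg Subtype.val e
  have hPQ : MvPolynomial.X 0 * P = MvPolynomial.X 1 * (Q : MvPolynomial (Fin 2) k) := by
    apply h.algebraicIndependent htr
    change MvPolynomial.aeval ![a, b] _ = MvPolynomial.aeval ![a, b] _
    rw [map_mul, map_mul, ← e', MvPolynomial.aeval_X, MvPolynomial.aeval_X]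
    change a * _ = b * _
    rw [mul_left_comm, ← mul_assoc, hf']
  have hdvd : (MvPolynomial.X 0 : MvPolynomial (Fin 2) k) ∣
      MvPolynomial.X 1 * (Q : MvPolynomial (Fin 2) k) := ⟨P, hPQ.symm⟩
  rcases (MvPolynomial.X_prime (R := k) (i := (0 : Fin 2))).dvd_or_dvd hdvd with h1 | ⟨T, hT⟩
  · rw [MvPolynomial.X_dvd_X] at h1
    exact absurd h1 (by decide)
  · have h1 : ν (MvPolynomial.aeval ![a, b] (Q : MvPolynomial (Fin 2) k)) = 0 := Q.2
    rw [hT, mul_comm, map_mul, MvPolynomial.aeval_X] at h1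
    exact (val_mul_pos (val_nonneg_of_mem (h.le_valuationRing hν) (h.aeval_mem T))
      h.left_pos).ne' h1

/-- The chain `0 ⊂ (a) ⊂ m_R` of prime ideals. -/
theorem two_le_height (h : IsModel k ν R a b) (hν : IsResidueRational k ν)
    (htr : 2 ≤ Algebra.trdeg k F) : 2 ≤ (maximalIdeal R.toSubring).height := by
  have hp := h.prime_left hν htr
  have hgen := h.generatesCenter hν
  have h1 : (⊥ : Ideal R.toSubring) < Ideal.span {⟨a, hgen.left_mem⟩} := by
    rw [bot_lt_iff_ne_bot, Ne, Ideal.span_singleton_eq_bot]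
    exact fun h0 => h.left_ne_zero htr (congrArg Subtype.val h0)
  have h2 : Ideal.span {⟨a, hgen.left_mem⟩} < maximalIdeal R.toSubring := by
    refine lt_of_le_of_ne ?_ ?_
    · rw [hgen.maximalIdeal_eq (h.le_valuationRing hν)]
      exact Ideal.span_mono (by simp)
    · intro e
      apply h.right_notMem_span_left hν htr
      rw [e, hgen.maximalIdeal_eq (h.le_valuationRing hν)]
      exact Ideal.subset_span (by simp)
  have h3 := Ideal.height_add_one_le_of_lt_of_isPrime h1
  have h4 := Ideal.height_add_one_le_of_lt_of_isPrime h2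
  rw [Ideal.height_bot, zero_add] at h3
  calc (2 : ℕ∞) = 1 + 1 := by norm_num
    _ ≤ _ := add_le_add_left h3 1
    _ ≤ _ := h4

/-- Any two generators of the maximal ideal are regular parameters, since the dimension is at least
two. -/
theorem isRegularParameters (h : IsModel k ν R a b) (hν : IsResidueRational k ν)
    (htr : 2 ≤ Algebra.trdeg k F) {a' b' : F} (hgen : GeneratesCenter ν R.toSubring a' b') :
    IsRegularParameters R a' b' := by
  have hN := h.isNoetherianRing hν htr
  have hm := hgen.maximalIdeal_eq (h.le_valuationRing hν)
  have hfin : (maximalIdeal R.toSubring).spanFinrank ≤ 2 := by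
    rw [hm]
    refine (Submodule.spanFinrank_span_le_ncard_of_finite (Set.toFinite _)).trans ?_
    exact (Set.ncard_insert_le _ _).trans (by rw [Set.ncard_singleton])
  have hdim : ringKrullDim R.toSubring = (maximalIdeal R.toSubring).height :=
    IsLocalRing.maximalIdeal_height_eq_ringKrullDim.symm
  have h2 : (2 : WithBot ℕ∞) ≤ ringKrullDim R.toSubring := by
    rw [hdim]
    exact WithBot.coe_le_coe.2 (h.two_le_height hν htr)
  have h3 := ringKrullDim_le_spanFinrank_maximalIdeal R.toSubring
  have h4 : ((maximalIdeal R.toSubring).spanFinrank : WithBot ℕ∞) ≤ 2 := by exact_mod_cast hfin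
  exact ⟨IsRegularLocalRing.of_spanFinrank_maximalIdeal_le _ (h4.trans h2),
    le_antisymm (h3.trans h4) h2, hgen.left_mem, hgen.right_mem, hm⟩

end IsModel

/-- A power of one regular parameter is not divisible by the other one. -/
theorem IsRegularParameters.pow_ne_mul {R : LocalSubring F} {a b : F}
    (h : IsRegularParameters R a b) {r b' : R.toSubring} (hb : (b' : F) = b)
    (m : ℕ) (f : R.toSubring) (hr : (r : F) = a) : b' ^ m ≠ f * r := by
  obtain ⟨hreg, hdim, ha, hb', hm⟩ := h
  obtain rfl : r = ⟨a, ha⟩ := Subtype.ext hr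
  obtain rfl : b' = ⟨b, hb'⟩ := Subtype.ext hb
  intro e
  -- A prime ideal over `a` would contain `b` as well, so the maximal ideal would have height one.
  have hmem : (⟨a, ha⟩ : R.toSubring) ∈ maximalIdeal R.toSubring :=
    hm ▸ Ideal.subset_span (by simp)
  have hmin : maximalIdeal R.toSubring ∈ (Ideal.span {(⟨a, ha⟩ : R.toSubring)}).minimalPrimes := by
    refine ⟨⟨inferInstance, ?_⟩, ?_⟩
    · rw [Ideal.span_singleton_le_iff_mem]
      exact hmem
    · rintro P ⟨hP, haP⟩ -
      rw [Ideal.span_singleton_le_iff_mem] at haP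
      have : (⟨b, hb'⟩ : R.toSubring) ∈ P :=
        hP.mem_of_pow_mem m (e ▸ P.mul_mem_left f haP)
      rw [hm, Ideal.span_le]
      rintro z (rfl | rfl) <;> assumption
  have h1 := Ideal.height_le_one_of_isPrincipal_of_mem_minimalPrimes
    (Ideal.span {(⟨a, ha⟩ : R.toSubring)}) _ hmin
  rw [← IsLocalRing.maximalIdeal_height_eq_ringKrullDim] at hdim
  have h2 : (maximalIdeal R.toSubring).height = 2 := WithBot.coe_injective hdim
  rw [h2] at h1
  exact absurd h1 (by decide)

end Model

/-! ### The values of a key sequence -/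

section Exponents

/-- The shape of the exponents of both sequences: the `n j` are powers of `p`, of period two in `j`,
and `e j = n 2 * ⋯ * n j`. -/
structure IsKeyExponents (p : ℕ) (n e : ℕ → ℕ) : Prop where
  prime : p.Prime
  exists_pow : ∀ j, ∃ r, n j = p ^ (r + 1)
  period : ∀ j, n (j + 2) = n j
  e_one : e 1 = 1
  e_succ : ∀ j, e (j + 2) = n (j + 2) * e (j + 1)

/-- The product `n 1 * ⋯ * n j`; the values of the first `j + 1` members of a key sequence have this
common denominator. -/
def partialProd (n : ℕ → ℕ) (j : ℕ) : ℕ := ∏ i ∈ Finset.range j, n (i + 1)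

theorem partialProd_zero (n : ℕ → ℕ) : partialProd n 0 = 1 := rfl

theorem partialProd_succ (n : ℕ → ℕ) (j : ℕ) :
    partialProd n (j + 1) = partialProd n j * n (j + 1) := Finset.prod_range_succ _ _

theorem partialProd_dvd (n : ℕ → ℕ) {i j : ℕ} (h : i ≤ j) : partialProd n i ∣ partialProd n j :=
  Finset.prod_dvd_prod_of_subset _ _ _ (Finset.range_mono h)

namespace IsKeyExponents

variable {p : ℕ} {n e : ℕ → ℕ}

theorem two_le (h : IsKeyExponents p n e) (j : ℕ) : 2 ≤ n j := by
  obtain ⟨r, hr⟩ := h.exists_pow j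
  rw [hr]
  exact h.prime.two_le.trans (Nat.le_self_pow (Nat.succ_ne_zero r) p)

theorem n_pos (h : IsKeyExponents p n e) (j : ℕ) : 0 < n j := two_pos.trans_le (h.two_le j)

theorem cast_pos (h : IsKeyExponents p n e) (j : ℕ) : (0 : ℚ) < n j := Nat.cast_pos.2 (h.n_pos j)

theorem two_le_cast (h : IsKeyExponents p n e) (j : ℕ) : (2 : ℚ) ≤ n j := by
  exact_mod_cast h.two_le j

theorem partialProd_pos (h : IsKeyExponents p n e) (j : ℕ) : 0 < partialProd n j :=
  Finset.prod_pos fun i _ => h.n_pos (i + 1)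

theorem partialProd_cast_pos (h : IsKeyExponents p n e) (j : ℕ) : (0 : ℚ) < partialProd n j :=
  Nat.cast_pos.2 (h.partialProd_pos j)

theorem n_one_mul_keyValue_one (h : IsKeyExponents p n e) : n 1 * keyValue n e 1 = 1 :=
  mul_one_div_cancel (h.cast_pos 1).ne'

theorem n_mul_keyValue (h : IsKeyExponents p n e) (j : ℕ) :
    n (j + 2) * keyValue n e (j + 2) = e (j + 2) + keyValue n e (j + 1) :=
  mul_div_cancel₀ _ (h.cast_pos _).ne'

/-- The excess `ν (Q (j + 2)) - ν (Q (j + 1) ^ n (j + 1))`. -/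
theorem keyValue_succ (h : IsKeyExponents p n e) (j : ℕ) :
    keyValue n e (j + 2) = n (j + 1) * keyValue n e (j + 1) + 1 / partialProd n (j + 2) := by
  induction j with
  | zero =>
    have h1 := h.cast_pos 1
    have h2 := h.cast_pos 2
    rw [h.n_one_mul_keyValue_one]
    simp only [keyValue, partialProd_succ, partialProd_zero, h.e_succ 0, h.e_one]
    push_cast
    field_simp
  | succ j ih =>
    have h3 : (n (j + 3) : ℚ) = n (j + 1) := by rw [h.period (j + 1)]
    have hpos := h.cast_pos (j + 3)
    rw [h.n_mul_keyValue]
    apply mul_left_cancel₀ hpos.ne'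
    rw [h.n_mul_keyValue (j + 1), h.e_succ (j + 1), partialProd_succ n (j + 2), h3]
    push_cast
    rw [h3] at hpos ⊢
    have := h.partialProd_cast_pos (j + 2)
    rw [ih]
    field_simp
    ring

theorem keyValue_pos (h : IsKeyExponents p n e) (j : ℕ) : 0 < keyValue n e j := by
  match j with
  | 0 => exact one_pos
  | 1 => exact one_div_pos.2 (h.cast_pos 1)
  | j + 2 =>
    exact div_pos (add_pos_of_nonneg_of_pos (Nat.cast_nonneg _) (h.keyValue_pos (j + 1)))
      (h.cast_pos _)

theorem n_mul_keyValue_lt (h : IsKeyExponents p n e) (j : ℕ) :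
    n (j + 1) * keyValue n e (j + 1) < keyValue n e (j + 2) := by
  rw [h.keyValue_succ]
  exact lt_add_of_pos_right _ (one_div_pos.2 (h.partialProd_cast_pos _))

theorem pow_two_mul_le_keyValue (h : IsKeyExponents p n e) (j : ℕ) :
    2 ^ j * keyValue n e 1 ≤ keyValue n e (j + 1) := by
  induction j with
  | zero => simp
  | succ j ih =>
    have h1 := mul_le_mul_of_nonneg_right (h.two_le_cast (j + 1)) (h.keyValue_pos (j + 1)).le
    have h2 := h.n_mul_keyValue_lt j
    rw [pow_succ]
    linarith

theorem exists_forall_le_keyValue (h : IsKeyExponents p n e) (γ : ℚ) :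
    ∃ m, ∀ j, m < j → γ ≤ keyValue n e j := by
  have h1 := h.keyValue_pos 1
  obtain ⟨m, hm⟩ := pow_unbounded_of_one_lt (γ / keyValue n e 1) (one_lt_two (α := ℚ))
  refine ⟨m, fun j hj => ?_⟩
  obtain ⟨i, rfl⟩ := Nat.exists_eq_add_of_lt hj
  rw [div_lt_iff₀ h1] at hm
  refine hm.le.trans (le_trans ?_ (h.pow_two_mul_le_keyValue (m + i)))
  exact mul_le_mul_of_nonneg_right (pow_le_pow_right₀ one_le_two (Nat.le_add_right m i)) h1.le

/-- The value of the `j`-th member of a key sequence has the exact denominator `n 1 * ⋯ * n j`. -/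
theorem exists_partialProd_mul_keyValue (h : IsKeyExponents p n e) (j : ℕ) :
    ∃ B : ℕ, partialProd n j * keyValue n e j = B ∧ B.Coprime p := by
  induction j with
  | zero => exact ⟨1, by simp [partialProd_zero, keyValue], Nat.coprime_one_left p⟩
  | succ j ih =>
    cases j with
    | zero =>
      refine ⟨1, ?_, Nat.coprime_one_left p⟩
      simp only [partialProd_succ, partialProd_zero, one_mul, zero_add, Nat.cast_one]
      exact h.n_one_mul_keyValue_one
    | succ j =>
      obtain ⟨B, hB, -⟩ := ih
      obtain ⟨r, hr⟩ := h.exists_pow (j + 1)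
      refine ⟨n (j + 2) * n (j + 1) * B + 1, ?_, ?_⟩
      · have := h.partialProd_cast_pos (j + 2)
        rw [h.keyValue_succ, mul_add, mul_one_div_cancel this.ne', partialProd_succ]
        push_cast
        rw [← hB]
        ring
      · rw [hr, pow_succ, Nat.coprime_comm]
        have : n (j + 2) * (p ^ r * p) * B + 1 = n (j + 2) * p ^ r * B * p + 1 := by ring
        rw [this]
        exact (Nat.coprime_mul_right_add_right _ _ _).2 (Nat.coprime_one_right p)

theorem exists_partialProd_mul_sum (h : IsKeyExponents p n e) (m : ℕ) (f : ℕ → ℕ) :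
    ∃ z : ℕ, (partialProd n m : ℚ) * ∑ i ∈ Finset.range (m + 1), f i * keyValue n e i = z := by
  have key : ∀ i ∈ Finset.range (m + 1), ∃ z : ℕ,
      (partialProd n m : ℚ) * (f i * keyValue n e i) = z := by
    intro i hi
    obtain ⟨B, hB, -⟩ := h.exists_partialProd_mul_keyValue i
    obtain ⟨d, hd⟩ := partialProd_dvd n (Nat.lt_succ_iff.1 (Finset.mem_range.1 hi))
    refine ⟨d * f i * B, ?_⟩
    rw [hd]
    push_cast
    rw [← hB]
    ring
  choose! z hz using key
  exact ⟨∑ i ∈ Finset.range (m + 1), z i, by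
    rw [Finset.mul_sum, Nat.cast_sum]
    exact Finset.sum_congr rfl hz⟩

/-- A sequence of exponents with `f i < n i` for `i ≥ 1` is determined by the value of the
monomial. -/
theorem eq_of_sum_eq (h : IsKeyExponents p n e) {f g : ℕ → ℕ} (hf : ∀ i, f (i + 1) < n (i + 1))
    (hg : ∀ i, g (i + 1) < n (i + 1)) (m : ℕ)
    (hfg : ∑ i ∈ Finset.range m, f i * keyValue n e i =
      ∑ i ∈ Finset.range m, g i * keyValue n e i) : ∀ i < m, f i = g i := by
  induction m with
  | zero => exact fun i hi => absurd hi (Nat.not_lt_zero i)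
  | succ m ih =>
    have hm : f m = g m := by
      cases m with
      | zero =>
        simp only [Finset.sum_range_succ, Finset.sum_range_zero, zero_add, keyValue, mul_one] at hfg
        exact_mod_cast hfg
      | succ m =>
        obtain ⟨B, hB, hBp⟩ := h.exists_partialProd_mul_keyValue (m + 1)
        obtain ⟨a, ha⟩ := h.exists_partialProd_mul_sum m f
        obtain ⟨b, hb⟩ := h.exists_partialProd_mul_sum m g
        rw [Finset.sum_range_succ _ (m + 1), Finset.sum_range_succ _ (m + 1)] at hfg
        have h1 : (f (m + 1) : ℚ) * B + n (m + 1) * a = g (m + 1) * B + n (m + 1) * b := by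
          rw [← ha, ← hb, ← hB, partialProd_succ]
          push_cast
          linear_combination ((partialProd n m : ℚ) * n (m + 1)) * hfg
        have h2 : f (m + 1) * B + n (m + 1) * a = g (m + 1) * B + n (m + 1) * b := by
          exact_mod_cast h1
        obtain ⟨r, hr⟩ := h.exists_pow (m + 1)
        have hcop : (n (m + 1)).gcd B = 1 := by
          rw [hr]
          exact (hBp.pow_right (r + 1)).symm
        have h3 : f (m + 1) * B ≡ g (m + 1) * B [MOD n (m + 1)] := by
          have := congrArg (· % n (m + 1)) h2
          simpa [Nat.ModEq, Nat.add_mul_mod_self_left] using this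
        have h4 := Nat.ModEq.cancel_right_of_coprime hcop h3
        rwa [Nat.ModEq, Nat.mod_eq_of_lt (hf m), Nat.mod_eq_of_lt (hg m)] at h4
    have hlt : ∀ i < m, f i = g i := by
      apply ih
      rw [Finset.sum_range_succ, Finset.sum_range_succ, hm] at hfg
      exact add_right_cancel hfg
    intro i hi
    rcases Nat.lt_succ_iff_lt_or_eq.1 hi with h1 | rfl
    · exact hlt i h1
    · exact hm

end IsKeyExponents

end Exponents

/-! ### Generating sequences -/

section Generating

variable {k : Type*} [Field k] {F : Type*} [Field F] [Algebra k F]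
  {ν : AddValuation F (WithTop ℚ)}

/-- The monomial `Q 0` for `j = 1` and `Q 0 ^ e j * Q (j - 1)` for `j ≥ 2`, so that
`Q (j + 1) = Q j ^ n j - keyDenom e Q j` for `j ≥ 1`. -/
def keyDenom (e : ℕ → ℕ) (Q : ℕ → F) : ℕ → F
  | 0 => 1
  | 1 => Q 0
  | j + 2 => Q 0 ^ e (j + 2) * Q (j + 1)

theorem keySeq_succ (n e : ℕ → ℕ) (a b : F) (j : ℕ) :
    keySeq n e a b (j + 2) =
      keySeq n e a b (j + 1) ^ n (j + 1) - keyDenom e (keySeq n e a b) (j + 1) := by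
  cases j <;> rfl

theorem secondParam_succ (e : ℕ → ℕ) (Q : ℕ → F) (j : ℕ) :
    secondParam e Q (j + 2) = Q (j + 2) / keyDenom e Q (j + 1) := by
  cases j <;> rfl

theorem val_keyDenom {p : ℕ} {n e : ℕ → ℕ} {Q : ℕ → F} (h : IsKeyExponents p n e)
    (hval : ∀ i, ν (Q i) = (keyValue n e i : WithTop ℚ)) (j : ℕ) :
    ν (keyDenom e Q (j + 1)) = ((n (j + 1) * keyValue n e (j + 1) : ℚ) : WithTop ℚ) := by
  cases j with
  | zero =>
    rw [h.n_one_mul_keyValue_one]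
    exact hval 0
  | succ j =>
    rw [h.n_mul_keyValue]
    convert val_mul (val_pow (hval 0) (e (j + 2))) (hval (j + 1)) using 3
    · rfl
    · exact (mul_one _).symm

/-- `Q` is a sequence in `R` that satisfies the recursion of `keySeq` and has the values `keyValue`,
and `Q 0`, `Q 1` generate the maximal ideal of `R`. -/
structure IsKeySequence (k : Type*) [Field k] {F : Type*} [Field F] [Algebra k F]
    (ν : AddValuation F (WithTop ℚ)) (R : LocalSubring F) (n e : ℕ → ℕ) (Q : ℕ → F) : Prop where
  residue : IsResidueRational k ν
  dominated : R ≤ (valuationRing ν).toLocalSubring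
  algebraMap_mem : ∀ c : k, algebraMap k F c ∈ R.toSubring
  generatesCenter : GeneratesCenter ν R.toSubring (Q 0) (Q 1)
  succ : ∀ j, Q (j + 2) = Q (j + 1) ^ n (j + 1) - keyDenom e Q (j + 1)
  val : ∀ j, ν (Q j) = (keyValue n e j : WithTop ℚ)

namespace IsKeySequence

variable {p : ℕ} {n e : ℕ → ℕ} {R : LocalSubring F} {Q : ℕ → F}

theorem mem (h : IsKeySequence k ν R n e Q) (j : ℕ) : Q j ∈ R.toSubring := by
  have h0 := h.generatesCenter.left_mem
  suffices hj : Q j ∈ R.toSubring ∧ Q (j + 1) ∈ R.toSubring from hj.1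
  induction j with
  | zero => exact ⟨h0, h.generatesCenter.right_mem⟩
  | succ j ih =>
    refine ⟨ih.2, ?_⟩
    rw [h.succ]
    refine Subring.sub_mem _ (Subring.pow_mem _ ih.2 _) ?_
    cases j with
    | zero => exact h0
    | succ j => exact Subring.mul_mem _ (Subring.pow_mem _ h0 _) ih.1

/-- The monomial with exponents `f` in the members of the sequence. -/
def monomial (h : IsKeySequence k ν R n e Q) (f : ℕ →₀ ℕ) : R.toSubring :=
  f.prod fun i m => (⟨Q i, h.mem i⟩ : R.toSubring) ^ m

/-- The value of the monomial with exponents `f`. -/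
def monomialValue (n e : ℕ → ℕ) (f : ℕ →₀ ℕ) : ℚ := f.sum fun i m => m * keyValue n e i

theorem coe_monomial (h : IsKeySequence k ν R n e Q) (f : ℕ →₀ ℕ) :
    (h.monomial f : F) = f.prod fun i m => Q i ^ m := by
  rw [monomial, Finsupp.prod, Finsupp.prod, ← Subring.coe_subtype, map_prod]
  rfl

theorem monomial_add (h : IsKeySequence k ν R n e Q) (f g : ℕ →₀ ℕ) :
    h.monomial (f + g) = h.monomial f * h.monomial g :=
  Finsupp.prod_add_index' (fun _ => pow_zero _) (fun _ _ _ => pow_add _ _ _)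

theorem monomial_single (h : IsKeySequence k ν R n e Q) (i m : ℕ) :
    h.monomial (Finsupp.single i m) = (⟨Q i, h.mem i⟩ : R.toSubring) ^ m :=
  Finsupp.prod_single_index (pow_zero _)

theorem monomialValue_add (f g : ℕ →₀ ℕ) :
    monomialValue n e (f + g) = monomialValue n e f + monomialValue n e g :=
  Finsupp.sum_add_index' (fun _ => by rw [Nat.cast_zero, zero_mul])
    (fun _ _ _ => by rw [Nat.cast_add, add_mul])

theorem monomialValue_single (i m : ℕ) :
    monomialValue n e (Finsupp.single i m) = m * keyValue n e i :=
  Finsupp.sum_single_index (by rw [Nat.cast_zero, zero_mul])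

theorem val_monomial (h : IsKeySequence k ν R n e Q) (f : ℕ →₀ ℕ) :
    ν (h.monomial f : F) = (monomialValue n e f : WithTop ℚ) := by
  induction f using Finsupp.induction with
  | zero => exact AddValuation.map_one ν
  | single_add i m f _ _ ih =>
    rw [monomial_add, monomialValue_add, Subring.coe_mul, monomial_single, monomialValue_single]
    exact val_mul (val_pow (h.val i) m) ih

/-- The ideal generated by the monomials of value at least `γ`. -/
def leIdeal (h : IsKeySequence k ν R n e Q) (γ : ℚ) : Ideal R.toSubring :=
  Ideal.span {g | ∃ f, γ ≤ monomialValue n e f ∧ g = h.monomial f}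

/-- The ideal generated by the monomials of value greater than `γ`. -/
def ltIdeal (h : IsKeySequence k ν R n e Q) (γ : ℚ) : Ideal R.toSubring :=
  Ideal.span {g | ∃ f, γ < monomialValue n e f ∧ g = h.monomial f}

theorem monomial_mem_ltIdeal (h : IsKeySequence k ν R n e Q) {γ : ℚ} {f : ℕ →₀ ℕ}
    (hf : γ < monomialValue n e f) : h.monomial f ∈ h.ltIdeal γ :=
  Ideal.subset_span ⟨f, hf, rfl⟩

theorem lt_val_of_mem_ltIdeal (h : IsKeySequence k ν R n e Q) {γ : ℚ} {g : R.toSubring}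
    (hg : g ∈ h.ltIdeal γ) : (γ : WithTop ℚ) < ν (g : F) := by
  induction hg using Submodule.span_induction with
  | mem g hg =>
    obtain ⟨f, hf, rfl⟩ := hg
    rw [h.val_monomial]
    exact WithTop.coe_lt_coe.2 hf
  | zero =>
    rw [Subring.coe_zero, AddValuation.map_zero]
    exact WithTop.coe_lt_top γ
  | add x y _ _ hx hy => exact AddValuation.map_lt_add ν hx hy
  | smul r x _ hx =>
    rw [smul_eq_mul, Subring.coe_mul, AddValuation.map_mul]
    exact hx.trans_le (le_add_of_nonneg_left (val_nonneg_of_mem h.dominated r.2))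

theorem le_val_of_mem_leIdeal (h : IsKeySequence k ν R n e Q) {γ : ℚ} {g : R.toSubring}
    (hg : g ∈ h.leIdeal γ) : (γ : WithTop ℚ) ≤ ν (g : F) := by
  induction hg using Submodule.span_induction with
  | mem g hg =>
    obtain ⟨f, hf, rfl⟩ := hg
    rw [h.val_monomial]
    exact WithTop.coe_le_coe.2 hf
  | zero =>
    rw [Subring.coe_zero, AddValuation.map_zero]
    exact le_top
  | add x y _ _ hx hy => exact AddValuation.map_le_add ν hx hy
  | smul r x _ hx =>
    rw [smul_eq_mul, Subring.coe_mul, AddValuation.map_mul]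
    exact hx.trans (le_add_of_nonneg_left (val_nonneg_of_mem h.dominated r.2))

/-- The exponents of the monomial `keyDenom e Q (i + 1)`. -/
def denomExponents (e : ℕ → ℕ) : ℕ → ℕ →₀ ℕ
  | 0 => Finsupp.single 0 1
  | j + 1 => Finsupp.single 0 (e (j + 2)) + Finsupp.single (j + 1) 1

theorem coe_monomial_denomExponents (h : IsKeySequence k ν R n e Q) (i : ℕ) :
    (h.monomial (denomExponents e i) : F) = keyDenom e Q (i + 1) := by
  cases i with
  | zero => rw [denomExponents, monomial_single, pow_one]; rfl
  | succ j =>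
    rw [denomExponents, monomial_add, monomial_single, monomial_single, pow_one]
    rfl

/-- The degree of the monomial with exponents `f` in all members of the sequence but the first. -/
def positiveDegree (f : ℕ →₀ ℕ) : ℕ := f.sum fun i m => if i = 0 then 0 else m

theorem positiveDegree_add (f g : ℕ →₀ ℕ) :
    positiveDegree (f + g) = positiveDegree f + positiveDegree g :=
  Finsupp.sum_add_index' (fun i => by split_ifs <;> rfl) (fun i _ _ => by split_ifs <;> rfl)

theorem positiveDegree_single (i m : ℕ) :
    positiveDegree (Finsupp.single i m) = if i = 0 then 0 else m :=
  Finsupp.sum_single_index (by split_ifs <;> rfl)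

theorem positiveDegree_denomExponents_le (i : ℕ) : positiveDegree (denomExponents e i) ≤ 1 := by
  cases i with
  | zero => simp [denomExponents, positiveDegree_single]
  | succ j => simp [denomExponents, positiveDegree_add, positiveDegree_single]

theorem monomialValue_denomExponents (hp : IsKeyExponents p n e) (h : IsKeySequence k ν R n e Q)
    (i : ℕ) : monomialValue n e (denomExponents e i) = n (i + 1) * keyValue n e (i + 1) := by
  have h1 := h.val_monomial (denomExponents e i)
  rw [coe_monomial_denomExponents, val_keyDenom hp h.val, WithTop.coe_eq_coe] at h1
  exact h1.symm

/-- Modulo monomials of higher value, every monomial is congruent to one of the same value whose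
exponents satisfy `f i < n i` for `i ≥ 1`: replacing `Q i ^ n i` by `keyDenom e Q i` costs
`Q (i + 1)`, of higher value, and lowers the degree. -/
theorem exists_reduced (hp : IsKeyExponents p n e) (h : IsKeySequence k ν R n e Q) (f : ℕ →₀ ℕ) :
    ∃ g : ℕ →₀ ℕ, (∀ i, g (i + 1) < n (i + 1)) ∧ monomialValue n e g = monomialValue n e f ∧
      h.monomial f - h.monomial g ∈ h.ltIdeal (monomialValue n e f) := by
  induction hd : positiveDegree f using Nat.strong_induction_on generalizing f with
  | _ d ih =>
    by_cases hf : ∀ i, f (i + 1) < n (i + 1)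
    · exact ⟨f, hf, rfl, by rw [sub_self]; exact Ideal.zero_mem _⟩
    push Not at hf
    obtain ⟨i, hi⟩ := hf
    obtain ⟨f₀, rfl⟩ : ∃ f₀, f = f₀ + Finsupp.single (i + 1) (n (i + 1)) :=
      ⟨f - Finsupp.single (i + 1) (n (i + 1)),
        (tsub_add_cancel_of_le (Finsupp.single_le_iff.2 hi)).symm⟩
    have hval : monomialValue n e (f₀ + denomExponents e i) =
        monomialValue n e (f₀ + Finsupp.single (i + 1) (n (i + 1))) := by
      rw [monomialValue_add, monomialValue_add, h.monomialValue_denomExponents hp,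
        monomialValue_single]
    obtain ⟨g, hg, hgv, hgm⟩ := ih _ (by
      rw [← hd, positiveDegree_add, positiveDegree_add, positiveDegree_single,
        if_neg (Nat.succ_ne_zero i)]
      have h1 := positiveDegree_denomExponents_le (e := e) i
      have h2 := hp.two_le (i + 1)
      omega) (f₀ + denomExponents e i) rfl
    rw [hval] at hgv hgm
    refine ⟨g, hg, hgv, ?_⟩
    have h1 : h.monomial (f₀ + Finsupp.single (i + 1) (n (i + 1))) =
        h.monomial (f₀ + denomExponents e i) + h.monomial (f₀ + Finsupp.single (i + 2) 1) := by
      rw [monomial_add, monomial_add, monomial_add, monomial_single, monomial_single, ← mul_add,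
        pow_one]
      congr 1
      apply Subtype.ext
      rw [Subring.coe_add, coe_monomial_denomExponents, Subring.coe_pow]
      change Q (i + 1) ^ _ = _ + Q (i + 2)
      rw [h.succ]
      ring
    rw [h1, add_sub_right_comm]
    refine Ideal.add_mem _ hgm (h.monomial_mem_ltIdeal ?_)
    rw [monomialValue_add, monomialValue_add, monomialValue_single, monomialValue_single]
    have := hp.n_mul_keyValue_lt i
    rw [Nat.cast_one, one_mul]
    linarith

/-- Two monomials of the same value have the same reduced form, as the value determines the reduced
exponents. -/
theorem monomial_sub_monomial_mem (hp : IsKeyExponents p n e) (h : IsKeySequence k ν R n e Q)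
    {f g : ℕ →₀ ℕ} (hfg : monomialValue n e f = monomialValue n e g) :
    h.monomial f - h.monomial g ∈ h.ltIdeal (monomialValue n e f) := by
  obtain ⟨f', hf', hfv, hfm⟩ := h.exists_reduced hp f
  obtain ⟨g', hg', hgv, hgm⟩ := h.exists_reduced hp g
  have heq : f' = g' := by
    have hsum : ∀ s : ℕ →₀ ℕ, ∀ m, s.support ⊆ Finset.range m →
        monomialValue n e s = ∑ i ∈ Finset.range m, s i * keyValue n e i := fun s m hs =>
      Finsupp.sum_of_support_subset _ hs _ (fun i _ => by rw [Nat.cast_zero, zero_mul])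
    obtain ⟨m, hm⟩ := Finset.exists_nat_subset_range (f'.support ∪ g'.support)
    have hmf := Finset.subset_union_left.trans hm
    have hmg := Finset.subset_union_right.trans hm
    have hlt := hp.eq_of_sum_eq hf' hg' m (by
      rw [← hsum f' m hmf, ← hsum g' m hmg, hfv, hgv, hfg])
    ext i
    by_cases hi : i < m
    · exact hlt i hi
    · have h0 : ∀ s : ℕ →₀ ℕ, s.support ⊆ Finset.range m → s i = 0 := fun s hs => by
        by_contra hne
        exact hi (Finset.mem_range.1 (hs (Finsupp.mem_support_iff.2 hne)))
      rw [h0 f' hmf, h0 g' hmg]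
  rw [← hfg] at hgm
  subst heq
  have := Ideal.sub_mem _ hfm hgm
  rwa [sub_sub_sub_cancel_right] at this

theorem mul_monomial_mem_ltIdeal (h : IsKeySequence k ν R n e Q) (hp : IsKeyExponents p n e)
    {r : R.toSubring} (hr : 0 < ν (r : F)) (f : ℕ →₀ ℕ) :
    r * h.monomial f ∈ h.ltIdeal (monomialValue n e f) := by
  obtain ⟨s, hs, t, ht, hst⟩ := h.generatesCenter.exists_eq r r.2 hr
  have h1 : r * h.monomial f = ⟨s, hs⟩ * h.monomial (Finsupp.single 0 1 + f) +
      ⟨t, ht⟩ * h.monomial (Finsupp.single 1 1 + f) := by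
    rw [monomial_add, monomial_add, monomial_single, monomial_single, pow_one, pow_one,
      ← mul_assoc, ← mul_assoc, ← add_mul]
    congr 1
    exact Subtype.ext hst
  rw [h1]
  refine Ideal.add_mem _ (Ideal.mul_mem_left _ _ (h.monomial_mem_ltIdeal ?_))
    (Ideal.mul_mem_left _ _ (h.monomial_mem_ltIdeal ?_)) <;>
  · rw [monomialValue_add, monomialValue_single, Nat.cast_one, one_mul]
    exact lt_add_of_pos_left _ (hp.keyValue_pos _)

/-- The quotient of `leIdeal γ` by `ltIdeal γ` is at most one-dimensional over `k`. -/
theorem exists_sub_mem_ltIdeal (hp : IsKeyExponents p n e) (h : IsKeySequence k ν R n e Q) {γ : ℚ}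
    {g : R.toSubring} (hg : g ∈ h.leIdeal γ) :
    g ∈ h.ltIdeal γ ∨ ∃ (c : k) (f : ℕ →₀ ℕ), monomialValue n e f = γ ∧
      g - ⟨algebraMap k F c, h.algebraMap_mem c⟩ * h.monomial f ∈ h.ltIdeal γ := by
  induction hg using Submodule.span_induction with
  | mem g hg =>
    obtain ⟨f, hf, rfl⟩ := hg
    rcases hf.lt_or_eq with hf | rfl
    · exact Or.inl (h.monomial_mem_ltIdeal hf)
    · refine Or.inr ⟨1, f, rfl, ?_⟩
      have : (⟨algebraMap k F 1, h.algebraMap_mem 1⟩ : R.toSubring) = 1 := Subtype.ext (map_one _)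
      rw [this, one_mul, sub_self]
      exact Ideal.zero_mem _
  | zero => exact Or.inl (Ideal.zero_mem _)
  | add x y _ _ hx hy =>
    rcases hx with hx | ⟨c, f, hf, hx⟩
    · rcases hy with hy | ⟨d, f', hf', hy⟩
      · exact Or.inl (Ideal.add_mem _ hx hy)
      · exact Or.inr ⟨d, f', hf', by rw [add_sub_assoc]; exact Ideal.add_mem _ hx hy⟩
    · rcases hy with hy | ⟨d, f', hf', hy⟩
      · exact Or.inr ⟨c, f, hf, by rw [add_sub_right_comm]; exact Ideal.add_mem _ hx hy⟩
      · refine Or.inr ⟨c + d, f, hf, ?_⟩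
        have h1 := h.monomial_sub_monomial_mem hp (hf'.trans hf.symm)
        rw [hf'] at h1
        have h2 : (⟨algebraMap k F (c + d), h.algebraMap_mem (c + d)⟩ : R.toSubring) =
            ⟨algebraMap k F c, h.algebraMap_mem c⟩ + ⟨algebraMap k F d, h.algebraMap_mem d⟩ :=
          Subtype.ext (map_add _ c d)
        have h3 := Ideal.add_mem _ (Ideal.add_mem _ hx hy) (Ideal.mul_mem_left _
          ⟨algebraMap k F d, h.algebraMap_mem d⟩ h1)
        rw [h2]
        convert h3 using 1
        ring
  | smul r x _ hx =>
    rw [smul_eq_mul]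
    rcases hx with hx | ⟨c, f, hf, hx⟩
    · exact Or.inl (Ideal.mul_mem_left _ _ hx)
    · obtain ⟨d, hd⟩ := h.residue.exists_residue r (val_nonneg_of_mem h.dominated r.2)
      refine Or.inr ⟨d * c, f, hf, ?_⟩
      have h1 := h.mul_monomial_mem_ltIdeal hp
        (r := r - ⟨algebraMap k F d, h.algebraMap_mem d⟩) hd f
      rw [hf] at h1
      have h2 : (⟨algebraMap k F (d * c), h.algebraMap_mem (d * c)⟩ : R.toSubring) =
          ⟨algebraMap k F d, h.algebraMap_mem d⟩ * ⟨algebraMap k F c, h.algebraMap_mem c⟩ :=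
        Subtype.ext (map_mul _ d c)
      have h3 := Ideal.add_mem _ (Ideal.mul_mem_left _ r hx) (Ideal.mul_mem_left _
          ⟨algebraMap k F c, h.algebraMap_mem c⟩ h1)
      rw [h2]
      convert h3 using 1
      ring

/-- If the leading coefficient of `g` in degree `γ` were nonzero, then `g` would have value `γ`. -/
theorem mem_ltIdeal_of_lt_val (hp : IsKeyExponents p n e) (h : IsKeySequence k ν R n e Q) {γ : ℚ}
    {g : R.toSubring} (hg : g ∈ h.leIdeal γ) (hγ : (γ : WithTop ℚ) < ν (g : F)) :
    g ∈ h.ltIdeal γ := by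
  rcases h.exists_sub_mem_ltIdeal hp hg with h1 | ⟨c, f, hf, h1⟩
  · exact h1
  · have hc : c = 0 := by
      by_contra hc
      have h2 := AddValuation.map_lt_add ν hγ
        ((h.lt_val_of_mem_ltIdeal h1).trans_eq (AddValuation.map_neg ν _).symm)
      rw [← sub_eq_add_neg, ← AddSubgroupClass.coe_sub, sub_sub_cancel, Subring.coe_mul,
        AddValuation.map_mul, h.val_monomial,
        h.residue.val_algebraMap c hc, zero_add, hf] at h2
      exact lt_irrefl _ h2
    have h2 : (⟨algebraMap k F c, h.algebraMap_mem c⟩ : R.toSubring) = 0 :=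
      Subtype.ext (by subst hc; exact map_zero _)
    rwa [h2, zero_mul, sub_zero] at h1

/-- The values below `γ` of monomials lie in `N⁻¹ ℤ` for some `N`. -/
theorem exists_denominator (hp : IsKeyExponents p n e) (γ : ℚ) :
    ∃ N : ℕ, 0 < N ∧ ∀ f : ℕ →₀ ℕ, monomialValue n e f < γ →
      ∃ z : ℕ, N * monomialValue n e f = z := by
  obtain ⟨m, hm⟩ := hp.exists_forall_le_keyValue γ
  refine ⟨partialProd n m, hp.partialProd_pos m, fun f hf => ?_⟩
  have hsupp : f.support ⊆ Finset.range (m + 1) := by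
    intro i hi
    by_contra hi'
    rw [Finset.mem_range, Nat.lt_succ_iff, not_le] at hi'
    have h1 : (f i : ℚ) * keyValue n e i ≤ monomialValue n e f :=
      Finset.single_le_sum (f := fun i => (f i : ℚ) * keyValue n e i)
        (fun j _ => mul_nonneg (Nat.cast_nonneg _) (hp.keyValue_pos j).le) hi
    have h2 : (1 : ℚ) ≤ f i := by
      exact_mod_cast Nat.one_le_iff_ne_zero.2 (Finsupp.mem_support_iff.1 hi)
    have h3 := mul_le_mul_of_nonneg_right h2 (hp.keyValue_pos i).le
    have h4 := hm i hi'
    linarith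
  have h1 : monomialValue n e f = ∑ i ∈ Finset.range (m + 1), f i * keyValue n e i :=
    Finsupp.sum_of_support_subset _ hsupp _ (fun i _ => by rw [Nat.cast_zero, zero_mul])
  rw [h1]
  exact hp.exists_partialProd_mul_sum m f

/-- The value of the monomials that are needed to generate `g` can be raised in steps of `1 / N`
until it reaches `γ`, by `mem_ltIdeal_of_lt_val`; below `γ` the values are multiples of `1 / N`. -/
theorem mem_leIdeal_of_le_val (hp : IsKeyExponents p n e) (h : IsKeySequence k ν R n e Q) {γ : ℚ}
    {g : R.toSubring} (hγ : (γ : WithTop ℚ) ≤ ν (g : F)) : g ∈ h.leIdeal γ := by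
  obtain ⟨N, hN, hden⟩ := exists_denominator hp γ
  have hN' : (0 : ℚ) < N := Nat.cast_pos.2 hN
  have step : ∀ i : ℕ, g ∈ h.leIdeal (min (i / N) γ) := by
    intro i
    induction i with
    | zero =>
      have : (1 : R.toSubring) ∈ h.leIdeal (min ((0 : ℕ) / N) γ) := by
        refine Ideal.subset_span ⟨0, ?_, ?_⟩
        · refine (min_le_left _ _).trans ?_
          rw [Nat.cast_zero, zero_div]
          exact (Finsupp.sum_zero_index (h := fun i m => (m : ℚ) * keyValue n e i)).ge
        · exact Finsupp.prod_zero_index.symm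
      rw [← mul_one g]
      exact Ideal.mul_mem_left _ _ this
    | succ i ih =>
      rcases le_or_gt γ (i / N) with hi | hi
      · rw [min_eq_right hi] at ih
        rwa [min_eq_right (hi.trans (div_le_div_of_nonneg_right
          (Nat.cast_le.2 (Nat.le_succ i)) hN'.le))]
      · rw [min_eq_left hi.le] at ih
        have h1 := h.mem_ltIdeal_of_lt_val hp ih ((WithTop.coe_lt_coe.2 hi).trans_le hγ)
        refine Ideal.span_mono ?_ h1
        rintro _ ⟨f, hf, rfl⟩
        refine ⟨f, ?_, rfl⟩
        rcases lt_or_ge (monomialValue n e f) γ with hlt | hge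
        · refine (min_le_left _ _).trans ?_
          obtain ⟨z, hz⟩ := hden f hlt
          rw [div_lt_iff₀ hN', mul_comm, hz] at hf
          rw [div_le_iff₀ hN', mul_comm, hz]
          exact_mod_cast Nat.succ_le_of_lt (Nat.cast_lt.1 hf)
        · exact (min_le_right _ _).trans hge
  obtain ⟨i, hi⟩ := exists_nat_ge (γ * N)
  have := step i
  rwa [min_eq_right ((le_div_iff₀ hN').2 hi)] at this

/-- A sequence with the values `keyValue` is a generating sequence. -/
theorem isGeneratingSequence (hp : IsKeyExponents p n e) (h : IsKeySequence k ν R n e Q) :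
    IsGeneratingSequence ν R Q := by
  refine ⟨fun i => ⟨h.mem i, (mem_maximalIdeal_iff_val_pos h.dominated _).2 ?_⟩, fun γ g => ?_⟩
  · change 0 < ν (Q i)
    rw [h.val]
    exact WithTop.coe_lt_coe.2 (hp.keyValue_pos i)
  · have hset : {g : R.toSubring | (γ : WithTop ℚ) ≤ ν (g : F) ∧
        ∃ f : ℕ →₀ ℕ, (g : F) = f.prod (fun i m => Q i ^ m)} =
        {g | ∃ f, γ ≤ monomialValue n e f ∧ g = h.monomial f} := by
      ext g
      constructor
      · rintro ⟨h1, f, hf⟩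
        rw [← h.coe_monomial] at hf
        refine ⟨f, ?_, Subtype.ext hf⟩
        rwa [hf, h.val_monomial, WithTop.coe_le_coe] at h1
      · rintro ⟨f, hf, rfl⟩
        exact ⟨by rw [h.val_monomial]; exact WithTop.coe_le_coe.2 hf, f, h.coe_monomial f⟩
    rw [hset]
    exact ⟨h.mem_leIdeal_of_le_val hp, h.le_val_of_mem_leIdeal⟩

theorem isValuationGeneratedBy (hp : IsKeyExponents p n e) (h : IsKeySequence k ν R n e Q) :
    IsValuationGeneratedBy k ν R Q (keyValue n e) :=
  ⟨h.residue.val_algebraMap, h.val, h.isGeneratingSequence hp⟩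

end IsKeySequence

/-- A valuation is determined on `R` by a generating sequence and its values. -/
theorem IsValuationGeneratedBy.eq_on {R : LocalSubring F} {Q : ℕ → F} {β : ℕ → ℚ}
    {ν ν' : AddValuation F (WithTop ℚ)} (h : IsValuationGeneratedBy k ν R Q β)
    (h' : IsValuationGeneratedBy k ν' R Q β) (f : F) (hf : f ∈ R.toSubring) : ν f = ν' f := by
  have hmon : ∀ s : ℕ →₀ ℕ, ν (s.prod fun i m => Q i ^ m) = ν' (s.prod fun i m => Q i ^ m) := by
    intro s
    induction s using Finsupp.induction with
    | zero => rw [Finsupp.prod_zero_index, AddValuation.map_one, AddValuation.map_one]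
    | single_add i m s _ _ ih =>
      rw [Finsupp.prod_add_index' (fun _ => pow_zero _) (fun _ _ _ => pow_add _ _ _),
        Finsupp.prod_single_index (h := fun i m => Q i ^ m) (pow_zero _),
        AddValuation.map_mul, AddValuation.map_mul, ih,
        AddValuation.map_pow, AddValuation.map_pow, h.2.1, h'.2.1]
  have hset : ∀ γ : ℚ, {g : R.toSubring | (γ : WithTop ℚ) ≤ ν (g : F) ∧
      ∃ s : ℕ →₀ ℕ, (g : F) = s.prod (fun i m => Q i ^ m)} =
      {g : R.toSubring | (γ : WithTop ℚ) ≤ ν' (g : F) ∧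
      ∃ s : ℕ →₀ ℕ, (g : F) = s.prod (fun i m => Q i ^ m)} := by
    intro γ
    ext g
    refine and_congr_left ?_
    rintro ⟨s, hs⟩
    rw [hs, hmon]
  have hle : ∀ γ : ℚ, (γ : WithTop ℚ) ≤ ν f ↔ (γ : WithTop ℚ) ≤ ν' f := fun γ => by
    rw [h.2.2.2 γ ⟨f, hf⟩, h'.2.2.2 γ ⟨f, hf⟩, hset]
  rcases eq_or_ne f 0 with rfl | h0
  · rw [AddValuation.map_zero, AddValuation.map_zero]
  · obtain ⟨q, hq⟩ := exists_val_eq_coe ν h0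
    obtain ⟨q', hq'⟩ := exists_val_eq_coe ν' h0
    refine le_antisymm ?_ ?_
    · rw [hq]
      exact (hle q).1 hq.ge
    · rw [hq']
      exact (hle q').2 hq'.ge

end Generating

/-! ### Blocks of quadratic transforms -/

section Stages

variable {k : Type*} [Field k] {F : Type*} [Field F] [Algebra k F]
  {ν : AddValuation F (WithTop ℚ)}

theorem IsModel.exists_of_isQuadraticTransform (hν : IsResidueRational k ν)
    (htr : 2 ≤ Algebra.trdeg k F) {R R' : LocalSubring F}
    (hR' : R' ≤ (valuationRing ν).toLocalSubring) (hq : IsQuadraticTransform R R')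
    (h : ∃ a b, IsModel k ν R a b) : ∃ a b, IsModel k ν R' a b := by
  obtain ⟨a, b, h⟩ := h
  rcases le_total (ν a) (ν b) with hab | hab
  · obtain ⟨c, hc⟩ := h.exists_quadraticTransform hν hR' hq (h.left_ne_zero htr) hab
    exact ⟨_, _, hc⟩
  · obtain ⟨c, hc⟩ := h.symm.exists_quadraticTransform hν hR' hq (h.symm.left_ne_zero htr) hab
    exact ⟨_, _, hc⟩

/-- Quadratic transforms along `ν` of a localized polynomial ring are again of this kind, so the
sequence can be continued. -/
theorem IsModel.exists_isQuadraticSequence (hν : IsResidueRational k ν)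
    (htr : 2 ≤ Algebra.trdeg k F) {R : LocalSubring F} {a b : F} (h : IsModel k ν R a b) :
    ∃ A, IsQuadraticSequence ν R A := by
  refine DefectTower.exists_isQuadraticSequence (fun R => ∃ a b, IsModel k ν R a b) ⟨a, b, h⟩
    (h.le_valuationRing hν) ?_ fun R R' _ hR' hP hq =>
      IsModel.exists_of_isQuadraticTransform hν htr hR' hq hP
  rintro R hR ⟨a, b, h⟩
  rcases le_total (ν a) (ν b) with hab | hab
  · exact ⟨a, (h.generatesCenter hν).isMinimalParam hR (h.left_ne_zero htr) hab⟩
  · exact ⟨b, (h.symm.generatesCenter hν).isMinimalParam hR (h.symm.left_ne_zero htr) hab⟩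

theorem IsQuadraticSequence.exists_isModel (hν : IsResidueRational k ν)
    (htr : 2 ≤ Algebra.trdeg k F) {R : LocalSubring F} {A : ℕ → LocalSubring F}
    (hA : IsQuadraticSequence ν R A) {a b : F} (h : IsModel k ν R a b) (i : ℕ) :
    ∃ a b, IsModel k ν (A i) a b := by
  induction i with
  | zero => exact ⟨a, b, hA.1 ▸ h⟩
  | succ i ih => exact IsModel.exists_of_isQuadraticTransform hν htr (hA.2.1 _) (hA.2.2 i) ih

theorem IsQuadraticSequence.toSubring_mono {R : LocalSubring F} {A : ℕ → LocalSubring F}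
    (hA : IsQuadraticSequence ν R A) : Monotone fun i => (A i).toSubring :=
  monotone_nat_of_le_succ fun i => (hA.2.2 i).toSubring_le (hA.2.1 i) (hA.2.1 (i + 1))

theorem IsQuadraticSequence.mem_of_mem {R : LocalSubring F} {A : ℕ → LocalSubring F}
    (hA : IsQuadraticSequence ν R A) {f : F} (hf : f ∈ R.toSubring) (i : ℕ) :
    f ∈ (A i).toSubring := by
  rw [← hA.1] at hf
  exact hA.toSubring_mono (Nat.zero_le i) hf

theorem val_div_pow {x y : F} {q : ℚ} {n : ℕ} (hx : ν x = ((n * q : ℚ) : WithTop ℚ)) (hy : ν y = q)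
    (i : ℕ) : ν (x / y ^ i) = ((n - i : ℚ) * q : ℚ) := by
  rw [val_div hx (val_pow hy i), sub_mul]

/-- If `x`, `y` generate the maximal ideal and `ν x = n ν y`, then the first `n - 1` quadratic
transforms divide `x` by `y`. -/
theorem generatesCenter_div_pow (hν : IsResidueRational k ν) {R : ℕ → LocalSubring F}
    (hR : ∀ i, R i ≤ (valuationRing ν).toLocalSubring)
    (hq : ∀ i, IsQuadraticTransform (R i) (R (i + 1)))
    (hk : ∀ i, ∀ c : k, algebraMap k F c ∈ (R i).toSubring) {x y : F}
    (h : GeneratesCenter ν (R 0).toSubring x y) {n : ℕ} {q : ℚ} (hq0 : 0 < q)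
    (hx : ν x = ((n * q : ℚ) : WithTop ℚ)) (hy : ν y = q) (i : ℕ) (hi : i < n) :
    GeneratesCenter ν (R i).toSubring y (x / y ^ i) := by
  induction i with
  | zero =>
    rw [pow_zero, div_one]
    exact h.symm
  | succ i ih =>
    have hin : (i : ℚ) + 1 < n := by exact_mod_cast hi
    have hpos : 0 < ν (x / y ^ i / y - 0) := by
      rw [sub_zero, div_div, ← pow_succ, val_div_pow hx hy, ← WithTop.coe_zero,
        WithTop.coe_lt_coe]
      push_cast
      exact mul_pos (by linarith) hq0
    have h1 := (hq i).generatesCenter hν (hR i) (hR (i + 1)) (hk i) (ih (by omega))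
      (ne_zero_of_val hy) (by
        rw [val_div_pow hx hy, hy, WithTop.coe_le_coe]
        nlinarith) (Subring.zero_mem _) hpos
    rwa [sub_zero, div_div, ← pow_succ] at h1

/-- If `x`, `y` generate the maximal ideal, `ν x = n ν y` and `w` has the residue of `x / y ^ n`,
then after `n` quadratic transforms the maximal ideal is generated by `y` and `x / y ^ n - w`. -/
theorem generatesCenter_div_pow_sub (hν : IsResidueRational k ν) {R : ℕ → LocalSubring F}
    (hR : ∀ i, R i ≤ (valuationRing ν).toLocalSubring)
    (hq : ∀ i, IsQuadraticTransform (R i) (R (i + 1)))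
    (hk : ∀ i, ∀ c : k, algebraMap k F c ∈ (R i).toSubring) {x y w : F}
    (h : GeneratesCenter ν (R 0).toSubring x y) {n : ℕ} (hn : 0 < n) {q : ℚ} (hq0 : 0 < q)
    (hx : ν x = ((n * q : ℚ) : WithTop ℚ)) (hy : ν y = q) (hw : w ∈ (R 0).toSubring)
    (hpos : 0 < ν (x / y ^ n - w)) :
    GeneratesCenter ν (R n).toSubring y (x / y ^ n - w) ∧ x / y ^ n ∈ (R n).toSubring := by
  obtain ⟨m, rfl⟩ := Nat.exists_eq_succ_of_ne_zero hn.ne'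
  have h1 := generatesCenter_div_pow hν hR hq hk h hq0 hx hy m (Nat.lt_succ_self m)
  have hmono : Monotone fun i => (R i).toSubring :=
    monotone_nat_of_le_succ fun i => (hq i).toSubring_le (hR i) (hR (i + 1))
  have hle : ν y ≤ ν (x / y ^ m) := by
    rw [val_div_pow hx hy, hy, WithTop.coe_le_coe]
    push_cast
    linarith
  have hpow : x / y ^ m / y = x / y ^ (m + 1) := by rw [div_div, ← pow_succ]
  refine ⟨?_, ?_⟩
  · have h2 := (hq m).generatesCenter hν (hR m) (hR (m + 1)) (hk m) h1 (ne_zero_of_val hy) hle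
      (hmono (Nat.zero_le m) hw) (by rwa [hpow])
    rwa [hpow] at h2
  · have h2 := (hq m).div_mem (hR m) (hR (m + 1)) h1 (ne_zero_of_val hy) hle
    rwa [hpow] at h2

/-- The `n` quadratic transforms of `R 0` adjoin no more than `x / y ^ n` and inverses of elements of
value zero. -/
theorem toSubring_le_of_div_pow_mem (hν : IsResidueRational k ν) {R : ℕ → LocalSubring F}
    (hR : ∀ i, R i ≤ (valuationRing ν).toLocalSubring)
    (hq : ∀ i, IsQuadraticTransform (R i) (R (i + 1)))
    (hk : ∀ i, ∀ c : k, algebraMap k F c ∈ (R i).toSubring) {x y : F}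
    (h : GeneratesCenter ν (R 0).toSubring x y) {n : ℕ} {q : ℚ} (hq0 : 0 < q)
    (hx : ν x = ((n * q : ℚ) : WithTop ℚ)) (hy : ν y = q) {C : Subring F}
    (hC : (R 0).toSubring ≤ C) (hCinv : ∀ f ∈ C, ν f = 0 → f⁻¹ ∈ C) (hxy : x / y ^ n ∈ C)
    (i : ℕ) (hi : i ≤ n) : (R i).toSubring ≤ C := by
  induction i with
  | zero => exact hC
  | succ i ih =>
    have h1 := generatesCenter_div_pow hν hR hq hk h hq0 hx hy i hi
    have hin : (i : ℚ) + 1 ≤ n := by exact_mod_cast hi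
    have hle : ν y ≤ ν (x / y ^ i) := by
      rw [val_div_pow hx hy, hy, WithTop.coe_le_coe]
      nlinarith
    have hy0 := ne_zero_of_val hy
    rw [(hq i).toSubring_eq (hR i) (hR (i + 1)) (h1.isMinimalParam (hR i) hy0 hle),
      blowupRing_eq_closure (hR i) h1 hy0]
    refine locSubring_le (Subring.closure_le.2 ?_) hCinv
    rintro f (rfl | hf)
    · obtain ⟨m, rfl⟩ := Nat.exists_eq_add_of_le hi
      have : x / y ^ i / y = x / y ^ (i + 1 + m) * y ^ m := by
        rw [pow_add]
        field_simp
        ring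
      rw [this]
      exact C.mul_mem hxy (C.pow_mem (hC h.right_mem) m)
    · exact ih (by omega) hf

end Stages

/-! ### The regular parameters -/

section Parameters

variable {k : Type*} [Field k] {F : Type*} [Field F] [Algebra k F]
  {ν : AddValuation F (WithTop ℚ)}

theorem stage_one (n : ℕ → ℕ) : stage n 1 = 0 := rfl

theorem stage_succ (n : ℕ → ℕ) (j : ℕ) : stage n (j + 2) = stage n (j + 1) + n (j + 1) :=
  Finset.sum_Ico_succ_top (Nat.le_add_left 1 j) n

namespace IsKeySequence

variable {p : ℕ} {n e : ℕ → ℕ} {R : LocalSubring F} {Q : ℕ → F}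

theorem ne_zero (h : IsKeySequence k ν R n e Q) (j : ℕ) : Q j ≠ 0 := ne_zero_of_val (h.val j)

/-- The second parameter at stage `j` has value `1 / (n 1 * ⋯ * n j)`, so that its power of exponent
`n j` has the value of the first parameter. -/
theorem val_secondParam (hp : IsKeyExponents p n e) (h : IsKeySequence k ν R n e Q) (j : ℕ) :
    ν (secondParam e Q j) = ((1 / partialProd n j : ℚ) : WithTop ℚ) := by
  match j with
  | 0 =>
    rw [partialProd_zero, Nat.cast_one, div_one]
    exact h.val 0
  | 1 =>
    rw [partialProd_succ, partialProd_zero, one_mul]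
    exact h.val 1
  | j + 2 =>
    rw [secondParam_succ, val_div (h.val _) (val_keyDenom hp h.val j), hp.keyValue_succ,
      add_sub_cancel_left]

theorem val_secondParam_pos (hp : IsKeyExponents p n e) (h : IsKeySequence k ν R n e Q) (j : ℕ) :
    0 < ν (secondParam e Q j) := by
  rw [h.val_secondParam hp]
  exact WithTop.coe_lt_coe.2 (one_div_pos.2 (hp.partialProd_cast_pos j))

theorem secondParam_ne_zero (hp : IsKeyExponents p n e) (h : IsKeySequence k ν R n e Q) (j : ℕ) :
    secondParam e Q j ≠ 0 := ne_zero_of_val (h.val_secondParam hp j)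

theorem val_secondParam_eq_mul (hp : IsKeyExponents p n e) (h : IsKeySequence k ν R n e Q) (j : ℕ) :
    ν (secondParam e Q j) = ((n (j + 1) * (1 / partialProd n (j + 1) : ℚ) : ℚ) : WithTop ℚ) := by
  rw [h.val_secondParam hp, partialProd_succ]
  have h1 := hp.cast_pos (j + 1)
  have h2 := hp.partialProd_cast_pos j
  congr 1
  push_cast
  field_simp

theorem keyDenom_ne_zero (h : IsKeySequence k ν R n e Q) (j : ℕ) : keyDenom e Q j ≠ 0 := by
  match j with
  | 0 => exact one_ne_zero
  | 1 => exact h.ne_zero 0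
  | j + 2 => exact mul_ne_zero (pow_ne_zero _ (h.ne_zero 0)) (h.ne_zero _)

theorem one_add_secondParam (h : IsKeySequence k ν R n e Q) (j : ℕ) :
    1 + secondParam e Q (j + 2) = Q (j + 1) ^ n (j + 1) / keyDenom e Q (j + 1) := by
  have := h.keyDenom_ne_zero (j + 1)
  rw [secondParam_succ, h.succ]
  field_simp
  ring

/-- The correction factor in the relation between successive parameters. -/
def paramUnit (e : ℕ → ℕ) (Q : ℕ → F) (j : ℕ) : F := if j < 2 then 1 else 1 + secondParam e Q j

/-- The relation `y ^ n * w = x * (1 + y')` between the parameters `x`, `y` of a ring and the second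
parameter `y'` of the next one; the unit `w` is `1` or `1 + x`. -/
theorem secondParam_pow_mul (hp : IsKeyExponents p n e) (h : IsKeySequence k ν R n e Q) (j : ℕ) :
    secondParam e Q (j + 1) ^ n (j + 1) * paramUnit e Q j =
      secondParam e Q j * (1 + secondParam e Q (j + 2)) := by
  rw [h.one_add_secondParam]
  have hQ := h.ne_zero
  match j with
  | 0 =>
    change Q 1 ^ n 1 * 1 = Q 0 * (Q 1 ^ n 1 / Q 0)
    rw [mul_one, mul_div_cancel₀ _ (hQ 0)]
  | 1 =>
    change (Q 2 / Q 0) ^ n 2 * 1 = Q 1 * (Q 2 ^ n 2 / (Q 0 ^ e 2 * Q 1))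
    have h0 := hQ 0
    have h1 := hQ 1
    rw [hp.e_succ 0, hp.e_one, mul_one, mul_one, zero_add, div_pow]
    field_simp
  | m + 2 =>
    have hw : paramUnit e Q (m + 2) = 1 + secondParam e Q (m + 2) := if_neg (by omega)
    rw [hw, h.one_add_secondParam m, secondParam_succ e Q m, secondParam_succ e Q (m + 1), div_pow]
    have h1 := h.keyDenom_ne_zero (m + 1)
    have h2 := hQ (m + 1)
    have h3 := hQ (m + 2)
    have h0 := hQ 0
    have h4 : keyDenom e Q (m + 3) = (Q 0 ^ e (m + 2)) ^ n (m + 1) * Q (m + 2) := by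
      rw [← pow_mul, mul_comm, ← hp.period (m + 1), mul_comm (e (m + 2)), ← hp.e_succ (m + 1),
        mul_comm]
      rfl
    have h5 : keyDenom e Q (m + 2) = Q 0 ^ e (m + 2) * Q (m + 1) := rfl
    have hn : n (m + 2 + 1) = n (m + 1) := hp.period (m + 1)
    rw [hn, h5, h4, mul_pow]
    field_simp

theorem val_paramUnit (hp : IsKeyExponents p n e) (h : IsKeySequence k ν R n e Q) (j : ℕ) :
    ν (paramUnit e Q j) = 0 := by
  rw [paramUnit]
  split_ifs
  · exact AddValuation.map_one ν
  · exact val_one_add (h.val_secondParam_pos hp j)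

theorem paramUnit_mem {B : Subring F} {j : ℕ} (hB : secondParam e Q j ∈ B) :
    paramUnit e Q j ∈ B := by
  rw [paramUnit]
  split_ifs
  · exact B.one_mem
  · exact B.add_mem B.one_mem hB

theorem secondParam_div_pow (hp : IsKeyExponents p n e) (h : IsKeySequence k ν R n e Q) (j : ℕ) :
    secondParam e Q j / secondParam e Q (j + 1) ^ n (j + 1) =
      paramUnit e Q j / (1 + secondParam e Q (j + 2)) := by
  rw [div_eq_div_iff (pow_ne_zero _ (h.secondParam_ne_zero hp (j + 1)))
    (ne_zero_of_val (q := 0) (val_one_add (h.val_secondParam_pos hp (j + 2)))),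
    ← h.secondParam_pow_mul hp, mul_comm]

theorem generatesCenter_stage_succ (hp : IsKeyExponents p n e) (h : IsKeySequence k ν R n e Q)
    {A : ℕ → LocalSubring F} (hA : IsQuadraticSequence ν R A) (j : ℕ)
    (ih : GeneratesCenter ν (A (stage n (j + 1))).toSubring (secondParam e Q j)
      (secondParam e Q (j + 1))) :
    GeneratesCenter ν (A (stage n (j + 2))).toSubring (secondParam e Q (j + 1))
      (secondParam e Q (j + 2)) := by
  have hk : ∀ i, ∀ c : k, algebraMap k F c ∈ (A i).toSubring := fun i c =>
    hA.mem_of_mem (h.algebraMap_mem c) i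
  set x := secondParam e Q j with hx
  set y := secondParam e Q (j + 1) with hy
  set y' := secondParam e Q (j + 2) with hy'
  set w := paramUnit e Q j with hw
  have hw0 : ν w = 0 := h.val_paramUnit hp j
  have hw1 : w ≠ 0 := ne_zero_of_val (q := 0) hw0
  have hy'0 : 0 < ν y' := h.val_secondParam_pos hp _
  have h1y : ν (1 + y') = 0 := val_one_add hy'0
  have h1y' : 1 + y' ≠ 0 := ne_zero_of_val (q := 0) h1y
  have hdiv : x / y ^ n (j + 1) = w / (1 + y') := h.secondParam_div_pow hp j
  have hsub : x / y ^ n (j + 1) - w = -(w / (1 + y')) * y' := by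
    rw [hdiv]
    field_simp
    ring
  have hwy : ν (w / (1 + y')) = 0 := by
    have := val_div (q := 0) (r := 0) hw0 h1y
    rwa [sub_zero] at this
  have hpos : 0 < ν (x / y ^ n (j + 1) - w) := by
    rw [hsub]
    exact val_mul_pos (by rw [AddValuation.map_neg, hwy]) hy'0
  obtain ⟨h1, h2⟩ := generatesCenter_div_pow_sub h.residue
    (R := fun i => A (stage n (j + 1) + i)) (fun i => hA.2.1 _) (fun i => hA.2.2 _) (fun i => hk _)
    ih (hp.n_pos (j + 1)) (one_div_pos.2 (hp.partialProd_cast_pos (j + 1)))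
    (h.val_secondParam_eq_mul hp j) (h.val_secondParam hp (j + 1)) (paramUnit_mem ih.left_mem) hpos
  rw [← stage_succ] at h1 h2
  have hinv := inv_mem_of_val_eq_zero (hA.2.1 _) h2 (by rw [hdiv, hwy])
  rw [hdiv] at h2 hinv
  have h3 := h1.mul_unit (w := -(w / (1 + y'))⁻¹) (Subring.neg_mem _ hinv)
    (by rw [inv_neg, inv_inv]; exact Subring.neg_mem _ h2)
    (by rw [AddValuation.map_neg]; exact val_inv_of_val_eq_zero hwy)
  rw [hsub] at h3
  convert h3 using 1
  field_simp

/-- The two parameters at stage `j + 1` generate the maximal ideal of the ring reached after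
`n 1 + ⋯ + n j` quadratic transforms. -/
theorem generatesCenter_stage (hp : IsKeyExponents p n e) (h : IsKeySequence k ν R n e Q)
    {A : ℕ → LocalSubring F} (hA : IsQuadraticSequence ν R A) (j : ℕ) :
    GeneratesCenter ν (A (stage n (j + 1))).toSubring (secondParam e Q j)
      (secondParam e Q (j + 1)) := by
  induction j with
  | zero =>
    rw [zero_add, stage_one, hA.1]
    exact h.generatesCenter
  | succ j ih => exact h.generatesCenter_stage_succ hp hA j ih

/-- The ring at the next stage is contained in every subring, closed under inverses of elements of
value zero, that contains the ring at this stage and the second parameter of the next one. -/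
theorem stage_succ_le (hp : IsKeyExponents p n e) (h : IsKeySequence k ν R n e Q)
    {A : ℕ → LocalSubring F} (hA : IsQuadraticSequence ν R A) (j : ℕ) {C : Subring F}
    (hC : (A (stage n (j + 1))).toSubring ≤ C) (hCinv : ∀ f ∈ C, ν f = 0 → f⁻¹ ∈ C)
    (hy : secondParam e Q (j + 2) ∈ C) : (A (stage n (j + 2))).toSubring ≤ C := by
  have hk : ∀ i, ∀ c : k, algebraMap k F c ∈ (A i).toSubring := fun i c =>
    hA.mem_of_mem (h.algebraMap_mem c) i
  have hgen := h.generatesCenter_stage hp hA j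
  rw [stage_succ]
  refine toSubring_le_of_div_pow_mem h.residue
    (R := fun i => A (stage n (j + 1) + i)) (fun i => hA.2.1 _) (fun i => hA.2.2 _) (fun i => hk _)
    hgen (one_div_pos.2 (hp.partialProd_cast_pos (j + 1)))
    (h.val_secondParam_eq_mul hp j) (h.val_secondParam hp (j + 1)) hC hCinv ?_ _ le_rfl
  rw [h.secondParam_div_pow hp, div_eq_mul_inv]
  exact C.mul_mem (paramUnit_mem (hC hgen.left_mem)) (hCinv _ (C.add_mem C.one_mem hy)
    (val_one_add (h.val_secondParam_pos hp _)))

end IsKeySequence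

end Parameters

/-! ### Frobenius on Hahn series -/

section Hahn

variable {k : Type*} [Field k]

theorem support_pow_lt {f : HahnSeries ℚ k} {h : ℚ} (hf : ∀ g ∈ f.support, g < h) (n : ℕ) :
    ∀ g ∈ (f ^ (n + 1)).support, g < (n + 1) * h := by
  induction n with
  | zero => simpa using hf
  | succ n ih =>
    intro g hg
    rw [pow_succ] at hg
    obtain ⟨a, ha, b, hb, rfl⟩ := HahnSeries.support_mul_subset hg
    have h1 := ih a ha
    have h2 := hf b hb
    push_cast
    linarith

theorem lt_support_pow {f : HahnSeries ℚ k} {h : ℚ} (hf : ∀ g ∈ f.support, h < g) (n : ℕ) :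
    ∀ g ∈ (f ^ (n + 1)).support, (n + 1) * h < g := by
  induction n with
  | zero => simpa using hf
  | succ n ih =>
    intro g hg
    rw [pow_succ] at hg
    obtain ⟨a, ha, b, hb, rfl⟩ := HahnSeries.support_mul_subset hg
    have h1 := ih a ha
    have h2 := hf b hb
    push_cast
    linarith

/-- In characteristic `p` the `p ^ r`-th power of a Hahn series is taken termwise: for a given
exponent `h`, split off the terms below and above `h`. -/
theorem coeff_pow_char_pow (p : ℕ) [Fact p.Prime] [CharP k p] (f : HahnSeries ℚ k) (r : ℕ) (h : ℚ) :
    (f ^ p ^ r).coeff ((p ^ r : ℕ) * h) = f.coeff h ^ p ^ r := by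
  have : CharP (HahnSeries ℚ k) p :=
    charP_of_injective_algebraMap (algebraMap k (HahnSeries ℚ k)).injective p
  set f₁ := HahnSeries.truncLT h f with hf₁
  set f₂ := f - f₁ - HahnSeries.single h (f.coeff h) with hf₂
  have hsum : f = f₁ + HahnSeries.single h (f.coeff h) + f₂ := by
    rw [hf₂]
    ring
  have h₁ : ∀ g ∈ f₁.support, g < h := by
    intro g hg
    by_contra hgh
    exact hg (HahnSeries.coeff_truncLT_of_le (not_lt.1 hgh) f)
  have h₂ : ∀ g ∈ f₂.support, h < g := by
    intro g hg
    by_contra hgh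
    rw [HahnSeries.mem_support, hf₂, HahnSeries.coeff_sub, HahnSeries.coeff_sub] at hg
    rcases (not_lt.1 hgh).lt_or_eq with hlt | rfl
    · rw [HahnSeries.coeff_truncLT_of_lt hlt, HahnSeries.coeff_single_of_ne hlt.ne] at hg
      simp at hg
    · rw [HahnSeries.coeff_truncLT_of_le le_rfl, HahnSeries.coeff_single_same] at hg
      simp at hg
  obtain ⟨n, hn⟩ := Nat.exists_eq_succ_of_ne_zero
    (pow_ne_zero r (Fact.out : p.Prime).ne_zero)
  have hpow : f ^ p ^ r = f₁ ^ p ^ r + HahnSeries.single h (f.coeff h) ^ p ^ r + f₂ ^ p ^ r := by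
    conv_lhs => rw [hsum]
    rw [add_pow_char_pow, add_pow_char_pow]
  have hz₁ : (f₁ ^ p ^ r).coeff ((p ^ r : ℕ) * h) = 0 := by
    by_contra hne
    rw [hn] at hne
    have := support_pow_lt h₁ n _ hne
    push_cast at this
    exact lt_irrefl _ this
  have hz₂ : (f₂ ^ p ^ r).coeff ((p ^ r : ℕ) * h) = 0 := by
    by_contra hne
    rw [hn] at hne
    have := lt_support_pow h₂ n _ hne
    push_cast at this
    exact lt_irrefl _ this
  rw [hpow, HahnSeries.coeff_add, HahnSeries.coeff_add, hz₁, hz₂, HahnSeries.single_pow, zero_add,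
    add_zero, nsmul_eq_mul, HahnSeries.coeff_single_same]

/-! ### A Hahn series with Catalan coefficients -/

/-- The exponents `0, P⁻¹, P⁻¹ + P⁻³, P⁻¹ + P⁻³ + P⁻⁵, …`. -/
def catExp (P : ℕ) : ℕ → ℚ
  | 0 => 0
  | m + 1 => (1 + catExp P m / P) / P

theorem catExp_strictMono {P : ℕ} (hP : 0 < P) : StrictMono (catExp P) := by
  have hP' : (0 : ℚ) < P := Nat.cast_pos.2 hP
  refine strictMono_nat_of_lt_succ fun m => ?_
  induction m with
  | zero => simp only [catExp]; positivity
  | succ m ih =>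
    rw [catExp, catExp]
    exact div_lt_div_of_pos_right (add_lt_add_right (div_lt_div_of_pos_right ih hP') 1) hP'

/-- The order embedding `m ↦ P ^ j * catExp P m`. -/
def catExpEmb {P : ℕ} (hP : 0 < P) (j : ℕ) : ℕ ↪o ℚ :=
  OrderEmbedding.ofStrictMono (fun m => (P : ℚ) ^ j * catExp P m) fun _ _ h =>
    mul_lt_mul_of_pos_left (catExp_strictMono hP h) (pow_pos (Nat.cast_pos.2 hP) j)

variable (k) in
/-- The Hahn series `∑ g m * X ^ (P ^ j * catExp P m)` attached to a power series `g`. -/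
def catHahn {P : ℕ} (hP : 0 < P) (j : ℕ) (g : PowerSeries ℕ) : HahnSeries ℚ k :=
  HahnSeries.embDomain (catExpEmb hP j)
    ⟨fun m => ((PowerSeries.coeff m g : ℕ) : k), Set.isPWO_of_wellQuasiOrderedLE _⟩

theorem coeff_catHahn {P : ℕ} (hP : 0 < P) (j : ℕ) (g : PowerSeries ℕ) (m : ℕ) :
    (catHahn k hP j g).coeff ((P : ℚ) ^ j * catExp P m) = ((PowerSeries.coeff m g : ℕ) : k) :=
  HahnSeries.embDomain_coeff (f := catExpEmb hP j)

theorem coeff_catHahn_of_notMem {P : ℕ} (hP : 0 < P) (j : ℕ) (g : PowerSeries ℕ) {b : ℚ}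
    (hb : ∀ m, b ≠ (P : ℚ) ^ j * catExp P m) : (catHahn k hP j g).coeff b = 0 :=
  HahnSeries.embDomain_of_notMem_range (by
    rintro ⟨m, hm⟩
    exact hb m hm.symm)

theorem catHahn_add {P : ℕ} (hP : 0 < P) (j : ℕ) (g h : PowerSeries ℕ) :
    catHahn k hP j (g + h) = catHahn k hP j g + catHahn k hP j h := by
  ext b
  rw [HahnSeries.coeff_add]
  by_cases hb : ∃ m, b = (P : ℚ) ^ j * catExp P m
  · obtain ⟨m, rfl⟩ := hb
    rw [coeff_catHahn, coeff_catHahn, coeff_catHahn, map_add, Nat.cast_add]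
  · push Not at hb
    rw [coeff_catHahn_of_notMem hP j _ hb, coeff_catHahn_of_notMem hP j _ hb,
      coeff_catHahn_of_notMem hP j _ hb, add_zero]

theorem catHahn_X {P : ℕ} (hP : 0 < P) :
    catHahn k hP 1 PowerSeries.X = HahnSeries.single (1 : ℚ) (1 : k) := by
  have hP' : (P : ℚ) ≠ 0 := (Nat.cast_pos.2 hP).ne'
  have h1 : (P : ℚ) ^ 1 * catExp P 1 = 1 := by
    simp only [catExp]
    field_simp
    ring
  ext b
  by_cases hb : ∃ m, b = (P : ℚ) ^ 1 * catExp P m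
  · obtain ⟨m, rfl⟩ := hb
    rw [coeff_catHahn, PowerSeries.coeff_X]
    split_ifs with hm
    · rw [hm, h1, HahnSeries.coeff_single_same, Nat.cast_one]
    · rw [HahnSeries.coeff_single_of_ne, Nat.cast_zero]
      rw [← h1]
      exact fun h => hm ((catExpEmb hP 1).injective h)
  · push Not at hb
    rw [coeff_catHahn_of_notMem hP 1 _ hb, HahnSeries.coeff_single_of_ne]
    exact fun h => hb 1 (h.trans h1.symm)

/-- Multiplication of `g` by `X` amounts to multiplication of the Hahn series by a monomial. -/
theorem catHahn_X_mul {P : ℕ} (hP : 0 < P) (j : ℕ) (g : PowerSeries ℕ) :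
    catHahn k hP (j + 2) (PowerSeries.X * g) =
      HahnSeries.single (1 : ℚ) (1 : k) ^ P ^ (j + 1) * catHahn k hP j g := by
  have hP' : (P : ℚ) ≠ 0 := (Nat.cast_pos.2 hP).ne'
  have hexp : ∀ m, (P : ℚ) ^ (j + 2) * catExp P (m + 1) =
      (P : ℚ) ^ (j + 1) + (P : ℚ) ^ j * catExp P m := by
    intro m
    rw [catExp]
    field_simp
    ring
  rw [HahnSeries.single_pow, one_pow, nsmul_one]
  ext b
  obtain ⟨b, rfl⟩ : ∃ b', b = ((P ^ (j + 1) : ℕ) : ℚ) + b' := ⟨b - ((P ^ (j + 1) : ℕ) : ℚ), by ring⟩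
  rw [add_comm ((P ^ (j + 1) : ℕ) : ℚ) b, HahnSeries.coeff_single_mul_add, one_mul]
  by_cases hb : ∃ m, b = (P : ℚ) ^ j * catExp P m
  · obtain ⟨m, rfl⟩ := hb
    have := hexp m
    push_cast
    rw [add_comm _ ((P : ℚ) ^ (j + 1)), ← this, coeff_catHahn, coeff_catHahn,
      PowerSeries.coeff_succ_X_mul]
  · push Not at hb
    rw [coeff_catHahn_of_notMem hP j _ hb]
    by_cases hb' : ∃ m, b + ((P ^ (j + 1) : ℕ) : ℚ) = (P : ℚ) ^ (j + 2) * catExp P m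
    · obtain ⟨m, hm⟩ := hb'
      rw [hm, coeff_catHahn]
      cases m with
      | zero => rw [PowerSeries.coeff_zero_X_mul, Nat.cast_zero]
      | succ m =>
        rw [hexp] at hm
        push_cast at hm
        exact absurd (by linarith) (hb m)
    · push Not at hb'
      exact coeff_catHahn_of_notMem hP _ _ hb'

/-- The coefficients are integers modulo `p` and so fixed by Frobenius, which only multiplies the
exponents by `p ^ r`. -/
theorem catHahn_pow (p : ℕ) [Fact p.Prime] [CharP k p] (r : ℕ) (hP : 0 < p ^ r) (j : ℕ)
    (g : PowerSeries ℕ) : catHahn k hP j g ^ p ^ r = catHahn k hP (j + 1) g := by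
  have hP' : ((p ^ r : ℕ) : ℚ) ≠ 0 := (Nat.cast_pos.2 hP).ne'
  ext b
  obtain ⟨b, rfl⟩ : ∃ b', b = ((p ^ r : ℕ) : ℚ) * b' := ⟨b / ((p ^ r : ℕ) : ℚ), by field_simp⟩
  rw [coeff_pow_char_pow]
  by_cases hb : ∃ m, b = ((p ^ r : ℕ) : ℚ) ^ j * catExp (p ^ r) m
  · obtain ⟨m, rfl⟩ := hb
    rw [← mul_assoc, ← pow_succ', coeff_catHahn, coeff_catHahn, ← iterateFrobenius_def,
      map_natCast]
  · push Not at hb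
    rw [coeff_catHahn_of_notMem hP j _ hb, zero_pow hP.ne', coeff_catHahn_of_notMem]
    intro m hm
    rw [pow_succ', mul_assoc] at hm
    exact hb m (mul_left_cancel₀ hP' hm)

/-- The power series `X * C`, where `C` is the generating series of the Catalan numbers. It is the
root `λ` of `λ ^ 2 + X = λ` without constant term, so its powers satisfy
`λ ^ (j + 2) + X * λ ^ j = λ ^ (j + 1)`. -/
def catLambda : PowerSeries ℕ := PowerSeries.X * PowerSeries.catalanSeries

theorem catLambda_sq_add : catLambda ^ 2 + PowerSeries.X = catLambda := by
  have h := PowerSeries.catalanSeries_sq_mul_X_add_one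
  calc catLambda ^ 2 + PowerSeries.X
      = PowerSeries.X * (PowerSeries.catalanSeries ^ 2 * PowerSeries.X + 1) := by
        rw [catLambda]; ring
    _ = catLambda := by rw [h, catLambda]

theorem coeff_catLambda_pow_of_lt {i j : ℕ} (h : i < j) :
    PowerSeries.coeff i (catLambda ^ j) = 0 := by
  rw [catLambda, mul_pow, PowerSeries.coeff_X_pow_mul', if_neg (by omega)]

theorem coeff_catLambda_pow_self (j : ℕ) : PowerSeries.coeff j (catLambda ^ j) = 1 := by
  rw [catLambda, mul_pow, PowerSeries.coeff_X_pow_mul', if_pos le_rfl, Nat.sub_self,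
    PowerSeries.coeff_zero_eq_constantCoeff_apply, map_pow,
    PowerSeries.catalanSeries_constantCoeff, one_pow]

theorem orderTop_catHahn_pow {P : ℕ} (hP : 0 < P) (i j : ℕ) :
    (catHahn k hP i (catLambda ^ j)).orderTop = (((P : ℚ) ^ i * catExp P j : ℚ) : WithTop ℚ) := by
  refine HahnSeries.orderTop_eq_of_le ?_ ?_
  · rw [HahnSeries.mem_support, coeff_catHahn, coeff_catLambda_pow_self, Nat.cast_one]
    exact one_ne_zero
  · intro b hb
    by_contra hlt
    rw [not_le] at hlt
    apply hb
    by_cases hm : ∃ m, b = (P : ℚ) ^ i * catExp P m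
    · obtain ⟨m, rfl⟩ := hm
      have : m < j := (catExpEmb hP i).lt_iff_lt.1 hlt
      rw [coeff_catHahn, coeff_catLambda_pow_of_lt this, Nat.cast_zero]
    · push Not at hm
      exact coeff_catHahn_of_notMem hP i _ hm

theorem isKeyExponents_S (p : ℕ) [hp : Fact p.Prime] : IsKeyExponents p (nS p) (eS p) where
  prime := hp.out
  exists_pow _ := ⟨1, rfl⟩
  period _ := rfl
  e_one := by simp [eS]
  e_succ j := by
    rw [eS, eS, nS, ← pow_add]
    congr 1
    omega

/-- The partial sums `catExp` are the values of the key sequence up to powers of `p ^ 2`. -/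
theorem keyValue_S (p : ℕ) [Fact p.Prime] (j : ℕ) :
    keyValue (nS p) (eS p) (j + 1) = ((p ^ 2 : ℕ) : ℚ) ^ j * catExp (p ^ 2) (j + 1) := by
  have hP : ((p ^ 2 : ℕ) : ℚ) ≠ 0 :=
    (Nat.cast_pos.2 (pow_pos (Fact.out : p.Prime).pos 2)).ne'
  induction j with
  | zero => simp [keyValue, catExp, nS]
  | succ j ih =>
    have he : eS p (j + 2) = (p ^ 2) ^ (j + 1) := by
      rw [eS, ← pow_mul]
      congr 1
    change ((eS p (j + 2) : ℚ) + keyValue (nS p) (eS p) (j + 1)) / (nS p (j + 2) : ℕ) = _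
    have hc : catExp (p ^ 2) (j + 2) =
      (1 + catExp (p ^ 2) (j + 1) / (p ^ 2 : ℕ)) / (p ^ 2 : ℕ) := rfl
    rw [ih, he, nS, hc]
    generalize hQ : p ^ 2 = Q at *
    push_cast
    field_simp
    ring

/-- The Hahn series `∑ C (m - 1) * X ^ (p⁻² + p⁻⁶ + ⋯ + p^(2 - 4 m))` satisfies
`keySeq (j + 1) = catHahn j (catLambda ^ (j + 1))`. -/
theorem keySeq_catHahn (p : ℕ) [Fact p.Prime] [CharP k p] (hP : 0 < p ^ 2) (j : ℕ) :
    keySeq (nS p) (eS p) (HahnSeries.single (1 : ℚ) (1 : k)) (catHahn k hP 0 catLambda) (j + 1) =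
      catHahn k hP j (catLambda ^ (j + 1)) := by
  have key : ∀ j, catHahn k hP (j + 1) (catLambda ^ (j + 2)) =
      catHahn k hP (j + 1) (catLambda ^ (j + 1)) -
        catHahn k hP (j + 1) (PowerSeries.X * catLambda ^ j) := by
    intro j
    rw [eq_sub_iff_add_eq, ← catHahn_add]
    congr 1
    calc catLambda ^ (j + 2) + PowerSeries.X * catLambda ^ j
        = (catLambda ^ 2 + PowerSeries.X) * catLambda ^ j := by ring
      _ = catLambda ^ (j + 1) := by rw [catLambda_sq_add]; ring
  induction j using Nat.strong_induction_on with
  | _ j ih =>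
    match j with
    | 0 => rw [zero_add, pow_one]; rfl
    | 1 =>
      have h1 := key 0
      rw [zero_add, zero_add, pow_one, pow_zero, mul_one, catHahn_X] at h1
      rw [h1, ← catHahn_pow p 2 hP 0]
      rfl
    | j + 2 =>
      have he : eS p (j + 2) = (p ^ 2) ^ (j + 1) := by
        rw [eS, ← pow_mul]
        congr 1
      rw [keySeq_succ, ih (j + 1) (by omega), key (j + 1), ← catHahn_pow p 2 hP (j + 1),
        catHahn_X_mul, ← ih j (by omega), ← he]
      rfl

end Hahn

/-! ### Transcendence of series with unbounded ramification -/

section Transcendence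

variable (k : Type*) [Field k]

/-- The algebra of constants, preferred over the algebra structure through power series. -/
instance hahnAlgebra {Γ : Type*} [AddCommMonoid Γ] [PartialOrder Γ] [IsOrderedCancelAddMonoid Γ] :
    Algebra k (HahnSeries Γ k) := HahnSeries.instAlgebra

/-- Hahn series with integral exponents, as Hahn series with rational exponents. -/
def intHahn : HahnSeries ℤ k →ₐ[k] HahnSeries ℚ k :=
  HahnSeries.embDomainAlgHom (Int.castAddHom ℚ) Int.cast_injective fun _ _ => Int.cast_le

variable {k}

theorem exists_orderTop_intHahn {f : HahnSeries ℤ k} (hf : f ≠ 0) :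
    ∃ z : ℤ, (intHahn k f).orderTop = ((z : ℚ) : WithTop ℚ) := by
  refine ⟨f.order, ?_⟩
  have h : (intHahn k f).orderTop = WithTop.map _ f.orderTop := HahnSeries.orderTop_embDomain
  rw [h, ← HahnSeries.order_eq_orderTop_of_ne_zero hf]
  rfl

/-- Nonzero series of distinct orders have a nonzero sum, as the term of least order is not
cancelled. -/
theorem sum_ne_zero_of_orderTop_injective {ι : Type*} {s : Finset ι} {f : ι → HahnSeries ℚ k}
    (hs : s.Nonempty) (h0 : ∀ i ∈ s, f i ≠ 0)
    (hinj : ∀ i ∈ s, ∀ j ∈ s, (f i).orderTop = (f j).orderTop → i = j) : ∑ i ∈ s, f i ≠ 0 := by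
  obtain ⟨i, hi, hmin⟩ := s.exists_min_image (fun i => (f i).orderTop) hs
  intro h
  have h1 := congrArg (fun g => g.coeff (f i).order) h
  simp only [HahnSeries.coeff_sum, HahnSeries.coeff_zero] at h1
  rw [Finset.sum_eq_single i] at h1
  · exact HahnSeries.coeff_order_eq_zero.not.2 (h0 i hi) h1
  · intro j hj hji
    refine HahnSeries.coeff_eq_zero_of_lt_orderTop ?_
    rw [HahnSeries.order_eq_orderTop_of_ne_zero (h0 i hi)]
    exact lt_of_le_of_ne (hmin j hj) fun e => hji (hinj j hj i hi e.symm)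
  · exact fun h => absurd hi h

/-- A series `y` such that the subring generated by `y` over the series with integral exponents
contains elements whose values have arbitrarily large denominators is transcendental over them:
if `z` has a value of denominator `N`, then `1, z, …, z ^ (N - 1)` have distinct values modulo
integers and so are linearly independent. -/
theorem transcendental_of_denominators (y : HahnSeries ℚ k)
    (hy : ∀ d : ℕ, ∃ (N : ℕ) (z : HahnSeries ℚ k) (q : ℚ), d < N ∧ z.orderTop = (q : WithTop ℚ) ∧
      (∀ i : ℤ, i * q ∈ Set.range ((↑) : ℤ → ℚ) → (N : ℤ) ∣ i) ∧
      ∀ B : Subring (HahnSeries ℚ k), (∀ f, intHahn k f ∈ B) → y ∈ B → z ∈ B) :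
    letI := (intHahn k).toRingHom.toAlgebra
    Transcendental (HahnSeries ℤ k) y := by
  let _ := (intHahn k).toRingHom.toAlgebra
  intro halg
  have : FiniteDimensional (HahnSeries ℤ k) (IntermediateField.adjoin (HahnSeries ℤ k) {y}) :=
    IntermediateField.adjoin.finiteDimensional halg.isIntegral
  obtain ⟨N, z, q, hN, hz, hq, hB⟩ :=
    hy (Module.finrank (HahnSeries ℤ k) (IntermediateField.adjoin (HahnSeries ℤ k) {y}))
  have hz0 : z ≠ 0 := by
    rintro rfl
    rw [HahnSeries.orderTop_zero] at hz
    exact WithTop.top_ne_coe hz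
  have hzmem : z ∈ IntermediateField.adjoin (HahnSeries ℤ k) {y} :=
    hB (IntermediateField.adjoin (HahnSeries ℤ k) {y}).toSubfield.toSubring
      (fun f => IntermediateField.algebraMap_mem _ f)
      (IntermediateField.subset_adjoin _ _ (Set.mem_singleton y))
  have hval : ∀ (f : HahnSeries ℤ k) (i : ℕ), f ≠ 0 →
      ∃ m : ℤ, (f • z ^ i).orderTop = ((m + i * q : ℚ) : WithTop ℚ) := by
    intro f i hf
    obtain ⟨m, hm⟩ := exists_orderTop_intHahn hf
    refine ⟨m, ?_⟩
    rw [Algebra.smul_def]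
    change (intHahn k f * z ^ i).orderTop = _
    rw [← HahnSeries.addVal_apply, AddValuation.map_mul, AddValuation.map_pow,
      HahnSeries.addVal_apply, HahnSeries.addVal_apply, hm, hz, ← WithTop.coe_nsmul,
      ← WithTop.coe_add, nsmul_eq_mul]
  have hli : LinearIndependent (HahnSeries ℤ k) fun i : Fin N => z ^ (i : ℕ) := by
    classical
    rw [Fintype.linearIndependent_iff]
    intro g hg
    by_contra! hne
    have hsum : ∑ i with g i ≠ 0, g i • z ^ (i : ℕ) = 0 := by
      rw [← hg]
      refine Finset.sum_subset (Finset.subset_univ _) fun i _ hi => ?_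
      have : g i = 0 := by simpa using hi
      rw [this, zero_smul]
    refine sum_ne_zero_of_orderTop_injective ?_ ?_ ?_ hsum
    · obtain ⟨i, hi⟩ := hne
      exact ⟨i, by simpa using hi⟩
    · intro i hi
      obtain ⟨m, hm⟩ := hval (g i) i (by simpa using hi)
      intro h0
      rw [h0, HahnSeries.orderTop_zero] at hm
      exact WithTop.top_ne_coe hm
    · intro i hi j hj hij
      obtain ⟨m, hm⟩ := hval (g i) i (by simpa using hi)
      obtain ⟨m', hm'⟩ := hval (g j) j (by simpa using hj)
      rw [hm, hm', WithTop.coe_eq_coe] at hij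
      have hdvd := hq ((i : ℤ) - j) ⟨m' - m, by push_cast; linarith⟩
      have h1 : ((i : ℕ) : ℤ) - ((j : ℕ) : ℤ) = 0 := by
        refine Int.eq_zero_of_abs_lt_dvd hdvd ?_
        rw [abs_lt]
        have := i.2
        have := j.2
        omega
      exact Fin.ext (by omega)
  have hli' : LinearIndependent (HahnSeries ℤ k) fun i : Fin N =>
      ((⟨z, hzmem⟩ : IntermediateField.adjoin (HahnSeries ℤ k) {y}) ^ (i : ℕ)) := by
    refine LinearIndependent.of_comp
      (IntermediateField.adjoin (HahnSeries ℤ k) {y}).val.toLinearMap ?_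
    exact hli
  have := hli'.fintype_card_le_finrank
  rw [Fintype.card_fin] at this
  omega

theorem transcendental_single [IsAlgClosed k] :
    Transcendental k (HahnSeries.single (1 : ℤ) (1 : k)) := by
  intro h
  obtain ⟨c, hc⟩ := minpoly.mem_range_of_degree_eq_one k _
    (IsAlgClosed.degree_eq_one_of_irreducible k (minpoly.irreducible h.isIntegral))
  have h1 := congrArg (fun f => f.coeff 1) hc
  simp only [HahnSeries.coeff_single_same, HahnSeries.algebraMap_apply, HahnSeries.C_apply] at h1
  rw [HahnSeries.coeff_single_of_ne one_ne_zero] at h1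
  exact zero_ne_one h1

end Transcendence

/-! ### The valuation of the function field -/

section Existence

variable {k : Type*} [Field k] (p : ℕ) [hp : Fact p.Prime] [CharP k p]

variable (k) in
/-- The image of `y` under an embedding of `k(x, y)` into Hahn series with `x` of value one. -/
def yHahn : HahnSeries ℚ k := catHahn k (pow_pos hp.out.pos 2) 0 catLambda

theorem keySeq_yHahn_mem {B : Subring (HahnSeries ℚ k)} (n e : ℕ → ℕ) {a b : HahnSeries ℚ k}
    (ha : a ∈ B) (hb : b ∈ B) (j : ℕ) : keySeq n e a b j ∈ B := by
  suffices hj : keySeq n e a b j ∈ B ∧ keySeq n e a b (j + 1) ∈ B from hj.1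
  induction j with
  | zero => exact ⟨ha, hb⟩
  | succ j ih =>
    refine ⟨ih.2, ?_⟩
    cases j with
    | zero => exact B.sub_mem (B.pow_mem hb _) ha
    | succ j => exact B.sub_mem (B.pow_mem ih.2 _) (B.mul_mem (B.pow_mem ha _) ih.1)

theorem orderTop_keySeq_yHahn (j : ℕ) :
    (keySeq (nS p) (eS p) (HahnSeries.single (1 : ℚ) (1 : k)) (yHahn k p) j).orderTop =
      (keyValue (nS p) (eS p) j : WithTop ℚ) := by
  cases j with
  | zero => exact HahnSeries.orderTop_single one_ne_zero
  | succ j =>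
    rw [yHahn, keySeq_catHahn, orderTop_catHahn_pow, keyValue_S]

variable [IsAlgClosed k]

/-- The series `y` is transcendental over the series with integral exponents, since the values of the
members of the key sequence have unbounded denominators. -/
theorem algebraicIndependent_yHahn :
    AlgebraicIndependent k ![HahnSeries.single (1 : ℚ) (1 : k), yHahn k p] := by
  let _ := (intHahn k).toRingHom.toAlgebra
  have : IsScalarTower k (HahnSeries ℤ k) (HahnSeries ℚ k) :=
    IsScalarTower.of_algebraMap_eq fun c => ((intHahn k).commutes c).symm
  have hx : intHahn k (HahnSeries.single (1 : ℤ) (1 : k)) = HahnSeries.single (1 : ℚ) (1 : k) := by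
    refine HahnSeries.embDomain_single.trans ?_
    congr 1
  have htr : Transcendental (HahnSeries ℤ k) (yHahn k p) := by
    have hS := isKeyExponents_S p
    refine transcendental_of_denominators _ fun d => ⟨partialProd (nS p) d, _, _, ?_,
      orderTop_keySeq_yHahn p d, ?_, fun B hB hy => ?_⟩
    · refine Nat.lt_two_pow_self.trans_le ?_
      have : (2 : ℕ) ^ d = ∏ i ∈ Finset.range d, 2 := by simp
      rw [this]
      exact Finset.prod_le_prod' fun i _ => hS.two_le (i + 1)
    · rintro i ⟨z, hz⟩
      obtain ⟨b, hb, hbp⟩ := hS.exists_partialProd_mul_keyValue d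
      have h1 : (partialProd (nS p) d : ℤ) * z = i * b := by
        have : ((partialProd (nS p) d : ℚ)) * z = i * b := by rw [hz, ← hb]; ring
        exact_mod_cast this
      have h2 : IsCoprime (partialProd (nS p) d : ℤ) (b : ℤ) := by
        rw [Nat.isCoprime_iff_coprime, partialProd]
        refine Nat.Coprime.prod_left fun i _ => ?_
        exact (Nat.Coprime.pow_right 2 hbp).symm
      exact h2.dvd_of_dvd_mul_right ⟨z, h1.symm⟩
    · refine keySeq_yHahn_mem _ _ ?_ hy d
      rw [← hx]
      exact hB _
  have h1 : AlgebraicIndependent (HahnSeries ℤ k) fun _ : Unit => yHahn k p :=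
    algebraicIndependent_unique_type_iff.2 htr
  have h2 : AlgebraicIndependent k fun _ : Unit => HahnSeries.single (1 : ℤ) (1 : k) :=
    algebraicIndependent_unique_type_iff.2 transcendental_single
  have h3 := (AlgebraicIndependent.sumElim_comp h2 h1).comp ![Sum.inr (), Sum.inl ()] (by
    intro i j hij
    fin_cases i <;> fin_cases j <;> simp_all)
  convert h3 using 1
  ext1 i
  fin_cases i
  · exact hx.symm
  · rfl

variable (k) in
/-- The embedding of `k(x, y)` into Hahn series. -/
def toHahn : TopField k →ₐ[k] HahnSeries ℚ k :=
  IsFractionRing.liftAlgHom (g := MvPolynomial.aeval ![HahnSeries.single (1 : ℚ) (1 : k), yHahn k p])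
    (algebraicIndependent_yHahn p)

theorem toHahn_xVar : toHahn k p (xVar k) = HahnSeries.single (1 : ℚ) (1 : k) := by
  refine (IsFractionRing.lift_algebraMap (algebraicIndependent_yHahn (k := k) p) _).trans ?_
  exact MvPolynomial.aeval_X _ 0

theorem toHahn_yVar : toHahn k p (yVar k) = yHahn k p := by
  refine (IsFractionRing.lift_algebraMap (algebraicIndependent_yHahn (k := k) p) _).trans ?_
  exact MvPolynomial.aeval_X _ 1

variable (k) in
/-- The valuation of `k(x, y)` induced by the embedding into Hahn series. -/
def hahnVal : AddValuation (TopField k) (WithTop ℚ) :=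
  (HahnSeries.addVal ℚ k).comap (toHahn k p).toRingHom

theorem hahnVal_apply (f : TopField k) : hahnVal k p f = (toHahn k p f).orderTop := rfl

theorem isResidueRational_hahnVal : IsResidueRational k (hahnVal k p) where
  val_algebraMap c hc := by
    rw [hahnVal_apply, AlgHom.commutes, HahnSeries.algebraMap_apply, HahnSeries.C_apply]
    exact HahnSeries.orderTop_single hc
  exists_residue f hf := by
    rw [hahnVal_apply] at hf
    refine ⟨(toHahn k p f).coeff 0, ?_⟩
    rw [hahnVal_apply, map_sub, AlgHom.commutes]
    set g := toHahn k p f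
    have hC : algebraMap k (HahnSeries ℚ k) (g.coeff 0) = HahnSeries.single 0 (g.coeff 0) := rfl
    rw [hC]
    refine lt_of_le_of_ne ?_ fun h0 => ?_
    · refine (le_min hf ?_).trans HahnSeries.min_orderTop_le_orderTop_sub
      exact HahnSeries.orderTop_single_le
    · refine HahnSeries.coeff_orderTop_ne h0.symm ?_
      rw [HahnSeries.coeff_sub, HahnSeries.coeff_single_same, sub_self]

end Existence

/-! ### The function fields -/

section FunctionField

variable {k : Type*} [Field k]

theorem algebraMap_eq_aeval (P : MvPolynomial (Fin 2) k) :
    algebraMap (MvPolynomial (Fin 2) k) (TopField k) P = MvPolynomial.aeval ![xVar k, yVar k] P := by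
  have : (IsScalarTower.toAlgHom k (MvPolynomial (Fin 2) k) (TopField k)) =
      MvPolynomial.aeval ![xVar k, yVar k] := by
    ext i
    fin_cases i <;> simp [xVar, yVar]
  exact DFunLike.congr_fun this P

theorem mem_adjoin_of_algebraMap (P : MvPolynomial (Fin 2) k) :
    algebraMap (MvPolynomial (Fin 2) k) (TopField k) P ∈ Algebra.adjoin k {xVar k, yVar k} := by
  have hr : Set.range ![xVar k, yVar k] = {xVar k, yVar k} := by simp [Set.pair_comm]
  rw [algebraMap_eq_aeval, ← hr, Algebra.adjoin_range_eq_range_aeval]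
  exact ⟨P, rfl⟩

theorem adjoin_xVar_yVar : IntermediateField.adjoin k {xVar k, yVar k} = ⊤ := by
  rw [eq_top_iff]
  intro f _
  obtain ⟨P, Q, -, rfl⟩ := IsFractionRing.div_surjective (A := MvPolynomial (Fin 2) k) f
  exact (IntermediateField.adjoin k {xVar k, yVar k}).div_mem
    (IntermediateField.algebra_adjoin_le_adjoin k _ (mem_adjoin_of_algebraMap P))
    (IntermediateField.algebra_adjoin_le_adjoin k _ (mem_adjoin_of_algebraMap Q))

theorem two_le_trdeg_topField : 2 ≤ Algebra.trdeg k (TopField k) := by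
  have h := ((MvPolynomial.algebraicIndependent_X (Fin 2) k).map'
    (f := IsScalarTower.toAlgHom k (MvPolynomial (Fin 2) k) (TopField k))
    (IsFractionRing.injective _ _)).lift_cardinalMk_le_trdeg
  simpa using h

theorem algebraicIndependent_of_isAlgebraic {F : Type*} [Field F] [Algebra k F]
    (htr : 2 ≤ Algebra.trdeg k F) {a b : F}
    (h : Algebra.IsAlgebraic (IntermediateField.adjoin k {a, b}) F) :
    AlgebraicIndependent k ![a, b] := by
  have hr : Set.range ![a, b] = {a, b} := by simp [Set.pair_comm]
  have : Algebra.IsAlgebraic (Algebra.adjoin k (Set.range ![a, b])) F := by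
    rw [hr]
    open scoped IntermediateField.algebraAdjoinAdjoin in
    exact (IsFractionRing.comap_isAlgebraic_iff (K := IntermediateField.adjoin k {a, b})).2 h
  exact (Algebra.IsAlgebraic.isTranscendenceBasis_of_lift_le_trdeg_of_finite k ![a, b]
    (by simpa using htr)).1

theorem algebraicIndependent_of_le {F : Type*} [Field F] [Algebra k F]
    (htr : 2 ≤ Algebra.trdeg k F) {a b : F} (E : IntermediateField k F) [Algebra.IsAlgebraic E F]
    (hE : E ≤ IntermediateField.adjoin k {a, b}) : AlgebraicIndependent k ![a, b] := by
  refine algebraicIndependent_of_isAlgebraic htr ⟨fun f => ?_⟩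
  let := (IntermediateField.inclusion hE).toRingHom.toAlgebra
  have : IsScalarTower E (IntermediateField.adjoin k {a, b}) F :=
    IsScalarTower.of_algebraMap_eq fun _ => rfl
  exact (Algebra.IsAlgebraic.isAlgebraic (R := E) f).tower_top _

/-- The substitution `x ↦ a`, `y ↦ b`, where `a`, `b` are algebraically independent. -/
def substHom {a b : TopField k} (h : AlgebraicIndependent k ![a, b]) :
    TopField k →ₐ[k] TopField k :=
  IsFractionRing.liftAlgHom (g := MvPolynomial.aeval ![a, b]) h

theorem substHom_xVar {a b : TopField k} (h : AlgebraicIndependent k ![a, b]) :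
    substHom h (xVar k) = a :=
  (IsFractionRing.lift_algebraMap (A := MvPolynomial (Fin 2) k) h _).trans (MvPolynomial.aeval_X _ 0)

theorem substHom_yVar {a b : TopField k} (h : AlgebraicIndependent k ![a, b]) :
    substHom h (yVar k) = b :=
  (IsFractionRing.lift_algebraMap (A := MvPolynomial (Fin 2) k) h _).trans (MvPolynomial.aeval_X _ 1)

theorem algHom_eqOn_adjoin {F E : Type*} [Field F] [Field E] [Algebra k F] [Algebra k E]
    {f g : F →ₐ[k] E} {s : Set F} (h : Set.EqOn f g s) :
    Set.EqOn f g (IntermediateField.adjoin k s) := by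
  intro z hz
  induction hz using IntermediateField.adjoin_induction with
  | mem z hz => exact h hz
  | algebraMap c => rw [AlgHom.commutes, AlgHom.commutes]
  | add z w _ _ hz hw => rw [map_add, map_add, hz, hw]
  | inv z _ hz => rw [map_inv₀, map_inv₀, hz]
  | mul z w _ _ hz hw => rw [map_mul, map_mul, hz, hw]

theorem xVar_ne_zero : xVar k ≠ 0 := fun h =>
  MvPolynomial.X_ne_zero (R := k) (0 : Fin 2)
    (IsFractionRing.injective (MvPolynomial (Fin 2) k) (TopField k) (h.trans (map_zero _).symm))

theorem one_add_mul_xVar_ne_zero (r : MvPolynomial (Fin 2) k) :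
    1 + algebraMap (MvPolynomial (Fin 2) k) (TopField k) r * xVar k ≠ 0 := by
  intro h
  have h1 : 1 + r * MvPolynomial.X 0 = 0 :=
    IsFractionRing.injective (MvPolynomial (Fin 2) k) (TopField k) (by
      rw [map_add, map_one, map_mul, map_zero]
      exact h)
  have := congrArg MvPolynomial.constantCoeff h1
  simp at this

variable (k) (p c : ℕ)

/-- `y` is a root of this polynomial over `k(x, v)`. -/
def yPoly : Polynomial (KOne k p c) :=
  Polynomial.X ^ p - (Polynomial.C (xOne k p c ^ c) * Polynomial.X + Polynomial.C (vOne k p c))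

theorem aeval_yPoly : Polynomial.aeval (yVar k) (yPoly k p c) = 0 := by
  simp only [yPoly, map_sub, map_add, map_mul, map_pow, Polynomial.aeval_X, Polynomial.aeval_C]
  change yVar k ^ p - (xVar k ^ c * yVar k + vElt k p c) = 0
  rw [vElt]
  ring

theorem adjoin_yVar : IntermediateField.adjoin (KOne k p c) {yVar k} = ⊤ := by
  have h : (IntermediateField.adjoin k {xVar k, yVar k}) ≤
      (IntermediateField.adjoin (KOne k p c) {yVar k}).restrictScalars k := by
    rw [IntermediateField.adjoin_le_iff]
    rintro f (rfl | rfl)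
    · have := (IntermediateField.adjoin (KOne k p c) {yVar k}).algebraMap_mem (xOne k p c)
      rwa [← IntermediateField.mem_restrictScalars k] at this
    · rw [SetLike.mem_coe, IntermediateField.mem_restrictScalars]
      exact IntermediateField.subset_adjoin _ _ rfl
  rw [eq_top_iff]
  intro f _
  exact h ((adjoin_xVar_yVar (k := k)).symm ▸ IntermediateField.mem_top)

theorem adjoin_xOne_vOne : IntermediateField.adjoin k {xOne k p c, vOne k p c} = ⊤ := by
  apply IntermediateField.lift_injective (KOne k p c)
  rw [IntermediateField.lift_adjoin, IntermediateField.lift_top, Set.image_pair]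
  rfl

variable [hp : Fact p.Prime]

theorem degree_yPoly_aux : (Polynomial.C (xOne k p c ^ c) * Polynomial.X +
    Polynomial.C (vOne k p c)).degree < (p : WithBot ℕ) :=
  Polynomial.degree_linear_le.trans_lt (by exact_mod_cast hp.out.one_lt)

theorem monic_yPoly : (yPoly k p c).Monic :=
  Polynomial.monic_X_pow_sub (degree_yPoly_aux k p c)

theorem natDegree_yPoly : (yPoly k p c).natDegree = p :=
  Polynomial.natDegree_eq_of_degree_eq_some
    (Polynomial.degree_sub_eq_left_of_degree_lt (by
      rw [Polynomial.degree_X_pow]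
      exact degree_yPoly_aux k p c) |>.trans (Polynomial.degree_X_pow p))

theorem isIntegral_yVar : IsIntegral (KOne k p c) (yVar k) :=
  ⟨yPoly k p c, monic_yPoly k p c, aeval_yPoly k p c⟩

theorem finrank_KOne_le : Module.finrank (KOne k p c) (TopField k) ≤ p := by
  rw [← IntermediateField.finrank_top', ← adjoin_yVar,
    IntermediateField.adjoin.finrank (isIntegral_yVar k p c)]
  exact (Polynomial.natDegree_le_natDegree
    (minpoly.min _ _ (monic_yPoly k p c) (aeval_yPoly k p c))).trans_eq (natDegree_yPoly k p c)

instance finiteDimensional_KOne : FiniteDimensional (KOne k p c) (TopField k) := by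
  have := IntermediateField.adjoin.finiteDimensional (isIntegral_yVar k p c)
  rw [adjoin_yVar] at this
  exact IntermediateField.topEquiv.toLinearEquiv.finiteDimensional

/-- Two elements that generate a field over which `k(x, y)` is algebraic are algebraically
independent. -/
theorem algebraicIndependent_of_KOne_le {a b : TopField k}
    (h : KOne k p c ≤ IntermediateField.adjoin k {a, b}) : AlgebraicIndependent k ![a, b] := by
  have halg : Algebra.IsAlgebraic (KOne k p c) (TopField k) := Algebra.IsAlgebraic.of_finite _ _
  have htr := two_le_trdeg_topField (k := k)
  generalize KOne k p c = E at *
  exact algebraicIndependent_of_le htr E h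

theorem algebraicIndependent_x_v : AlgebraicIndependent k ![xVar k, vElt k p c] :=
  algebraicIndependent_of_KOne_le k p c le_rfl

theorem two_le_trdeg_KOne : 2 ≤ Algebra.trdeg k (KOne k p c) := by
  have h : AlgebraicIndependent k ![xOne k p c, vOne k p c] := by
    refine AlgebraicIndependent.of_comp (KOne k p c).val ?_
    convert algebraicIndependent_x_v k p c using 1
    ext1 i
    fin_cases i <;> rfl
  simpa using h.lift_cardinalMk_le_trdeg

theorem algebraicIndependent_x_div_v :
    AlgebraicIndependent k ![xVar k / (1 + xVar k), vElt k p c] := by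
  have h1 : 1 + xVar k ≠ 0 := by simpa using one_add_mul_xVar_ne_zero (k := k) 1
  have h : KOne k p c ≤ IntermediateField.adjoin k {xVar k / (1 + xVar k), vElt k p c} := by
    refine IntermediateField.adjoin_le_iff.2 ?_
    rintro f (rfl | rfl)
    · have h2 : xVar k / (1 + xVar k) ∈
          IntermediateField.adjoin k {xVar k / (1 + xVar k), vElt k p c} :=
        IntermediateField.subset_adjoin _ _ (by simp)
      have h3 : xVar k = (xVar k / (1 + xVar k)) / (1 - xVar k / (1 + xVar k)) := by
        have : 1 - xVar k / (1 + xVar k) = 1 / (1 + xVar k) := by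
          field_simp
          ring
        rw [this]
        field_simp
      have h4 := IntermediateField.div_mem _ h2 (IntermediateField.sub_mem _
        (IntermediateField.one_mem _) h2)
      rwa [← h3] at h4
    · exact IntermediateField.subset_adjoin _ _ (by simp)
  exact algebraicIndependent_of_KOne_le k p c h

variable {p c}

theorem inv_xVar_pow_sub : (xVar k)⁻¹ ^ p - (xVar k)⁻¹ = (uElt k p)⁻¹ := by
  have h0 := xVar_ne_zero (k := k)
  have hp1 := hp.out.pos
  have hx : xVar k ^ p = xVar k ^ (p - 1) * xVar k := by
    rw [← pow_succ]
    congr 1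
    omega
  rw [uElt, inv_div, hx, inv_pow, hx]
  field_simp

/-- The extension `k(x, v)` of `k(u, v)` is generated by `1 / x`, which is not in `k(u, v)`: the
substitutions `x ↦ x` and `x ↦ x / (1 + x)`, with `v ↦ v`, agree on `u` and `v`. -/
theorem isArtinSchreierExtension_KBase [CharP k p] :
    IsArtinSchreierExtension p (KBase k p c) (KOne k p c) := by
  have h0 := xVar_ne_zero (k := k)
  have hu : uElt k p ∈ KBase k p c := IntermediateField.subset_adjoin _ _ (by simp)
  have hv : vElt k p c ∈ KBase k p c := IntermediateField.subset_adjoin _ _ (by simp)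
  have hx1 : xVar k ∈ KOne k p c := (xOne k p c).2
  have hle : KBase k p c ≤ KOne k p c := by
    refine IntermediateField.adjoin_le_iff.2 ?_
    rintro f (rfl | rfl)
    · exact IntermediateField.div_mem _ (pow_mem hx1 _)
        (IntermediateField.sub_mem _ (IntermediateField.one_mem _)
          (pow_mem hx1 _))
    · exact (vOne k p c).2
  refine ⟨hle, (xVar k)⁻¹, ?_, ?_, ?_⟩
  · rw [inv_xVar_pow_sub]
    exact IntermediateField.inv_mem _ hu
  · intro hmem
    set φ := substHom (algebraicIndependent_x_v k p c)
    set ψ := substHom (algebraicIndependent_x_div_v k p c)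
    have hφu : φ (uElt k p) = uElt k p := by
      rw [uElt, map_div₀, map_sub, map_one, map_pow, map_pow, substHom_xVar]
    have hψu : ψ (uElt k p) = uElt k p := by
      have h1 : 1 + xVar k ≠ 0 := by simpa using one_add_mul_xVar_ne_zero (k := k) 1
      have hch : CharP (TopField k) p := charP_of_injective_algebraMap (algebraMap k _).injective p
      rw [← inv_inj, ← map_inv₀, ← inv_xVar_pow_sub, map_sub, map_pow, map_inv₀, substHom_xVar,
        inv_div]
      have : (1 + xVar k) / xVar k = (xVar k)⁻¹ + 1 := by field_simp
      rw [this, add_pow_char, one_pow]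
      ring
    have hset : (IntermediateField.adjoin k {uElt k p, yVar k}).map φ = KBase k p c := by
      rw [IntermediateField.adjoin_map, Set.image_pair, hφu, substHom_yVar]
      rfl
    rw [← hset] at hmem
    obtain ⟨z, hz, hzx⟩ := hmem
    have hz' : φ z = ψ z := algHom_eqOn_adjoin (f := φ) (g := ψ) (by
      rintro f (rfl | rfl)
      · rw [hφu, hψu]
      · rw [substHom_yVar, substHom_yVar]) hz
    have h2 : z = (xVar k)⁻¹ := φ.injective (Eq.trans hzx (by
      rw [AlgHom.toRingHom_eq_coe, RingHom.coe_coe, map_inv₀, substHom_xVar]))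
    have h3 : (xVar k)⁻¹ = (1 + xVar k) / xVar k := by
      have := hzx.symm.trans hz'
      rwa [h2, map_inv₀, substHom_xVar, inv_div] at this
    rw [add_div, div_self h0, one_div] at h3
    exact one_ne_zero (add_eq_left.1 h3.symm)
  · refine le_antisymm (IntermediateField.adjoin_le_iff.2 ?_) (sup_le hle
      (IntermediateField.adjoin_le_iff.2 ?_))
    · rintro f (rfl | rfl)
      · have : (xVar k)⁻¹ ∈ IntermediateField.adjoin k {(xVar k)⁻¹} :=
          IntermediateField.subset_adjoin _ _ rfl
        have h := IntermediateField.inv_mem _ ((le_sup_right :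
          IntermediateField.adjoin k {(xVar k)⁻¹} ≤ KBase k p c ⊔ _) this)
        rwa [inv_inv] at h
      · exact (le_sup_left : KBase k p c ≤ _) hv
    · rintro f rfl
      exact IntermediateField.inv_mem _ hx1

end FunctionField

/-! ### The Galois group of `k(x, y)` over `k(x, v)` -/

section Galois

theorem algHom_bijective_of_finite {F L : Type*} [Field F] [Field L] [Algebra F L]
    [FiniteDimensional F L] (f : L →ₐ[F] L) : Function.Bijective f :=
  Algebra.IsAlgebraic.algHom_bijective f

/-- If the degree is at most `p` and `σ` has order `p`, then the fixed field of `σ` is the base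
field. -/
theorem mem_range_algebraMap_of_fixed {F L : Type*} [Field F] [Field L] [Algebra F L]
    [FiniteDimensional F L] {p : ℕ} (hp : p.Prime) (h3 : Module.finrank F L ≤ p) {σ : L ≃ₐ[F] L}
    (hσ : σ ^ p = 1) (hσ1 : σ ≠ 1) {f : L} (hf : σ f = f) : f ∈ Set.range (algebraMap F L) := by
  have : Fact p.Prime := ⟨hp⟩
  set G := Subgroup.zpowers σ with hG
  have hcard : Nat.card G = p := by
    rw [hG, Nat.card_zpowers]
    exact orderOf_eq_prime hσ hσ1
  have h1 : Module.finrank (IntermediateField.fixedField G) L = p := by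
    rw [IntermediateField.finrank_fixedField_eq_card, hcard]
  have h2 := Module.finrank_mul_finrank F (IntermediateField.fixedField G) L
  rw [h1] at h2
  have h4 : 0 < Module.finrank F (IntermediateField.fixedField G) := Module.finrank_pos
  have h5 : Module.finrank F (IntermediateField.fixedField G) = 1 := by
    have : Module.finrank F (IntermediateField.fixedField G) * p ≤ 1 * p := by
      rw [h2, one_mul]
      exact h3
    have := Nat.le_of_mul_le_mul_right this hp.pos
    omega
  rw [IntermediateField.finrank_eq_one_iff] at h5
  have h6 : f ∈ IntermediateField.fixedField G := by
    rintro ⟨g, hg⟩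
    have hle : G ≤ MulAction.stabilizer (L ≃ₐ[F] L) f := by
      rw [hG, Subgroup.zpowers_le]
      exact hf
    exact hle hg
  rw [h5] at h6
  exact IntermediateField.mem_bot.1 h6

variable {k : Type*} [Field k]

theorem algebraicIndependent_shift (d : ℕ) :
    AlgebraicIndependent k ![xVar k, yVar k + xVar k ^ d] := by
  have h : KOne k 2 0 ≤ IntermediateField.adjoin k {xVar k, yVar k + xVar k ^ d} := by
    refine le_top.trans ?_
    rw [← adjoin_xVar_yVar]
    have hx : xVar k ∈ IntermediateField.adjoin k {xVar k, yVar k + xVar k ^ d} :=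
      IntermediateField.subset_adjoin _ _ (by simp)
    have hy : yVar k + xVar k ^ d ∈ IntermediateField.adjoin k {xVar k, yVar k + xVar k ^ d} :=
      IntermediateField.subset_adjoin _ _ (by simp)
    refine IntermediateField.adjoin_le_iff.2 ?_
    rintro f (hf | hf)
    · rwa [hf]
    · rw [Set.mem_singleton_iff.1 hf]
      have := sub_mem hy (pow_mem hx d)
      rwa [add_sub_cancel_right] at this
  exact algebraicIndependent_of_KOne_le k 2 0 h

variable (k) in
/-- The substitution `x ↦ x`, `y ↦ y + x ^ d`. -/
def shift (d : ℕ) : TopField k →ₐ[k] TopField k := substHom (algebraicIndependent_shift d)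

theorem shift_xVar (d : ℕ) : shift k d (xVar k) = xVar k := substHom_xVar _

theorem shift_yVar (d : ℕ) : shift k d (yVar k) = yVar k + xVar k ^ d := substHom_yVar _

theorem charP_topField {p : ℕ} [CharP k p] : CharP (TopField k) p :=
  charP_of_injective_algebraMap (algebraMap k (TopField k)).injective p

variable {p c d : ℕ} [hp : Fact p.Prime] [CharP k p]

/-- `v` is fixed by the shift because `x ^ (d p) = x ^ c x ^ d` for `c = (p - 1) d`. -/
theorem shift_vElt (hd : c = (p - 1) * d) : shift k d (vElt k p c) = vElt k p c := by
  have := charP_topField (k := k) (p := p)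
  obtain ⟨q, hq⟩ := Nat.exists_eq_succ_of_ne_zero hp.out.ne_zero
  have hc : c + d = d * p := by
    rw [hd, hq, Nat.succ_sub_one, Nat.succ_eq_add_one]
    ring
  rw [vElt, map_sub, map_mul, map_pow, map_pow, shift_xVar, shift_yVar, add_pow_char, ← pow_mul,
    ← hc, pow_add]
  ring

theorem shift_KOne (hd : c = (p - 1) * d) (f : KOne k p c) : shift k d (f : TopField k) = f := by
  refine algHom_eqOn_adjoin (f := shift k d) (g := AlgHom.id k _) ?_ f.2
  rintro f (hf | hf)
  · rw [hf]
    exact shift_xVar d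
  · rw [Set.mem_singleton_iff.1 hf]
    exact shift_vElt hd

/-- The extension `k(x, y)` of `k(x, v)` is generated by `y / x ^ d`. -/
theorem isArtinSchreierExtension_top (hd : c = (p - 1) * d) :
    IsArtinSchreierExtension p (KOne k p c) ⊤ := by
  have h0 := xVar_ne_zero (k := k)
  have hx : xVar k ∈ KOne k p c := (xOne k p c).2
  have hv : vElt k p c ∈ KOne k p c := (vOne k p c).2
  obtain ⟨q, hq⟩ := Nat.exists_eq_succ_of_ne_zero hp.out.ne_zero
  have hc : d * p = c + d := by
    rw [hd, hq, Nat.succ_sub_one, Nat.succ_eq_add_one]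
    ring
  refine ⟨le_top, yVar k / xVar k ^ d, ?_, ?_, ?_⟩
  · have h1 : (yVar k / xVar k ^ d) ^ p - yVar k / xVar k ^ d =
        vElt k p c / xVar k ^ (d * p) := by
      rw [vElt, div_pow, ← pow_mul, hc, pow_add]
      field_simp
    rw [h1]
    exact IntermediateField.div_mem _ hv (pow_mem hx _)
  · intro hmem
    have h1 := shift_KOne hd ⟨_, hmem⟩
    simp only [map_div₀, map_pow, shift_xVar, shift_yVar, add_div,
      div_self (pow_ne_zero d h0)] at h1
    exact one_ne_zero (add_eq_left.1 h1)
  · rw [eq_comm, eq_top_iff, ← adjoin_xVar_yVar]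
    have hle1 : KOne k p c ≤ KOne k p c ⊔ IntermediateField.adjoin k {yVar k / xVar k ^ d} :=
      le_sup_left
    have hle2 : IntermediateField.adjoin k {yVar k / xVar k ^ d} ≤
      KOne k p c ⊔ IntermediateField.adjoin k {yVar k / xVar k ^ d} := le_sup_right
    refine IntermediateField.adjoin_le_iff.2 ?_
    rintro f (hf | hf)
    · rw [hf]
      exact hle1 hx
    · rw [Set.mem_singleton_iff.1 hf]
      have h1 := mul_mem (hle2 (IntermediateField.subset_adjoin _ _ (Set.mem_singleton _)))
        (pow_mem (hle1 hx) d)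
      rwa [div_mul_cancel₀ _ (pow_ne_zero d h0)] at h1

/-- The substitution `shift` as an automorphism over `k(x, v)`. -/
def shiftEquiv (hd : c = (p - 1) * d) : TopField k ≃ₐ[KOne k p c] TopField k :=
  AlgEquiv.ofBijective (AlgHom.mk (shift k d).toRingHom fun f => shift_KOne hd f)
    (algHom_bijective_of_finite _)

theorem shiftEquiv_apply (hd : c = (p - 1) * d) (f : TopField k) :
    shiftEquiv hd f = shift k d f := rfl

theorem shiftEquiv_pow_yVar (hd : c = (p - 1) * d) (n : ℕ) :
    (shiftEquiv hd ^ n) (yVar k) = yVar k + n * xVar k ^ d := by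
  induction n with
  | zero => simp
  | succ n ih =>
    rw [pow_succ', AlgEquiv.mul_apply, ih, shiftEquiv_apply, map_add, map_mul, map_natCast, map_pow,
      shift_xVar, shift_yVar]
    push_cast
    ring

theorem shiftEquiv_pow_prime (hd : c = (p - 1) * d) :
    (shiftEquiv hd : TopField k ≃ₐ[KOne k p c] TopField k) ^ p = 1 := by
  have := charP_topField (k := k) (p := p)
  refine AlgEquiv.ext fun f => ?_
  have h := algHom_eqOn_adjoin (k := k)
    (f := ((shiftEquiv hd ^ p : TopField k ≃ₐ[KOne k p c] TopField k).restrictScalars k).toAlgHom)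
    (g := AlgHom.id k (TopField k)) (s := {xVar k, yVar k}) ?_
    (x := f) (adjoin_xVar_yVar (k := k) ▸ IntermediateField.mem_top)
  · exact h
  · rintro f (hf | hf)
    · rw [hf]
      exact (shiftEquiv hd ^ p).commutes (xOne k p c)
    · rw [Set.mem_singleton_iff.1 hf]
      refine (shiftEquiv_pow_yVar hd p).trans ?_
      rw [CharP.cast_eq_zero, zero_mul, add_zero]
      rfl

theorem shiftEquiv_ne_one (hd : c = (p - 1) * d) :
    (shiftEquiv hd : TopField k ≃ₐ[KOne k p c] TopField k) ≠ 1 := by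
  intro h
  have h1 := shiftEquiv_apply hd (yVar k)
  rw [h, shift_yVar, AlgEquiv.one_apply, left_eq_add] at h1
  exact pow_ne_zero d xVar_ne_zero h1

/-- The fixed field of the shift is `k(x, v)`. -/
theorem mem_KOne_of_shift_eq (hd : c = (p - 1) * d) {f : TopField k} (hf : shift k d f = f) :
    f ∈ KOne k p c := by
  obtain ⟨g, rfl⟩ := mem_range_algebraMap_of_fixed hp.out (finrank_KOne_le k p c)
    (shiftEquiv_pow_prime hd) (shiftEquiv_ne_one hd) hf
  exact g.2

end Galois

/-! ### The local rings at the origin as models -/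

section Origin

variable {k : Type*} [Field k] {F : Type*} [Field F] [Algebra k F]
  {ν : AddValuation F (WithTop ℚ)}

theorem mem_originIdeal_iff (hν : IsResidueRational k ν) {a b : F} (ha : 0 < ν a) (hb : 0 < ν b)
    (f : (Algebra.adjoin k {a, b}).toSubring) : f ∈ originIdeal k a b ↔ ν (f : F) ≠ 0 := by
  have hnn : ∀ g ∈ (Algebra.adjoin k {a, b}).toSubring, 0 ≤ ν g := fun g hg =>
    val_nonneg_of_mem_adjoin hν (by rintro h (rfl | rfl); exacts [ha.le, hb.le]) hg
  have hpos : ∀ s ∈ (Algebra.adjoin k {a, b}).toSubring,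
      ∀ t ∈ (Algebra.adjoin k {a, b}).toSubring, 0 < ν (s * a + t * b) := fun s hs t ht =>
    AddValuation.map_lt_add ν (val_mul_pos (hnn s hs) ha) (val_mul_pos (hnn t ht) hb)
  constructor
  · intro hf
    obtain ⟨s, t, hst⟩ := Ideal.mem_span_pair.1 hf
    have : (f : F) = s * a + t * b := (congrArg Subtype.val hst).symm
    rw [this]
    exact (hpos s s.2 t t.2).ne'
  · intro hf
    obtain ⟨c, s, hs, t, ht, hst⟩ := exists_eq_algebraMap_add_of_mem_adjoin f.2
    have hc : c = 0 := by
      by_contra hc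
      apply hf
      have h1 : algebraMap k F c - -(s * a + t * b) = f := by rw [hst]; ring
      rw [← h1, sub_neg_eq_add]
      refine (AddValuation.map_add_eq_of_lt_left ν ?_).trans (hν.val_algebraMap c hc)
      rw [hν.val_algebraMap c hc]
      exact hpos s hs t ht
    refine Ideal.mem_span_pair.2 ⟨⟨s, hs⟩, ⟨t, ht⟩, Subtype.ext ?_⟩
    rw [hst, hc, map_zero, zero_add]
    rfl

theorem isModel_ofPrime (hν : IsResidueRational k ν) {a b : F} (ha : 0 < ν a) (hb : 0 < ν b)
    (htop : IntermediateField.adjoin k {a, b} = ⊤) [(originIdeal k a b).IsPrime] :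
    IsModel k ν (LocalSubring.ofPrime (Algebra.adjoin k {a, b}).toSubring (originIdeal k a b))
      a b where
  left_pos := ha
  right_pos := hb
  adjoin_eq_top := htop
  toSubring_eq := toSubring_ofPrime_eq_locSubring _ (mem_originIdeal_iff hν ha hb)

end Origin

section Uniqueness

variable {k : Type*} [Field k] {p : ℕ} [hp : Fact p.Prime]

theorem isModel_ringS {ν : AddValuation (TopField k) (WithTop ℚ)} (hν : IsResidueRational k ν)
    (hval : ∀ j, ν (seqQ k p j) = (keyValue (nS p) (eS p) j : WithTop ℚ)) :
    IsModel k ν (ringS k) (xVar k) (yVar k) := by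
  have hpos : ∀ j, 0 < ν (seqQ k p j) := fun j => by
    rw [hval]
    exact WithTop.coe_lt_coe.2 ((isKeyExponents_S p).keyValue_pos j)
  exact isModel_ofPrime (a := xVar k) (b := yVar k) hν (hpos 0) (hpos 1) adjoin_xVar_yVar

theorem isKeySequence_seqQ {ν : AddValuation (TopField k) (WithTop ℚ)}
    (hν : IsResidueRational k ν)
    (hval : ∀ j, ν (seqQ k p j) = (keyValue (nS p) (eS p) j : WithTop ℚ)) :
    IsKeySequence k ν (ringS k) (nS p) (eS p) (seqQ k p) where
  residue := hν
  dominated := (isModel_ringS hν hval).le_valuationRing hν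
  algebraMap_mem := (isModel_ringS hν hval).algebraMap_mem
  generatesCenter := (isModel_ringS hν hval).generatesCenter hν
  succ := keySeq_succ _ _ _ _
  val := hval

theorem algebraMap_mem_ringS (P : MvPolynomial (Fin 2) k) :
    algebraMap (MvPolynomial (Fin 2) k) (TopField k) P ∈ (ringS k).toSubring :=
  LocalSubring.le_ofPrime _ _ (mem_adjoin_of_algebraMap P)

/-- Every element of `k(x, y)` is a quotient of elements of `S`, on which the generating sequence
determines the valuation. -/
theorem val_unique {β : ℕ → ℚ} {ν ν' : AddValuation (TopField k) (WithTop ℚ)}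
    {Q : ℕ → TopField k} (h : IsValuationGeneratedBy k ν (ringS k) Q β)
    (h' : IsValuationGeneratedBy k ν' (ringS k) Q β) : ν = ν' := by
  refine AddValuation.ext fun f => ?_
  obtain ⟨P, D, hD, rfl⟩ := IsFractionRing.div_surjective (A := MvPolynomial (Fin 2) k) f
  have hD0 : algebraMap (MvPolynomial (Fin 2) k) (TopField k) D ≠ 0 := by
    simpa using nonZeroDivisors.ne_zero hD
  rcases eq_or_ne (algebraMap (MvPolynomial (Fin 2) k) (TopField k) P) 0 with hP | hP
  · rw [hP, zero_div, AddValuation.map_zero, AddValuation.map_zero]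
  have h1 := h.eq_on h' _ (algebraMap_mem_ringS P)
  have h2 := h.eq_on h' _ (algebraMap_mem_ringS D)
  obtain ⟨q, hq⟩ := exists_val_eq_coe ν hP
  obtain ⟨r, hr⟩ := exists_val_eq_coe ν hD0
  rw [val_div hq hr, val_div (h1 ▸ hq) (h2 ▸ hr)]

variable [CharP k p] [IsAlgClosed k]

theorem toHahn_seqQ (j : ℕ) : toHahn k p (seqQ k p j) =
    keySeq (nS p) (eS p) (HahnSeries.single (1 : ℚ) (1 : k)) (yHahn k p) j := by
  suffices h : ∀ j, toHahn k p (seqQ k p j) =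
      keySeq (nS p) (eS p) (HahnSeries.single (1 : ℚ) (1 : k)) (yHahn k p) j ∧
      toHahn k p (seqQ k p (j + 1)) =
      keySeq (nS p) (eS p) (HahnSeries.single (1 : ℚ) (1 : k)) (yHahn k p) (j + 1) from (h j).1
  intro j
  induction j with
  | zero => exact ⟨toHahn_xVar p, toHahn_yVar p⟩
  | succ j ih =>
    refine ⟨ih.2, ?_⟩
    rw [seqQ, keySeq_succ, keySeq_succ, map_sub, map_pow]
    have h2 := ih.2
    rw [seqQ] at h2
    rw [h2]
    congr 1
    cases j with
    | zero => exact toHahn_xVar p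
    | succ j =>
      have h1 := ih.1
      rw [seqQ] at h1
      simp only [keyDenom, map_mul, map_pow, h1]
      congr 2
      exact toHahn_xVar p

theorem hahnVal_seqQ (j : ℕ) :
    hahnVal k p (seqQ k p j) = (keyValue (nS p) (eS p) j : WithTop ℚ) := by
  rw [hahnVal_apply, toHahn_seqQ, orderTop_keySeq_yHahn]

theorem isValuationGeneratedBy_hahnVal :
    IsValuationGeneratedBy k (hahnVal k p) (ringS k) (seqQ k p) (keyValue (nS p) (eS p)) :=
  (isKeySequence_seqQ (isResidueRational_hahnVal p) hahnVal_seqQ).isValuationGeneratedBy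
    (isKeyExponents_S p)

theorem existsUnique_valuation : ∃! ν : AddValuation (TopField k) (WithTop ℚ),
    IsValuationGeneratedBy k ν (ringS k) (seqQ k p) (keyValue (nS p) (eS p)) :=
  ⟨hahnVal k p, isValuationGeneratedBy_hahnVal, fun _ h =>
    val_unique h isValuationGeneratedBy_hahnVal⟩

theorem IsValuationGeneratedBy.isResidueRational {ν : AddValuation (TopField k) (WithTop ℚ)}
    (h : IsValuationGeneratedBy k ν (ringS k) (seqQ k p) (keyValue (nS p) (eS p))) :
    IsResidueRational k ν := by
  rw [val_unique h isValuationGeneratedBy_hahnVal]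
  exact isResidueRational_hahnVal p

end Uniqueness

/-! ### Perturbation of key sequences -/

section Perturbation

variable {F : Type*} [Field F]

/-- The additive group generated by the monomials `x ^ i * y ^ j` of weight `i + j * w ≥ γ`. -/
def weightGroup (x y : F) (w γ : ℚ) : AddSubgroup F :=
  AddSubgroup.closure {f | ∃ i j : ℕ, γ ≤ i + j * w ∧ f = x ^ i * y ^ j}

variable {x y : F} {w : ℚ}

theorem monomial_mem_weightGroup {γ : ℚ} {i j : ℕ} (h : γ ≤ i + j * w) :
    x ^ i * y ^ j ∈ weightGroup x y w γ := AddSubgroup.subset_closure ⟨i, j, h, rfl⟩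

theorem weightGroup_anti {γ γ' : ℚ} (h : γ ≤ γ') : weightGroup x y w γ' ≤ weightGroup x y w γ :=
  AddSubgroup.closure_mono fun _ ⟨i, j, hij, hf⟩ => ⟨i, j, h.trans hij, hf⟩

theorem mul_mem_weightGroup {γ γ' : ℚ} {f g : F} (hf : f ∈ weightGroup x y w γ)
    (hg : g ∈ weightGroup x y w γ') : f * g ∈ weightGroup x y w (γ + γ') := by
  induction hf using AddSubgroup.closure_induction with
  | mem f hf =>
    obtain ⟨i, j, hij, rfl⟩ := hf
    induction hg using AddSubgroup.closure_induction with
    | mem g hg =>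
      obtain ⟨i', j', hij', rfl⟩ := hg
      have : x ^ i * y ^ j * (x ^ i' * y ^ j') = x ^ (i + i') * y ^ (j + j') := by ring
      rw [this]
      refine monomial_mem_weightGroup ?_
      push_cast
      linarith
    | zero => rw [mul_zero]; exact zero_mem _
    | add a b _ _ ha hb => rw [mul_add]; exact add_mem ha hb
    | neg a _ ha => rw [mul_neg]; exact neg_mem ha
  | zero => rw [zero_mul]; exact zero_mem _
  | add a b _ _ ha hb => rw [add_mul]; exact add_mem ha hb
  | neg a _ ha => rw [neg_mul]; exact neg_mem ha

theorem pow_mem_weightGroup {γ : ℚ} {f : F} (hf : f ∈ weightGroup x y w γ) (n : ℕ) :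
    f ^ n ∈ weightGroup x y w (n * γ) := by
  induction n with
  | zero =>
    have := monomial_mem_weightGroup (x := x) (y := y) (w := w) (γ := (0 : ℕ) * γ) (i := 0) (j := 0)
      (by simp)
    simpa using this
  | succ n ih =>
    rw [pow_succ]
    refine weightGroup_anti (le_of_eq ?_) (mul_mem_weightGroup ih hf)
    push_cast
    ring

theorem le_val_of_mem_weightGroup {ν : AddValuation F (WithTop ℚ)} (hx : ν x = (1 : ℚ))
    (hy : ν y = w) {γ : ℚ} {f : F} (hf : f ∈ weightGroup x y w γ) : (γ : WithTop ℚ) ≤ ν f := by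
  induction hf using AddSubgroup.closure_induction with
  | mem f hf =>
    obtain ⟨i, j, hij, rfl⟩ := hf
    rw [val_mul (val_pow hx i) (val_pow hy j), mul_one]
    exact WithTop.coe_le_coe.2 hij
  | zero => rw [AddValuation.map_zero]; exact le_top
  | add a b _ _ ha hb => exact AddValuation.map_le_add ν ha hb
  | neg a _ ha => rwa [AddValuation.map_neg]

/-- Divisibility by powers of `t` of the elements of `weightGroup`, when `x` and `y` are
divisible by powers of `t` in the ring `B`. -/
theorem exists_eq_pow_mul_of_mem_weightGroup {B : Subring F} {t x' y' : F} {N : ℕ} {q : ℕ}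
    (ht : t ∈ B) (hx' : x' ∈ B) (hy' : y' ∈ B) (hx : x = x' * t ^ N) (hy : y = y' * t ^ q)
    (hw : (N : ℚ) * w = q) {γ : ℚ} {m : ℕ} (hm : (m : ℚ) < N * γ + 1) {f : F}
    (hf : f ∈ weightGroup x y w γ) : ∃ g ∈ B, f = g * t ^ m := by
  induction hf using AddSubgroup.closure_induction with
  | mem f hf =>
    obtain ⟨i, j, hij, rfl⟩ := hf
    have hle : m ≤ N * i + q * j := by
      have h1 := mul_le_mul_of_nonneg_left hij (Nat.cast_nonneg (α := ℚ) N)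
      have h2 : (N : ℚ) * (i + j * w) = N * i + q * j := by rw [← hw]; ring
      rw [h2] at h1
      have h3 : (m : ℚ) < ((N * i + q * j + 1 : ℕ) : ℚ) := by
        push_cast
        linarith
      exact Nat.lt_succ_iff.1 (Nat.cast_lt.1 h3)
    refine ⟨x' ^ i * y' ^ j * t ^ (N * i + q * j - m), B.mul_mem (B.mul_mem (B.pow_mem hx' _)
      (B.pow_mem hy' _)) (B.pow_mem ht _), ?_⟩
    rw [mul_assoc, ← pow_add, Nat.sub_add_cancel hle, hx, hy, mul_pow, mul_pow, pow_add, pow_mul,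
      pow_mul]
    ring
  | zero => exact ⟨0, B.zero_mem, by rw [zero_mul]⟩
  | add a b _ _ ha hb =>
    obtain ⟨g, hg, rfl⟩ := ha
    obtain ⟨h, hh, rfl⟩ := hb
    exact ⟨g + h, B.add_mem hg hh, by ring⟩
  | neg a _ ha =>
    obtain ⟨g, hg, rfl⟩ := ha
    exact ⟨-g, B.neg_mem hg, by ring⟩

/-- A weight larger than the value of the `j`-th member of a key sequence; a perturbation of weight
one of the second member changes the `j`-th member only by elements of at least this weight. -/
def gapValue (n e : ℕ → ℕ) (j : ℕ) : ℚ := keyValue n e j + 1 / partialProd n (j + 1)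

theorem keyValue_lt_gapValue {p : ℕ} {n e : ℕ → ℕ} (h : IsKeyExponents p n e) (j : ℕ) :
    keyValue n e j < gapValue n e j :=
  lt_add_of_pos_right _ (one_div_pos.2 (h.partialProd_cast_pos _))

theorem gapValue_one_le {p : ℕ} {n e : ℕ → ℕ} (h : IsKeyExponents p n e) : gapValue n e 1 ≤ 1 := by
  have h1 := h.two_le_cast 1
  have h2 := h.two_le_cast 2
  have h3 : (4 : ℚ) ≤ n 1 * n 2 := by nlinarith
  have h4 : (1 : ℚ) / n 1 ≤ 1 / 2 := one_div_le_one_div_of_le two_pos h1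
  have h5 : (1 : ℚ) / (n 1 * n 2) ≤ 1 / 4 := one_div_le_one_div_of_le four_pos h3
  have h6 : gapValue n e 1 = 1 / n 1 + 1 / (n 1 * n 2) := by
    simp [gapValue, keyValue, partialProd_succ, partialProd_zero]
  rw [h6]
  linarith

/-- The two estimates that carry the bound through the recursion: for the power of exponent
`n (j + 1)`, and for the product with `x ^ e (j + 2)`. -/
theorem gapValue_succ_le {p : ℕ} {n e : ℕ → ℕ} (h : IsKeyExponents p n e) (j : ℕ) :
    gapValue n e (j + 2) ≤ n (j + 1) * gapValue n e (j + 1) ∧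
      gapValue n e (j + 3) ≤ e (j + 2) + gapValue n e (j + 1) := by
  have key : ∀ i, gapValue n e (i + 2) ≤
      n (i + 1) * keyValue n e (i + 1) + 2 * (1 / partialProd n (i + 2)) := by
    intro i
    rw [gapValue, h.keyValue_succ]
    have : (1 : ℚ) / partialProd n (i + 2 + 1) ≤ 1 / partialProd n (i + 2) := by
      refine one_div_le_one_div_of_le (h.partialProd_cast_pos _) ?_
      exact_mod_cast Nat.le_of_dvd (h.partialProd_pos _) (partialProd_dvd n (Nat.le_succ _))
    linarith
  constructor
  · refine (key j).trans ?_
    have h1 : (2 : ℚ) * (1 / partialProd n (j + 2)) ≤ n (j + 1) * (1 / partialProd n (j + 2)) :=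
      mul_le_mul_of_nonneg_right (h.two_le_cast _)
        (one_div_nonneg.2 (h.partialProd_cast_pos _).le)
    rw [gapValue, mul_add]
    linarith
  · refine (key (j + 1)).trans ?_
    have h1 := h.n_mul_keyValue j
    have h2 : (1 : ℚ) / partialProd n (j + 2) = n (j + 3) * (1 / partialProd n (j + 3)) := by
      have h4 := h.partialProd_cast_pos (j + 2)
      have h5 := h.cast_pos (j + 3)
      rw [partialProd_succ n (j + 2)]
      push_cast
      field_simp
    have h3 : (2 : ℚ) * (1 / partialProd n (j + 3)) ≤ n (j + 3) * (1 / partialProd n (j + 3)) :=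
      mul_le_mul_of_nonneg_right (h.two_le_cast _)
        (one_div_nonneg.2 (h.partialProd_cast_pos _).le)
    rw [gapValue]
    linarith

/-- A perturbation of weight one of the second member of a key sequence changes its `j`-th member by
an element of weight larger than the value of the `j`-th member. -/
theorem keySeq_sub_keySeq_mem {p : ℕ} [CharP F p] {n e : ℕ → ℕ} (h : IsKeyExponents p n e)
    {b b' : F} (hb : b' - b ∈ weightGroup x y w 1) (j : ℕ) :
    keySeq n e x b' j - keySeq n e x b j ∈ weightGroup x y w (gapValue n e j) := by
  have hp : Fact p.Prime := ⟨h.prime⟩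
  have hpow : ∀ (f g : F) (i : ℕ), f ^ n i - g ^ n i = (f - g) ^ n i := fun f g i => by
    obtain ⟨r, hr⟩ := h.exists_pow i
    rw [hr, sub_pow_char_pow]
  suffices hs : ∀ j, keySeq n e x b' j - keySeq n e x b j ∈ weightGroup x y w (gapValue n e j) ∧
      keySeq n e x b' (j + 1) - keySeq n e x b (j + 1) ∈
        weightGroup x y w (gapValue n e (j + 1)) from (hs j).1
  intro j
  induction j with
  | zero =>
    refine ⟨?_, weightGroup_anti (gapValue_one_le h) hb⟩
    have : keySeq n e x b' 0 - keySeq n e x b 0 = 0 := sub_self x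
    rw [this]
    exact zero_mem _
  | succ j ih =>
    refine ⟨ih.2, ?_⟩
    have h1 := weightGroup_anti (gapValue_succ_le h j).1 (pow_mem_weightGroup ih.2 (n (j + 1)))
    rw [← hpow] at h1
    cases j with
    | zero =>
      convert h1 using 1
      change (b' ^ n 1 - x) - (b ^ n 1 - x) = b' ^ n 1 - b ^ n 1
      ring
    | succ j =>
      have h2 : x ^ e (j + 2) ∈ weightGroup x y w (e (j + 2)) := by
        have := monomial_mem_weightGroup (x := x) (y := y) (w := w) (γ := e (j + 2))
          (i := e (j + 2)) (j := 0) (by simp)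
        simpa using this
      have h3 := weightGroup_anti (gapValue_succ_le h j).2 (mul_mem_weightGroup h2 ih.1)
      convert sub_mem h1 h3 using 1
      rw [keySeq_succ, keySeq_succ]
      simp only [keyDenom]
      change _ - x ^ _ * _ - (_ - x ^ _ * _) = _
      ring

end Perturbation

/-! ### Comparison of the two key sequences -/

section Comparison

theorem isKeyExponents_A (p : ℕ) [hp : Fact p.Prime] : IsKeyExponents p (nA p) (eA p) where
  prime := hp.out
  exists_pow j := by
    rw [nA]
    split_ifs
    · exact ⟨0, (pow_one p).symm⟩
    · exact ⟨2, rfl⟩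
  period j := by
    have : Odd (j + 2) ↔ Odd j := by simp [Nat.odd_add]
    simp only [nA, this]
  e_one := by simp [eA]
  e_succ j := by
    rcases Nat.even_or_odd j with hj | hj
    · have h1 : ¬ Odd (j + 2) := by rw [Nat.not_odd_iff_even]; exact hj.add even_two
      have h2 : Odd (j + 1) := hj.add_one
      rw [eA, eA, nA, if_neg h1, if_pos h2, if_neg h1, ← pow_add]
      congr 1
      omega
    · have h1 : Odd (j + 2) := hj.add_even even_two
      have h2 : ¬ Odd (j + 1) := by rw [Nat.not_odd_iff_even]; exact hj.add_one
      rw [eA, eA, nA, if_pos h1, if_neg h2, if_pos h1, ← pow_succ']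
      congr 1

/-- The exponent `ε` such that `U j` is a perturbation of `Q j ^ ε`. -/
def powExp (p j : ℕ) : ℕ := if Odd j then p else 1

theorem powExp_zero (p : ℕ) : powExp p 0 = 1 := if_neg (by simp)

theorem powExp_one (p : ℕ) : powExp p 1 = p := if_pos odd_one

theorem powExp_add_two (p j : ℕ) : powExp p (j + 2) = powExp p j := by
  have : Odd (j + 2) ↔ Odd j := by simp [Nat.odd_add]
  simp only [powExp, this]

theorem powExp_mul_nA (p j : ℕ) : powExp p j * nA p j = nS p j * powExp p (j + 1) := by
  have : Odd (j + 1) ↔ ¬ Odd j := Nat.odd_add_one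
  simp only [powExp, nA, nS, this]
  split_ifs <;> ring

theorem eA_eq (p j : ℕ) : eA p (j + 1) = eS p (j + 1) * powExp p j := by
  have : Odd (j + 1) ↔ ¬ Odd j := Nat.odd_add_one
  simp only [powExp, eA, eS, this]
  split_ifs with h
  · rw [← pow_succ]
    congr 1
  · rw [mul_one]

theorem exists_powExp_eq (p j : ℕ) : ∃ r, powExp p j = p ^ r := by
  rw [powExp]
  split_ifs
  · exact ⟨1, (pow_one p).symm⟩
  · exact ⟨0, (pow_zero p).symm⟩

theorem keyValue_A (p : ℕ) [hp : Fact p.Prime] (j : ℕ) :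
    keyValue (nA p) (eA p) j = powExp p j * keyValue (nS p) (eS p) j := by
  have hp0 : (p : ℚ) ≠ 0 := Nat.cast_ne_zero.2 hp.out.ne_zero
  match j with
  | 0 => simp [keyValue, powExp_zero]
  | 1 =>
    simp only [keyValue, powExp_one, nA, nS, if_pos odd_one]
    push_cast
    field_simp
  | j + 2 =>
    have ih := keyValue_A p (j + 1)
    have h1 : ((powExp p (j + 2) * nA p (j + 2) : ℕ) : ℚ) = nS p (j + 2) * powExp p (j + 1) := by
      rw [powExp_mul_nA, powExp_add_two]
      push_cast
      rfl
    have hA := (isKeyExponents_A p).cast_pos (j + 2)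
    have hS := (isKeyExponents_S p).cast_pos (j + 2)
    rw [keyValue, keyValue, ih, eA_eq]
    push_cast at h1 ⊢
    field_simp
    linear_combination
      -(((eS p (j + 2) : ℚ) + keyValue (nS p) (eS p) (j + 1))) * h1

/-- Taken to the powers `powExp`, the recursion in `S` becomes the recursion in `A`, started at
`y ^ p` instead of `y`: Frobenius is additive, and the exponents match. -/
theorem pow_powExp_keySeq {F : Type*} [Field F] {p : ℕ} [hp : Fact p.Prime] [CharP F p] (x y : F)
    (j : ℕ) : keySeq (nS p) (eS p) x y j ^ powExp p j = keySeq (nA p) (eA p) x (y ^ p) j := by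
  have hpow : ∀ (f g : F) (i : ℕ), (f - g) ^ powExp p i = f ^ powExp p i - g ^ powExp p i :=
    fun f g i => by
      obtain ⟨r, hr⟩ := exists_powExp_eq p i
      rw [hr, sub_pow_char_pow]
  match j with
  | 0 => rw [powExp_zero, pow_one]; rfl
  | 1 => rw [powExp_one]; rfl
  | j + 2 =>
    have ih1 := pow_powExp_keySeq x y (p := p) (j + 1)
    rw [keySeq_succ, keySeq_succ, hpow, ← ih1, ← pow_mul, ← pow_mul, ← powExp_mul_nA]
    congr 1
    match j with
    | 0 => rw [powExp_add_two, powExp_zero, pow_one]; rfl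
    | j + 1 =>
      have ih0 := pow_powExp_keySeq x y (p := p) (j + 1)
      simp only [keyDenom]
      rw [← ih0, eA_eq, powExp_add_two, mul_pow, ← pow_mul]
      rfl

end Comparison

/-! ### The restriction of the valuation, and its invariance under the Galois group -/

section Restriction

variable {k : Type*} [Field k] {p c d : ℕ}

theorem map_keySeq {F E : Type*} [Field F] [Field E] (f : F →+* E) (n e : ℕ → ℕ) (a b : F) (j : ℕ) :
    f (keySeq n e a b j) = keySeq n e (f a) (f b) j := by
  suffices h : f (keySeq n e a b j) = keySeq n e (f a) (f b) j ∧
      f (keySeq n e a b (j + 1)) = keySeq n e (f a) (f b) (j + 1) from h.1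
  induction j with
  | zero => exact ⟨rfl, rfl⟩
  | succ j ih =>
    refine ⟨ih.2, ?_⟩
    rw [keySeq_succ, keySeq_succ, map_sub, map_pow, ih.2]
    congr 1
    cases j with
    | zero => rfl
    | succ j =>
      simp only [keyDenom, map_mul, map_pow, ih.1]
      rfl

theorem coe_seqU (j : ℕ) :
    (seqU k p c j : TopField k) = keySeq (nA p) (eA p) (xVar k) (vElt k p c) j :=
  map_keySeq (algebraMap (KOne k p c) (TopField k)) _ _ _ _ j

variable [hp : Fact p.Prime]

variable (k c) in
/-- `U j` is a perturbation of `Q j ^ powExp p j`, since `v = y ^ p - x ^ c y` and the weight of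
`x ^ c y` is at least one. -/
theorem seqU_sub_mem [CharP k p] (hc : 0 < c) (j : ℕ) :
    (seqU k p c j : TopField k) - seqQ k p j ^ powExp p j ∈
      weightGroup (xVar k) (yVar k) (keyValue (nS p) (eS p) 1) (gapValue (nA p) (eA p) j) := by
  have := charP_topField (k := k) (p := p)
  rw [coe_seqU, seqQ, pow_powExp_keySeq]
  refine keySeq_sub_keySeq_mem (isKeyExponents_A p) ?_ j
  have h : vElt k p c - yVar k ^ p = -(xVar k ^ c * yVar k ^ 1) := by
    rw [vElt]
    ring
  rw [h]
  refine neg_mem (monomial_mem_weightGroup ?_)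
  have h1 : (1 : ℚ) ≤ c := by exact_mod_cast hc
  have h2 := (isKeyExponents_S p).keyValue_pos 1
  push_cast
  linarith

theorem val_add_of_lt {F : Type*} [Field F] {ν : AddValuation F (WithTop ℚ)} {f g : F} {q : ℚ}
    (hf : ν f = q) (hg : (q : WithTop ℚ) < ν g) : ν (f + g) = q := by
  rw [← hf] at hg ⊢
  exact AddValuation.map_add_eq_of_lt_left ν hg

theorem IsResidueRational.comap {F : Type*} [Field F] [Algebra k F]
    {ν : AddValuation F (WithTop ℚ)} (h : IsResidueRational k ν) {E : Type*} [Field E] [Algebra k E]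
    (f : E →ₐ[k] F) : IsResidueRational k (ν.comap f.toRingHom) where
  val_algebraMap a ha := by
    change ν (f (algebraMap k E a)) = 0
    rw [AlgHom.commutes]
    exact h.val_algebraMap a ha
  exists_residue g hg := by
    obtain ⟨a, ha⟩ := h.exists_residue (f g) hg
    refine ⟨a, ?_⟩
    change 0 < ν (f (g - algebraMap k E a))
    rwa [map_sub, AlgHom.commutes]

variable {ν : AddValuation (TopField k) (WithTop ℚ)}

theorem val_seqU [CharP k p] (h : IsKeySequence k ν (ringS k) (nS p) (eS p) (seqQ k p))
    (hc : 0 < c) (j : ℕ) :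
    ν (seqU k p c j : TopField k) = (keyValue (nA p) (eA p) j : WithTop ℚ) := by
  have h1 := le_val_of_mem_weightGroup (h.val 0) (h.val 1) (seqU_sub_mem k c hc j)
  have h2 := val_pow (h.val j) (powExp p j)
  rw [← keyValue_A] at h2
  have h3 := val_add_of_lt h2
    ((WithTop.coe_lt_coe.2 (keyValue_lt_gapValue (isKeyExponents_A p) j)).trans_le h1)
  rwa [add_sub_cancel] at h3

theorem isModel_ringA [CharP k p] (h : IsKeySequence k ν (ringS k) (nS p) (eS p) (seqQ k p))
    (hc : 0 < c) : IsModel k (ν.comap (algebraMap (KOne k p c) (TopField k))) (ringA k p c)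
      (xOne k p c) (vOne k p c) := by
  have hpos : ∀ j, 0 < ν (seqU k p c j : TopField k) := fun j => by
    rw [val_seqU h hc]
    exact WithTop.coe_lt_coe.2 ((isKeyExponents_A p).keyValue_pos j)
  exact isModel_ofPrime (a := xOne k p c) (b := vOne k p c) (h.residue.comap (KOne k p c).val)
    (hpos 0) (hpos 1) (adjoin_xOne_vOne k p c)

theorem isKeySequence_seqU [CharP k p]
    (h : IsKeySequence k ν (ringS k) (nS p) (eS p) (seqQ k p)) (hc : 0 < c) :
    IsKeySequence k (ν.comap (algebraMap (KOne k p c) (TopField k))) (ringA k p c) (nA p) (eA p)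
      (seqU k p c) where
  residue := h.residue.comap (KOne k p c).val
  dominated := (isModel_ringA h hc).le_valuationRing (h.residue.comap (KOne k p c).val)
  algebraMap_mem := (isModel_ringA h hc).algebraMap_mem
  generatesCenter := (isModel_ringA h hc).generatesCenter (h.residue.comap (KOne k p c).val)
  succ := keySeq_succ _ _ _ _
  val := val_seqU h hc

/-- The shift adds `x ^ d`, of weight at least one, to `y`. -/
theorem shift_seqQ_sub_mem [CharP k p] (hd : 0 < d) (j : ℕ) :
    shift k d (seqQ k p j) - seqQ k p j ∈
      weightGroup (xVar k) (yVar k) (keyValue (nS p) (eS p) 1) (gapValue (nS p) (eS p) j) := by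
  have := charP_topField (k := k) (p := p)
  have h1 : shift k d (seqQ k p j) =
      keySeq (nS p) (eS p) (xVar k) (yVar k + xVar k ^ d) j := by
    have h2 := map_keySeq (shift k d).toRingHom (nS p) (eS p) (xVar k) (yVar k) j
    have h3 : (shift k d).toRingHom (xVar k) = xVar k := shift_xVar d
    have h4 : (shift k d).toRingHom (yVar k) = yVar k + xVar k ^ d := shift_yVar d
    rw [h3, h4] at h2
    exact h2
  rw [h1, seqQ]
  refine keySeq_sub_keySeq_mem (isKeyExponents_S p) ?_ j
  have h2 : yVar k + xVar k ^ d - yVar k = xVar k ^ d * yVar k ^ 0 := by ring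
  rw [h2]
  refine monomial_mem_weightGroup ?_
  have h3 : (1 : ℚ) ≤ d := by exact_mod_cast hd
  simpa using h3

/-- The valuation is invariant under the shift, as it is determined by its values on the key
sequence. -/
theorem val_shift [CharP k p] (h : IsKeySequence k ν (ringS k) (nS p) (eS p) (seqQ k p))
    (hd : 0 < d) (f : TopField k) : ν (shift k d f) = ν f := by
  have hres := h.residue.comap (shift k d)
  have hval : ∀ j, ν.comap (shift k d).toRingHom (seqQ k p j) =
      (keyValue (nS p) (eS p) j : WithTop ℚ) := fun j => by
    have h1 := le_val_of_mem_weightGroup (h.val 0) (h.val 1) (shift_seqQ_sub_mem (p := p) hd j)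
    have h3 := val_add_of_lt (h.val j)
      ((WithTop.coe_lt_coe.2 (keyValue_lt_gapValue (isKeyExponents_S p) j)).trans_le h1)
    rwa [add_sub_cancel] at h3
  have := val_unique ((isKeySequence_seqQ hres hval).isValuationGeneratedBy (isKeyExponents_S p))
    (h.isValuationGeneratedBy (isKeyExponents_S p))
  exact DFunLike.congr_fun this f

end Restriction

/-! ### The parameters of `A_j` in terms of those of `S_j` -/

section KeyPowers

variable {k : Type*} [Field k] {F : Type*} [Field F] [Algebra k F]
  {ν : AddValuation F (WithTop ℚ)} {p : ℕ} {n e : ℕ → ℕ} {R : LocalSubring F} {Q : ℕ → F}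

/-- `f` is a unit of `B` times a power of `t`; here the units of `B` are its elements of value
zero. -/
def IsUnitMulPow (ν : AddValuation F (WithTop ℚ)) (B : Subring F) (t f : F) : Prop :=
  ∃ u ∈ B, ν u = 0 ∧ ∃ m : ℕ, f = u * t ^ m

theorem IsUnitMulPow.mul {B : Subring F} {t f g : F} (hf : IsUnitMulPow ν B t f)
    (hg : IsUnitMulPow ν B t g) : IsUnitMulPow ν B t (f * g) := by
  obtain ⟨u, hu, hu0, m, rfl⟩ := hf
  obtain ⟨u', hu', hu0', m', rfl⟩ := hg
  exact ⟨u * u', B.mul_mem hu hu', by rw [AddValuation.map_mul, hu0, hu0', add_zero], m + m',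
    by rw [pow_add]; ring⟩

theorem IsUnitMulPow.pow {B : Subring F} {t f : F} (hf : IsUnitMulPow ν B t f) (i : ℕ) :
    IsUnitMulPow ν B t (f ^ i) := by
  induction i with
  | zero => exact ⟨1, B.one_mem, AddValuation.map_one ν, 0, by simp⟩
  | succ i ih =>
    rw [pow_succ]
    exact ih.mul hf

theorem IsUnitMulPow.self {B : Subring F} {t : F} : IsUnitMulPow ν B t t :=
  ⟨1, B.one_mem, AddValuation.map_one ν, 1, by simp⟩

theorem IsUnitMulPow.trans {B B' : Subring F} (hB : B ≤ B') {t t' f : F}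
    (hf : IsUnitMulPow ν B t f) (ht : IsUnitMulPow ν B' t' t) : IsUnitMulPow ν B' t' f := by
  obtain ⟨u, hu, hu0, m, rfl⟩ := hf
  exact IsUnitMulPow.mul ⟨u, hB hu, hu0, 0, by simp⟩ (ht.pow m)

namespace IsKeySequence

/-- The first parameter of one stage is a unit times a power of the first parameter of the next. -/
theorem isUnitMulPow_secondParam (hp : IsKeyExponents p n e) (h : IsKeySequence k ν R n e Q)
    {A : ℕ → LocalSubring F} (hA : IsQuadraticSequence ν R A) (i : ℕ) :
    IsUnitMulPow ν (A (stage n (i + 2))).toSubring (secondParam e Q (i + 1))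
      (secondParam e Q i) := by
  have hgen := h.generatesCenter_stage hp hA (i + 1)
  have hgen' := h.generatesCenter_stage hp hA i
  have hmono : (A (stage n (i + 1))).toSubring ≤ (A (stage n (i + 2))).toSubring := by
    rw [stage_succ]
    exact hA.toSubring_mono (Nat.le_add_right _ _)
  have h1 : ν (1 + secondParam e Q (i + 2)) = 0 := val_one_add (h.val_secondParam_pos hp (i + 2))
  have h2 : 1 + secondParam e Q (i + 2) ∈ (A (stage n (i + 2))).toSubring :=
    Subring.add_mem _ (Subring.one_mem _) hgen.right_mem
  refine ⟨paramUnit e Q i * (1 + secondParam e Q (i + 2))⁻¹,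
    Subring.mul_mem _ (hmono (paramUnit_mem hgen'.left_mem))
      (inv_mem_of_val_eq_zero (hA.2.1 _) h2 h1), ?_, n (i + 1), ?_⟩
  · rw [AddValuation.map_mul, h.val_paramUnit hp, val_inv_of_val_eq_zero h1, add_zero]
  · rw [← div_eq_mul_inv, ← h.secondParam_div_pow hp,
      div_mul_cancel₀ _ (pow_ne_zero _ (h.secondParam_ne_zero hp _))]

/-- In the ring at stage `i + 1`, the members of the key sequence of index at most `i` are units
times powers of the first parameter. -/
theorem isUnitMulPow (hp : IsKeyExponents p n e) (h : IsKeySequence k ν R n e Q)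
    {A : ℕ → LocalSubring F} (hA : IsQuadraticSequence ν R A) (i : ℕ) :
    ∀ l ≤ i, IsUnitMulPow ν (A (stage n (i + 1))).toSubring (secondParam e Q i) (Q l) := by
  induction i with
  | zero =>
    intro l hl
    obtain rfl : l = 0 := Nat.le_zero.1 hl
    exact IsUnitMulPow.self
  | succ i ih =>
    have hmono : (A (stage n (i + 1))).toSubring ≤ (A (stage n (i + 2))).toSubring := by
      rw [stage_succ]
      exact hA.toSubring_mono (Nat.le_add_right _ _)
    have hold : ∀ l ≤ i, IsUnitMulPow ν (A (stage n (i + 2))).toSubring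
        (secondParam e Q (i + 1)) (Q l) := fun l hl =>
      (ih l hl).trans hmono (h.isUnitMulPow_secondParam hp hA i)
    intro l hl
    rcases Nat.le_succ_iff.1 hl with hl | rfl
    · exact hold l hl
    match i with
    | 0 => exact IsUnitMulPow.self
    | i + 1 =>
      have h1 : Q (i + 2) = secondParam e Q (i + 2) * keyDenom e Q (i + 1) := by
        rw [secondParam_succ, div_mul_cancel₀ _ (h.keyDenom_ne_zero _)]
      rw [Nat.succ_eq_add_one, h1]
      refine IsUnitMulPow.self.mul ?_
      match i with
      | 0 => exact hold 0 (by omega)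
      | i + 1 => exact ((hold 0 (by omega)).pow _).mul (hold (i + 1) (by omega))

theorem isUnitMulPow_keyDenom (hp : IsKeyExponents p n e) (h : IsKeySequence k ν R n e Q)
    {A : ℕ → LocalSubring F} (hA : IsQuadraticSequence ν R A) (i : ℕ) :
    IsUnitMulPow ν (A (stage n (i + 1))).toSubring (secondParam e Q i) (keyDenom e Q i) := by
  match i with
  | 0 => exact ⟨1, Subring.one_mem _, AddValuation.map_one ν, 0, by simp [keyDenom]⟩
  | 1 => exact h.isUnitMulPow hp hA 1 0 (by omega)
  | i + 2 =>
    exact ((h.isUnitMulPow hp hA (i + 2) 0 (by omega)).pow _).mul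
      (h.isUnitMulPow hp hA (i + 2) (i + 1) (by omega))

/-- In the ring at stage `i + 1`, for `i ≥ 1`, an element of weight larger than the value of `g`
is divisible by `g` times the first parameter, if `g` is a unit times a power of that parameter. -/
theorem exists_eq_mul_of_mem_weightGroup (hp : IsKeyExponents p n e)
    (h : IsKeySequence k ν R n e Q) {A : ℕ → LocalSubring F} (hA : IsQuadraticSequence ν R A)
    {i : ℕ} (hi : 1 ≤ i) {g f : F} {q γ : ℚ}
    (hg : IsUnitMulPow ν (A (stage n (i + 1))).toSubring (secondParam e Q i) g) (hq : ν g = q)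
    (hqγ : q < γ) (hf : f ∈ weightGroup (Q 0) (Q 1) (keyValue n e 1) γ) :
    ∃ r ∈ (A (stage n (i + 1))).toSubring, f = secondParam e Q i * r * g := by
  set t := secondParam e Q i with ht
  have hN := hp.partialProd_cast_pos i
  have htv : ν t = ((1 / partialProd n i : ℚ) : WithTop ℚ) := h.val_secondParam hp i
  have hpow : ∀ {f : F} {q : ℚ}, ν f = q →
      ∀ {u : F} {m : ℕ}, ν u = 0 → f = u * t ^ m → (m : ℚ) = partialProd n i * q := by
    intro f q hf u m hu hfu
    have h1 := val_mul (q := 0) hu (val_pow htv m)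
    rw [← hfu, hf, WithTop.coe_eq_coe] at h1
    rw [h1]
    field_simp
    ring
  obtain ⟨x', hx', hx0, a, ha⟩ := h.isUnitMulPow hp hA i 0 (by omega)
  obtain ⟨y', hy', hy0, b, hb⟩ := h.isUnitMulPow hp hA i 1 hi
  obtain ⟨u, hu, hu0, m, hm⟩ := hg
  have h1 : (a : ℚ) = partialProd n i := by
    rw [hpow (h.val 0) hx0 ha]
    simp [keyValue]
  have h2 := hpow (h.val 1) hy0 hb
  have h3 := hpow hq hu0 hm
  obtain ⟨r, hr, hfr⟩ := exists_eq_pow_mul_of_mem_weightGroup (m := m + 1)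
    (h.generatesCenter_stage hp hA i).left_mem hx' hy' ha hb (by rw [h1, h2]) (by
      push_cast
      rw [h1, h3]
      have := mul_lt_mul_of_pos_left hqγ hN
      linarith) hf
  have hu1 : u ≠ 0 := ne_zero_of_val (q := 0) hu0
  refine ⟨r * u⁻¹, Subring.mul_mem _ hr (inv_mem_of_val_eq_zero (hA.2.1 _) hu hu0), ?_⟩
  rw [hfr, hm, pow_succ, ← ht]
  field_simp

end IsKeySequence

end KeyPowers

section Formulas

variable {k : Type*} [Field k] {p c : ℕ} [hp : Fact p.Prime] [CharP k p]
  {ν : AddValuation (TopField k) (WithTop ℚ)} {S : ℕ → LocalSubring (TopField k)}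

/-- At stage `i + 1` the members `U l` with `l ≤ i` agree with `Q l ^ powExp p l` up to units of
the ring of `K*`: the perturbation is divisible by `Q l ^ powExp p l` and one more power of the
first parameter. -/
theorem exists_seqU_eq_mul (h : IsKeySequence k ν (ringS k) (nS p) (eS p) (seqQ k p))
    (hS : IsQuadraticSequence ν (ringS k) S) (hc : 0 < c) {i : ℕ} (hi : 1 ≤ i) {l : ℕ}
    (hl : l ≤ i) : ∃ w ∈ (S (stage (nS p) (i + 1))).toSubring, ν w = 0 ∧
      (seqU k p c l : TopField k) = seqQ k p l ^ powExp p l * w := by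
  have hp := isKeyExponents_S p
  have hq := val_pow (h.val l) (powExp p l)
  rw [← keyValue_A] at hq
  obtain ⟨r, hr, hfr⟩ := h.exists_eq_mul_of_mem_weightGroup hp hS hi
    ((h.isUnitMulPow hp hS i l hl).pow (powExp p l)) hq
    (keyValue_lt_gapValue (isKeyExponents_A p) l) (seqU_sub_mem k c hc l)
  have hmem := (h.generatesCenter_stage hp hS i).left_mem
  have hmem' := Subring.mul_mem _ hmem hr
  refine ⟨1 + secondParam (eS p) (seqQ k p) i * r,
    Subring.add_mem _ (Subring.one_mem _) hmem', ?_, ?_⟩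
  · refine val_one_add ?_
    rw [mul_comm]
    exact val_mul_pos (val_nonneg_of_mem (hS.2.1 _) hr) (h.val_secondParam_pos hp i)
  · rw [mul_add, mul_one, ← sub_eq_iff_eq_add', hfr]
    ring

theorem exists_keyDenom_seqU_eq_mul (h : IsKeySequence k ν (ringS k) (nS p) (eS p) (seqQ k p))
    (hS : IsQuadraticSequence ν (ringS k) S) (hc : 0 < c) {i : ℕ} (hi : 1 ≤ i) {l : ℕ}
    (hl : l ≤ i) : ∃ w ∈ (S (stage (nS p) (i + 1))).toSubring, ν w = 0 ∧
      ((keyDenom (eA p) (seqU k p c) l : KOne k p c) : TopField k) =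
        keyDenom (eS p) (seqQ k p) l ^ powExp p (l + 1) * w := by
  match l with
  | 0 => exact ⟨1, Subring.one_mem _, AddValuation.map_one ν, by simp [keyDenom]⟩
  | 1 =>
    refine ⟨1, Subring.one_mem _, AddValuation.map_one ν, ?_⟩
    rw [powExp_add_two, powExp_zero, pow_one, mul_one]
    rfl
  | l + 2 =>
    obtain ⟨w, hw, hw0, e⟩ := exists_seqU_eq_mul h hS hc hi (l := l + 1) (by omega)
    refine ⟨w, hw, hw0, ?_⟩
    have h1 : ((keyDenom (eA p) (seqU k p c) (l + 2) : KOne k p c) : TopField k) =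
        xVar k ^ eA p (l + 2) * (seqU k p c (l + 1) : TopField k) := rfl
    have h2 : keyDenom (eS p) (seqQ k p) (l + 2) = xVar k ^ eS p (l + 2) * seqQ k p (l + 1) := rfl
    rw [h1, h2, e, eA_eq, powExp_add_two, mul_pow, ← pow_mul]
    ring

theorem exists_secondParam_seqU_eq_mul (h : IsKeySequence k ν (ringS k) (nS p) (eS p) (seqQ k p))
    (hS : IsQuadraticSequence ν (ringS k) S) (hc : 0 < c) (i : ℕ) :
    ∃ τ ∈ (S (stage (nS p) (i + 2))).toSubring, ν τ = 0 ∧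
      ((secondParam (eA p) (seqU k p c) (i + 1) : KOne k p c) : TopField k) =
        τ * secondParam (eS p) (seqQ k p) (i + 1) ^ powExp p (i + 1) := by
  obtain ⟨w, hw, hw0, hwe⟩ := exists_seqU_eq_mul h hS hc (Nat.le_add_left 1 i) le_rfl
  match i with
  | 0 => exact ⟨w, hw, hw0, by rw [mul_comm]; exact hwe⟩
  | i + 1 =>
    obtain ⟨w', hw', hw0', hwe'⟩ := exists_keyDenom_seqU_eq_mul h hS hc
      (Nat.le_add_left 1 (i + 1)) (l := i + 1) (by omega)
    have h1 := inv_mem_of_val_eq_zero (hS.2.1 _) hw' hw0'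
    have h2 := val_inv_of_val_eq_zero hw0'
    have h3 := ne_zero_of_val (q := 0) hw0'
    refine ⟨w * w'⁻¹, Subring.mul_mem _ hw h1, by rw [AddValuation.map_mul, hw0, h2, add_zero], ?_⟩
    have h4 := h.keyDenom_ne_zero (i + 1)
    rw [secondParam_succ, IntermediateField.coe_div, hwe, hwe', secondParam_succ, div_pow]
    field_simp

/-- The regular parameters of `A_{i + 1}` in terms of those of `S_{i + 1}`. -/
theorem exists_params_eq (h : IsKeySequence k ν (ringS k) (nS p) (eS p) (seqQ k p))
    (hS : IsQuadraticSequence ν (ringS k) S) (hc : 0 < c) (i : ℕ) :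
    ∃ τ ∈ (S (stage (nS p) (i + 1))).toSubring, ∃ γ ∈ (S (stage (nS p) (i + 1))).toSubring,
      ∃ Ω ∈ (S (stage (nS p) (i + 1))).toSubring, ν τ = 0 ∧ ν γ = 0 ∧
      ((secondParam (eA p) (seqU k p c) i : KOne k p c) : TopField k) =
        τ * secondParam (eS p) (seqQ k p) i ^ powExp p i ∧
      ((secondParam (eA p) (seqU k p c) (i + 1) : KOne k p c) : TopField k) =
        γ * secondParam (eS p) (seqQ k p) (i + 1) ^ powExp p (i + 1) +
          secondParam (eS p) (seqQ k p) i * Ω := by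
  have hp := isKeyExponents_S p
  have hgen := h.generatesCenter_stage hp hS i
  match i with
  | 0 =>
    refine ⟨1, Subring.one_mem _, 1, Subring.one_mem _, -(xVar k ^ (c - 1) * yVar k), ?_,
      AddValuation.map_one ν, AddValuation.map_one ν, ?_, ?_⟩
    · exact Subring.neg_mem _ (Subring.mul_mem _ (Subring.pow_mem _ hgen.left_mem _)
        hgen.right_mem)
    · rw [one_mul, powExp_zero, pow_one]
      rfl
    · obtain ⟨c', rfl⟩ := Nat.exists_eq_succ_of_ne_zero hc.ne'
      rw [powExp_one, one_mul]
      change yVar k ^ p - xVar k ^ (c' + 1) * yVar k =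
        yVar k ^ p + xVar k * -(xVar k ^ c' * yVar k)
      ring
  | i + 1 =>
    set s := secondParam (eS p) (seqQ k p) with hs
    set B := (S (stage (nS p) (i + 1 + 1))).toSubring with hB
    have hinv : ∀ {f : TopField k}, f ∈ B → ν f = 0 → f⁻¹ ∈ B ∧ ν f⁻¹ = 0 ∧ f ≠ 0 :=
      fun hf h0 => ⟨inv_mem_of_val_eq_zero (hS.2.1 _) hf h0, val_inv_of_val_eq_zero h0,
        ne_zero_of_val (q := 0) h0⟩
    obtain ⟨τ, hτ, hτ0, hτe⟩ := exists_secondParam_seqU_eq_mul h hS hc i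
    obtain ⟨w, hw, hw0, hwe⟩ := exists_keyDenom_seqU_eq_mul h hS hc
      (Nat.le_add_left 1 i) (l := i + 1) le_rfl
    have hq := val_pow (val_keyDenom hp h.val i) (powExp p (i + 2))
    obtain ⟨r, hr, hfr⟩ := h.exists_eq_mul_of_mem_weightGroup hp hS (Nat.le_add_left 1 i)
      ((h.isUnitMulPow_keyDenom hp hS (i + 1)).pow (powExp p (i + 2))) hq
      (γ := gapValue (nA p) (eA p) (i + 2))
      (by
        refine lt_trans ?_ (keyValue_lt_gapValue (isKeyExponents_A p) (i + 2))
        rw [keyValue_A]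
        refine mul_lt_mul_of_pos_left (hp.n_mul_keyValue_lt i) ?_
        obtain ⟨t, ht⟩ := exists_powExp_eq p (i + 2)
        rw [ht]
        exact Nat.cast_pos.2 (pow_pos hp.prime.pos _))
      (seqU_sub_mem k c hc (i + 2))
    obtain ⟨h1, h2, h3⟩ := hinv hw hw0
    refine ⟨τ, hτ, w⁻¹, h1, r * w⁻¹, B.mul_mem hr h1, hτ0, h2, hτe, ?_⟩
    have h4 := h.keyDenom_ne_zero (i + 1)
    have hU : (seqU k p c (i + 2) : TopField k) = seqQ k p (i + 2) ^ powExp p (i + 2) +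
        s (i + 1) * r * keyDenom (eS p) (seqQ k p) (i + 1) ^ powExp p (i + 2) :=
      sub_eq_iff_eq_add'.1 hfr
    rw [secondParam_succ, IntermediateField.coe_div, hwe, hU]
    have h5 : s (i + 1 + 1) = seqQ k p (i + 2) / keyDenom (eS p) (seqQ k p) (i + 1) :=
      secondParam_succ _ _ _
    rw [h5, div_pow]
    field_simp

end Formulas

/-! ### Integral extensions of two-dimensional local rings -/

section Dimension

/-- A two-dimensional factorial local ring contains every fraction that becomes an element of a
local ring of dimension at least two whose closed fibre is a point. In lowest terms `g / h`, a prime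
factor of `h` would lie, together with `g`, in a prime of height one over the maximal ideal. -/
theorem dvd_of_map_eq_mul {A S : Type*} [CommRing A] [IsDomain A] [UniqueFactorizationMonoid A]
    [IsLocalRing A] [CommRing S] [IsDomain S] [IsNoetherianRing S] [IsLocalRing S] {φ : A →+* S}
    (hφ : Function.Injective φ) (hloc : ∀ z ∈ maximalIdeal A, φ z ∈ maximalIdeal S)
    (hA : (maximalIdeal A).height ≤ 2) (hS : 2 ≤ (maximalIdeal S).height)
    (hfib : ∀ P : Ideal S, P.IsPrime → (∀ z ∈ maximalIdeal A, φ z ∈ P) → P = maximalIdeal S)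
    {g h : A} (hh : h ≠ 0) {f : S} (hf : φ g = f * φ h) : h ∣ g := by
  obtain ⟨h', g', d, hrel, rfl, rfl⟩ := UniqueFactorizationMonoid.exists_reduced_factors h hh g
  have hd : φ d ≠ 0 := (map_ne_zero_iff φ hφ).2 (left_ne_zero_of_mul hh)
  have hf' : φ g' = f * φ h' := by
    refine mul_left_cancel₀ hd ?_
    rw [← map_mul, hf, map_mul]
    ring
  suffices hu : IsUnit h' from mul_dvd_mul_left d hu.dvd
  by_contra hu
  obtain ⟨π, hπ, hπh⟩ := WfDvdMonoid.exists_irreducible_factor hu (right_ne_zero_of_mul hh)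
  have hπg : ¬ π ∣ g' := fun hg => hπ.not_isUnit (hrel hπh hg)
  have hle : Ideal.span {φ π} ≤ maximalIdeal S :=
    (Ideal.span_singleton_le_iff_mem _).2 (hloc π ((mem_maximalIdeal π).2 hπ.not_isUnit))
  obtain ⟨P, hP, hPle⟩ := Ideal.exists_minimalPrimes_le hle
  have hPprime : P.IsPrime := hP.1.1
  have hP1 : P.height ≤ 1 := Ideal.height_le_one_of_isPrincipal_of_mem_minimalPrimes _ P hP
  have hπP : φ π ∈ P := hP.1.2 (Ideal.mem_span_singleton_self _)
  have hgP : φ g' ∈ P := by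
    obtain ⟨w, rfl⟩ := hπh
    rw [hf', map_mul]
    exact P.mul_mem_left _ (P.mul_mem_right _ hπP)
  have hπprime : (Ideal.span {π}).IsPrime :=
    (Ideal.span_singleton_prime hπ.ne_zero).2 hπ.prime
  have h1 : (⊥ : Ideal A) < Ideal.span {π} := by
    rw [bot_lt_iff_ne_bot, Ne, Ideal.span_singleton_eq_bot]
    exact hπ.ne_zero
  have h2 : Ideal.span {π} < P.comap φ := by
    refine lt_of_le_of_ne ((Ideal.span_singleton_le_iff_mem _).2 hπP) fun e => hπg ?_
    rw [← Ideal.mem_span_singleton, e]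
    exact hgP
  have hcomap : (P.comap φ).IsPrime := Ideal.IsPrime.comap φ
  have h3 : P.comap φ = maximalIdeal A := by
    by_contra hne
    have hlt := lt_of_le_of_ne (le_maximalIdeal hcomap.ne_top) hne
    have e1 := Ideal.height_add_one_le_of_lt_of_isPrime h1
    have e2 := Ideal.height_add_one_le_of_lt_of_isPrime h2
    have e3 := Ideal.height_add_one_le_of_lt_of_isPrime hlt
    have e4 : (3 : ℕ∞) ≤ (maximalIdeal A).height := by
      refine le_trans ?_ e3
      refine le_trans ?_ (add_le_add_left e2 1)
      refine le_trans ?_ (add_le_add_left (add_le_add_left e1 1) 1)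
      rw [add_assoc, add_assoc]
      exact le_add_of_nonneg_left zero_le
    exact absurd (e4.trans hA) (by decide)
  have h4 := hfib P hPprime fun z hz => by
    rw [← h3] at hz
    exact hz
  rw [h4] at hP1
  exact absurd (hS.trans hP1) (by decide)

end Dimension

section Finite

variable {k : Type*} [Field k] {F : Type*} [Field F] [Algebra k F] {ν : AddValuation F (WithTop ℚ)}

/-- A localized polynomial ring that is integral over a subring containing the constants is finite
over it: it is generated by the two coordinates, since the denominators are units in every
intermediate ring over which it is integral. -/
theorem IsModel.finite_of_isIntegral {S : LocalSubring F} {a b : F} (h : IsModel k ν S a b)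
    (hν : IsResidueRational k ν) {B : Subring F} (hk : ∀ r : k, algebraMap k F r ∈ B)
    (hB : B ≤ S.toSubring) (hint : (Subring.inclusion hB).IsIntegral) :
    (Subring.inclusion hB).Finite := by
  refine hint.to_finite ?_
  let : Algebra B S.toSubring := (Subring.inclusion hB).toAlgebra
  have hdom := h.le_valuationRing hν
  have hgen := h.generatesCenter hν
  set T : Subalgebra B S.toSubring :=
    Algebra.adjoin B {⟨a, hgen.left_mem⟩, ⟨b, hgen.right_mem⟩} with hT
  have : Algebra.IsIntegral B S.toSubring := ⟨hint⟩
  have : Algebra.IsIntegral T S.toSubring := Algebra.IsIntegral.tower_top B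
  have hTmem : ∀ f ∈ Algebra.adjoin k ({a, b} : Set F), ∃ z ∈ T, (z : F) = f := by
    intro f hf
    induction hf using Algebra.adjoin_induction with
    | mem f hf =>
      rcases hf with rfl | rfl
      · exact ⟨_, Algebra.subset_adjoin (Or.inl rfl), rfl⟩
      · exact ⟨_, Algebra.subset_adjoin (Or.inr rfl), rfl⟩
    | algebraMap r => exact ⟨_, T.algebraMap_mem ⟨_, hk r⟩, rfl⟩
    | add f g _ _ hf hg =>
      obtain ⟨z, hz, rfl⟩ := hf
      obtain ⟨w, hw, rfl⟩ := hg
      exact ⟨z + w, T.add_mem hz hw, rfl⟩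
    | mul f g _ _ hf hg =>
      obtain ⟨z, hz, rfl⟩ := hf
      obtain ⟨w, hw, rfl⟩ := hg
      exact ⟨z * w, T.mul_mem hz hw, rfl⟩
  have hloc : IsLocalHom (algebraMap T S.toSubring) := Algebra.IsIntegral.isLocalHom T S.toSubring
  have htop : T = ⊤ := by
    refine eq_top_iff.2 fun f _ => ?_
    have hf : (f : F) ∈ locSubring ν (Algebra.adjoin k {a, b}).toSubring := h.toSubring_eq.le f.2
    obtain ⟨g, hg, w, hw, hw0, e⟩ := hf
    obtain ⟨g', hg', rfl⟩ := hTmem g hg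
    obtain ⟨w', hw', rfl⟩ := hTmem w hw
    have hu : IsUnit (algebraMap T S.toSubring ⟨w', hw'⟩) :=
      (isUnit_iff_val_eq_zero hdom w').2 hw0
    obtain ⟨⟨t, ht⟩, htw⟩ := (hloc.map_nonunit _ hu).exists_right_inv
    have htw' : (w' : F) * (t : F) = 1 :=
      congrArg (fun z : T => ((z : S.toSubring) : F)) htw
    have : f = g' * t := by
      refine Subtype.ext ?_
      rw [e, div_eq_iff (left_ne_zero_of_mul_eq_one htw')]
      change (g' : F) = g' * t * w'
      rw [mul_assoc, mul_comm (t : F), htw', mul_one]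
    rw [this]
    exact T.mul_mem hg' ht
  change (algebraMap B S.toSubring).FiniteType
  rw [RingHom.finiteType_algebraMap]
  exact ⟨htop ▸ Subalgebra.fg_def.2 ⟨_, Set.toFinite _, rfl⟩⟩

/-- If an automorphism `σ` of finite order maps the ring `S` into itself and the elements of `S`
fixed by `σ` lie in the subring `B`, then `S` is integral over `B`. -/
theorem isIntegral_of_fixed {E : Type*} [Field E] [Algebra E F] {σ : F ≃ₐ[E] F}
    (hfin : IsOfFinOrder σ) {B S : Subring F} (hB : B ≤ S) (hS : ∀ f ∈ S, σ f ∈ S)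
    (hfix : ∀ f ∈ S, σ f = f → f ∈ B) : (Subring.inclusion hB).IsIntegral := by
  let G := Subgroup.zpowers σ
  have : Finite G := Nat.finite_of_card_ne_zero (by
    rw [Nat.card_zpowers]
    exact hfin.orderOf_pos.ne')
  have hinv : IsInvariantSubring G S := by
    refine ⟨?_⟩
    rintro ⟨g, hg⟩ f hf
    obtain ⟨n, rfl⟩ := hfin.mem_powers_iff_mem_zpowers.2 hg
    change (σ ^ n) f ∈ S
    induction n with
    | zero => exact hf
    | succ n ih =>
      rw [pow_succ', AlgEquiv.mul_apply]
      exact hS _ (ih (Subgroup.npow_mem_zpowers σ n))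
  let : Algebra B S := (Subring.inclusion hB).toAlgebra
  have : Algebra.IsInvariant B S G := by
    refine ⟨fun f hf => ⟨⟨f, hfix f f.2 ?_⟩, rfl⟩⟩
    exact congrArg Subtype.val (hf ⟨σ, Subgroup.mem_zpowers σ⟩)
  exact (Algebra.IsInvariant.isIntegral B S G).isIntegral

/-- A homomorphism that preserves the valuation and maps `R` into itself preserves all quadratic
transforms of `R` along the valuation. -/
theorem IsQuadraticSequence.map_mem {R : LocalSubring F} {A : ℕ → LocalSubring F}
    (hA : IsQuadraticSequence ν R A) {σ : F →+* F} (hσ : ∀ f, ν (σ f) = ν f)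
    (hR : ∀ f ∈ R.toSubring, σ f ∈ R.toSubring) (i : ℕ) :
    ∀ f ∈ (A i).toSubring, σ f ∈ (A i).toSubring := by
  induction i with
  | zero => rwa [hA.1]
  | succ i ih =>
    obtain ⟨t, ht, e⟩ := (hA.2.2 i).exists_minimalParam (hA.2.1 i) (hA.2.1 (i + 1))
    set C := (A (i + 1)).toSubring with hC
    have hle : blowupRing (A i) t ≤ C := by
      rw [e]
      exact le_locSubring _
    have hCinv : ∀ f ∈ C, ν f = 0 → f⁻¹ ∈ C := fun f => inv_mem_of_val_eq_zero (hA.2.1 (i + 1))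
    have hdiv : ∀ z ∈ (A i).toSubring, 0 < ν z → z / t ∈ C := fun z hz h0 =>
      hle (div_mem_blowupRing (hA.2.1 i) t hz h0)
    have hσt : 0 < ν (σ t) := by
      rw [hσ]
      exact ht.2.2.1
    have hu0 : ν (σ t / t) = 0 := by
      obtain ⟨q, hq⟩ := exists_val_eq_coe ν ht.2.1
      rw [val_div ((hσ t).trans hq) hq, sub_self, WithTop.coe_zero]
    have hu : (σ t / t)⁻¹ ∈ C := hCinv _ (hdiv _ (ih t ht.1) hσt) hu0
    have h1 : C ≤ C.comap σ := by
      conv_lhs => rw [e]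
      refine locSubring_le (blowupRing_le (hA.2.1 i) ?_ ?_) ?_
      · exact fun f hf => hle (le_blowupRing _ _ (ih f hf))
      · intro z hz h0
        change σ (z / t) ∈ C
        have : σ (z / t) = σ z / t * (σ t / t)⁻¹ := by
          have := ht.2.1
          rw [map_div₀]
          field_simp
        rw [this]
        exact C.mul_mem (hdiv _ (ih z hz) (by rwa [hσ])) hu
      · intro f hf h0
        change σ f⁻¹ ∈ C
        rw [map_inv₀]
        exact hCinv _ hf (by rwa [hσ])
    exact fun f hf => h1 hf

theorem IsModel.exists_eq_div {R : LocalSubring F} {a b : F} (h : IsModel k ν R a b) (f : F) :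
    ∃ g ∈ R.toSubring, ∃ w ∈ R.toSubring, w ≠ 0 ∧ f = g / w := by
  have hf : f ∈ IntermediateField.adjoin k {a, b} := h.adjoin_eq_top ▸ IntermediateField.mem_top
  rw [IntermediateField.mem_adjoin_iff_div] at hf
  obtain ⟨r, hr, s, hs, rfl⟩ := hf
  rcases eq_or_ne s 0 with rfl | hs0
  · exact ⟨0, zero_mem _, 1, one_mem _, one_ne_zero, by simp⟩
  · exact ⟨r, h.adjoin_le hr, s, h.adjoin_le hs, hs0, rfl⟩

/-- Let `A` and `S` be localized polynomial rings in two variables in the fields `E ⊆ F`, such that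
`S` dominates `A` and the maximal ideal of `S` is the only prime ideal that contains that of `A`.
Then `S ∩ E = A`. -/
theorem IsModel.mem_of_algebraMap_mem {E : Type*} [Field E] [Algebra k E] [Algebra E F]
    {A : LocalSubring E} {S : LocalSubring F} {a b : E} {a' b' : F}
    (hν₁ : IsResidueRational k (ν.comap (algebraMap E F))) (hν : IsResidueRational k ν)
    (htr₁ : 2 ≤ Algebra.trdeg k E) (htr : 2 ≤ Algebra.trdeg k F)
    (hA : IsModel k (ν.comap (algebraMap E F)) A a b) (hS : IsModel k ν S a' b')
    (hle : A.toSubring ≤ S.toSubring.comap (algebraMap E F))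
    (hfib : ∀ P : Ideal S.toSubring, P.IsPrime →
      (∀ (z : E) (hz : z ∈ A.toSubring), 0 < ν (algebraMap E F z) →
        (⟨algebraMap E F z, hle hz⟩ : S.toSubring) ∈ P) → P = maximalIdeal S.toSubring)
    {f : E} (hf : algebraMap E F f ∈ S.toSubring) : f ∈ A.toSubring := by
  have hAdom := hA.le_valuationRing hν₁
  have hSdom := hS.le_valuationRing hν
  let φ : A.toSubring →+* S.toSubring :=
    ((algebraMap E F).comp A.toSubring.subtype).codRestrict S.toSubring fun z => hle z.2
  have hmem : ∀ z : A.toSubring, z ∈ maximalIdeal A.toSubring ↔ 0 < ν (algebraMap E F z) :=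
    fun z => mem_maximalIdeal_iff_val_pos hAdom z
  have hφ : Function.Injective φ := fun z w e =>
    Subtype.ext ((algebraMap E F).injective (congrArg Subtype.val e))
  have hUFD := hA.uniqueFactorizationMonoid hν₁ htr₁
  have hNoeth := hS.isNoetherianRing hν htr
  have hreg := hA.isRegularParameters hν₁ htr₁ (hA.generatesCenter hν₁)
  have hht : (maximalIdeal A.toSubring).height ≤ 2 := by
    have h1 := IsLocalRing.maximalIdeal_height_eq_ringKrullDim (R := A.toSubring)
    rw [hreg.2.1] at h1
    exact (WithBot.coe_eq_coe.1 h1 : (maximalIdeal A.toSubring).height = 2).le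
  obtain ⟨g, hg, w, hw, hw0, rfl⟩ := hA.exists_eq_div f
  have hdvd : (⟨w, hw⟩ : A.toSubring) ∣ ⟨g, hg⟩ := by
    refine dvd_of_map_eq_mul (φ := φ) (f := ⟨_, hf⟩) hφ ?_ hht (hS.two_le_height hν htr) ?_
      (fun e => hw0 (congrArg Subtype.val e)) ?_
    · exact fun z hz => (mem_maximalIdeal_iff_val_pos hSdom _).2 ((hmem z).1 hz)
    · exact fun P hP hz => hfib P hP fun z hzA h0 => hz ⟨z, hzA⟩ ((hmem _).2 h0)
    · refine Subtype.ext ?_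
      change algebraMap E F g = algebraMap E F (g / w) * algebraMap E F w
      rw [← map_mul, div_mul_cancel₀ _ hw0]
  obtain ⟨s, hs⟩ := hdvd
  have hs' : g = w * s := congrArg Subtype.val hs
  rw [hs', mul_div_cancel_left₀ _ hw0]
  exact s.2

end Finite

/-! ### Domination and finiteness in the tower -/

section TowerRings

variable {k : Type*} [Field k] {p c d : ℕ}
  {ν : AddValuation (TopField k) (WithTop ℚ)} {S : ℕ → LocalSubring (TopField k)}
  {A : ℕ → LocalSubring (KOne k p c)}

theorem coe_vOne_mem_ringS : ((vOne k p c : KOne k p c) : TopField k) ∈ (ringS k).toSubring := by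
  have h : ((vOne k p c : KOne k p c) : TopField k) =
      algebraMap (MvPolynomial (Fin 2) k) (TopField k)
      (MvPolynomial.X 1 ^ p - MvPolynomial.X 0 ^ c * MvPolynomial.X 1) := by
    rw [map_sub, map_mul, map_pow, map_pow]
    rfl
  rw [h]
  exact algebraMap_mem_ringS _

variable [hp : Fact p.Prime]

theorem isRegularParameters_stage (h : IsKeySequence k ν (ringS k) (nS p) (eS p) (seqQ k p))
    (hS : IsQuadraticSequence ν (ringS k) S) (i : ℕ) :
    IsRegularParameters (S (stage (nS p) (i + 1))) (xS k p (i + 1)) (yS k p (i + 1)) := by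
  obtain ⟨a', b', hSM⟩ :=
    hS.exists_isModel h.residue two_le_trdeg_topField (isModel_ringS h.residue h.val)
      (stage (nS p) (i + 1))
  exact hSM.isRegularParameters h.residue two_le_trdeg_topField
    (h.generatesCenter_stage (isKeyExponents_S p) hS i)

variable [CharP k p]

theorem ringA_le_comap (h : IsKeySequence k ν (ringS k) (nS p) (eS p) (seqQ k p)) (hc : 0 < c) :
    (ringA k p c).toSubring ≤
      (ringS k).toSubring.comap (algebraMap (KOne k p c) (TopField k)) := by
  rw [(isModel_ringA h hc).toSubring_eq]
  refine locSubring_le ?_ fun f hf h0 => ?_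
  · rw [Algebra.adjoin_eq_ring_closure]
    refine Subring.closure_le.2 ?_
    rintro f (⟨r, rfl⟩ | rfl | rfl)
    · exact h.algebraMap_mem r
    · exact algebraMap_mem_ringS (MvPolynomial.X 0)
    · exact coe_vOne_mem_ringS
  · change algebraMap (KOne k p c) (TopField k) f⁻¹ ∈ (ringS k).toSubring
    rw [map_inv₀]
    exact inv_mem_of_val_eq_zero h.dominated hf h0

/-- The ring of `K₁` at each stage is generated, up to inverses, by the preceding one and its new
parameter, which lies in the ring of `K*` by the formulas for the parameters. -/
theorem stage_le_comap (h : IsKeySequence k ν (ringS k) (nS p) (eS p) (seqQ k p)) (hc : 0 < c)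
    (hS : IsQuadraticSequence ν (ringS k) S)
    (hA : IsQuadraticSequence (ν.comap (algebraMap (KOne k p c) (TopField k))) (ringA k p c) A)
    (i : ℕ) : (A (stage (nA p) (i + 1))).toSubring ≤
      (S (stage (nS p) (i + 1))).toSubring.comap (algebraMap (KOne k p c) (TopField k)) := by
  induction i with
  | zero =>
    rw [zero_add, stage_one, stage_one, hA.1, hS.1]
    exact ringA_le_comap h hc
  | succ i ih =>
    refine (isKeySequence_seqU h hc).stage_succ_le (isKeyExponents_A p) hA i ?_ ?_ ?_
    · refine ih.trans fun f hf => hS.toSubring_mono (?_ : stage (nS p) (i + 1) ≤ _) hf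
      rw [stage_succ]
      exact Nat.le_add_right _ _
    · intro f hf h0
      change algebraMap (KOne k p c) (TopField k) f⁻¹ ∈ (S (stage (nS p) (i + 1 + 1))).toSubring
      rw [map_inv₀]
      exact inv_mem_of_val_eq_zero (hS.2.1 _) hf h0
    · obtain ⟨τ, hτ, γ, hγ, Ω, hΩ, -, -, -, e⟩ := exists_params_eq h hS hc (i + 1)
      have hgen := h.generatesCenter_stage (isKeyExponents_S p) hS (i + 1)
      change ((secondParam (eA p) (seqU k p c) (i + 1 + 1) : KOne k p c) : TopField k) ∈
        (S (stage (nS p) (i + 1 + 1))).toSubring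
      rw [e]
      exact Subring.add_mem _ (Subring.mul_mem _ hγ (Subring.pow_mem _ hgen.right_mem _))
        (Subring.mul_mem _ hgen.left_mem hΩ)

theorem shift_mem_ringS (h : IsKeySequence k ν (ringS k) (nS p) (eS p) (seqQ k p)) (hd : 0 < d)
    {f : TopField k} (hf : f ∈ (ringS k).toSubring) : shift k d f ∈ (ringS k).toSubring := by
  suffices hle : (ringS k).toSubring ≤ (ringS k).toSubring.comap (shift k d).toRingHom from hle hf
  have hM := isModel_ringS h.residue h.val
  conv_lhs => rw [hM.toSubring_eq]
  refine locSubring_le ?_ fun f hf h0 => ?_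
  · rw [Algebra.adjoin_eq_ring_closure]
    have hx := (hM.generatesCenter h.residue).left_mem
    refine Subring.closure_le.2 ?_
    rintro f (⟨r, rfl⟩ | rfl | rfl)
    · change shift k d (algebraMap k (TopField k) r) ∈ (ringS k).toSubring
      rw [AlgHom.commutes]
      exact h.algebraMap_mem r
    · change shift k d (xVar k) ∈ (ringS k).toSubring
      rwa [shift_xVar]
    · change shift k d (yVar k) ∈ (ringS k).toSubring
      rw [shift_yVar]
      exact Subring.add_mem _ (hM.generatesCenter h.residue).right_mem (Subring.pow_mem _ hx d)
  · change shift k d f⁻¹ ∈ (ringS k).toSubring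
    rw [map_inv₀]
    exact inv_mem_of_val_eq_zero h.dominated hf ((val_shift h hd f).trans h0)

/-- A prime ideal that contains the parameters of the lower ring contains those of the upper one. -/
theorem eq_maximalIdeal_of_params_mem
    (h : IsKeySequence k ν (ringS k) (nS p) (eS p) (seqQ k p)) (hc : 0 < c)
    (hS : IsQuadraticSequence ν (ringS k) S) (i : ℕ)
    {P : Ideal (S (stage (nS p) (i + 1))).toSubring} (hP : P.IsPrime)
    {a b : (S (stage (nS p) (i + 1))).toSubring} (haP : a ∈ P) (hbP : b ∈ P)
    (ha : (a : TopField k) = (secondParam (eA p) (seqU k p c) i : KOne k p c))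
    (hb : (b : TopField k) = (secondParam (eA p) (seqU k p c) (i + 1) : KOne k p c)) :
    P = maximalIdeal (S (stage (nS p) (i + 1))).toSubring := by
  obtain ⟨τ, hτ, γ, hγ, Ω, hΩ, hτ0, hγ0, e1, e2⟩ := exists_params_eq h hS hc i
  have hgen := h.generatesCenter_stage (isKeyExponents_S p) hS i
  have hdom := hS.2.1 (stage (nS p) (i + 1))
  have hτu : IsUnit (⟨τ, hτ⟩ : (S (stage (nS p) (i + 1))).toSubring) :=
    (isUnit_iff_val_eq_zero hdom _).2 hτ0
  have hγu : IsUnit (⟨γ, hγ⟩ : (S (stage (nS p) (i + 1))).toSubring) :=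
    (isUnit_iff_val_eq_zero hdom _).2 hγ0
  have h1 : a = ⟨τ, hτ⟩ * ⟨_, hgen.left_mem⟩ ^ powExp p i := Subtype.ext (ha.trans e1)
  have h2 : b = ⟨γ, hγ⟩ * ⟨_, hgen.right_mem⟩ ^ powExp p (i + 1) +
      ⟨_, hgen.left_mem⟩ * ⟨Ω, hΩ⟩ := Subtype.ext (hb.trans e2)
  have hx : (⟨_, hgen.left_mem⟩ : (S (stage (nS p) (i + 1))).toSubring) ∈ P := by
    rw [h1] at haP
    exact hP.mem_of_pow_mem _ ((hP.mem_or_mem haP).resolve_left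
      fun hm => hP.ne_top (P.eq_top_of_isUnit_mem hm hτu))
  have hy : (⟨_, hgen.right_mem⟩ : (S (stage (nS p) (i + 1))).toSubring) ∈ P := by
    rw [h2] at hbP
    have := (Ideal.add_mem_iff_left P (P.mul_mem_right _ hx)).1 hbP
    exact hP.mem_of_pow_mem _ ((hP.mem_or_mem this).resolve_left
      fun hm => hP.ne_top (P.eq_top_of_isUnit_mem hm hγu))
  refine le_antisymm (le_maximalIdeal hP.ne_top) ?_
  rw [hgen.maximalIdeal_eq hdom]
  refine Ideal.span_le.2 ?_
  rintro z (rfl | rfl)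
  · exact hx
  · exact hy

/-- The intersection of the ring of `K*` with `K₁` is the ring of `K₁` at the same stage. -/
theorem mem_stage_of_algebraMap_mem
    (h : IsKeySequence k ν (ringS k) (nS p) (eS p) (seqQ k p)) (hc : 0 < c)
    (hS : IsQuadraticSequence ν (ringS k) S)
    (hA : IsQuadraticSequence (ν.comap (algebraMap (KOne k p c) (TopField k))) (ringA k p c) A)
    (i : ℕ) {f : KOne k p c}
    (hf : algebraMap (KOne k p c) (TopField k) f ∈ (S (stage (nS p) (i + 1))).toSubring) :
    f ∈ (A (stage (nA p) (i + 1))).toSubring := by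
  have hU := isKeySequence_seqU h hc
  have hgen := hU.generatesCenter_stage (isKeyExponents_A p) hA i
  obtain ⟨a, b, hAM⟩ :=
    hA.exists_isModel hU.residue (two_le_trdeg_KOne k p c) (isModel_ringA h hc)
      (stage (nA p) (i + 1))
  obtain ⟨a', b', hSM⟩ :=
    hS.exists_isModel h.residue two_le_trdeg_topField (isModel_ringS h.residue h.val)
      (stage (nS p) (i + 1))
  exact IsModel.mem_of_algebraMap_mem hU.residue h.residue (two_le_trdeg_KOne k p c)
    two_le_trdeg_topField hAM hSM (stage_le_comap h hc hS hA i)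
    (fun P hP hz => eq_maximalIdeal_of_params_mem h hc hS i hP (hz _ hgen.left_mem hgen.left_pos)
      (hz _ hgen.right_mem hgen.right_pos) rfl rfl) hf

theorem map_stage_le (h : IsKeySequence k ν (ringS k) (nS p) (eS p) (seqQ k p)) (hc : 0 < c)
    (hS : IsQuadraticSequence ν (ringS k) S)
    (hA : IsQuadraticSequence (ν.comap (algebraMap (KOne k p c) (TopField k))) (ringA k p c) A)
    (i : ℕ) : (A (stage (nA p) (i + 1))).map (algebraMap (KOne k p c) (TopField k)) ≤
      S (stage (nS p) (i + 1)) := by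
  refine le_of_toSubring_le ?_ (hS.2.1 _)
    (Subring.map_le_iff_le_comap.2 (stage_le_comap h hc hS hA i))
  rw [le_valuationRing_iff]
  constructor
  · rintro _ ⟨f, hf, rfl⟩
    exact val_nonneg_of_mem (hA.2.1 _) hf
  · rintro _ ⟨f, hf, rfl⟩ h0
    rw [← map_inv₀]
    exact ⟨_, inv_mem_of_val_eq_zero (hA.2.1 _) hf h0, rfl⟩

/-- The shift maps the ring of `K*` into itself, and its fixed elements in that ring lie in the ring
of `K₁`, so the ring of `K*` is integral over the ring of `K₁`; finiteness follows as it is a localized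
polynomial ring. -/
theorem finite_stage (h : IsKeySequence k ν (ringS k) (nS p) (eS p) (seqQ k p)) (hd : 0 < d)
    (hcd : c = (p - 1) * d) (hc : 0 < c) (hS : IsQuadraticSequence ν (ringS k) S)
    (hA : IsQuadraticSequence (ν.comap (algebraMap (KOne k p c) (TopField k))) (ringA k p c) A)
    (i : ℕ)
    (hle : ((A (stage (nA p) (i + 1))).map (algebraMap (KOne k p c) (TopField k))).toSubring ≤
      (S (stage (nS p) (i + 1))).toSubring) : (Subring.inclusion hle).Finite := by
  obtain ⟨a', b', hSM⟩ :=
    hS.exists_isModel h.residue two_le_trdeg_topField (isModel_ringS h.residue h.val)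
      (stage (nS p) (i + 1))
  have hU := isKeySequence_seqU h hc
  refine hSM.finite_of_isIntegral h.residue (fun r => ?_) hle ?_
  · exact ⟨algebraMap k (KOne k p c) r, hA.mem_of_mem (hU.algebraMap_mem r) _, rfl⟩
  · refine isIntegral_of_fixed (σ := shiftEquiv hcd)
      (isOfFinOrder_iff_pow_eq_one.2 ⟨p, hp.out.pos, shiftEquiv_pow_prime hcd⟩) hle ?_ ?_
    · exact hS.map_mem (σ := (shift k d).toRingHom) (val_shift h hd)
        (fun f => shift_mem_ringS h hd) _
    · intro f hf e
      have hfK : f ∈ KOne k p c := mem_KOne_of_shift_eq hcd e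
      exact ⟨⟨f, hfK⟩, mem_stage_of_algebraMap_mem h hc hS hA i hf, rfl⟩

theorem isRegularParameters_stage_KOne
    (h : IsKeySequence k ν (ringS k) (nS p) (eS p) (seqQ k p)) (hc : 0 < c)
    (hA : IsQuadraticSequence (ν.comap (algebraMap (KOne k p c) (TopField k))) (ringA k p c) A)
    (i : ℕ) :
    IsRegularParameters (A (stage (nA p) (i + 1))) (xA k p c (i + 1)) (vA k p c (i + 1)) := by
  have hU := isKeySequence_seqU h hc
  obtain ⟨a, b, hAM⟩ :=
    hA.exists_isModel hU.residue (two_le_trdeg_KOne k p c) (isModel_ringA h hc)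
      (stage (nA p) (i + 1))
  exact hAM.isRegularParameters hU.residue (two_le_trdeg_KOne k p c)
    (hU.generatesCenter_stage (isKeyExponents_A p) hA i)

end TowerRings

/-! ### Stable forms -/

section StableForms

variable {F : Type*} [Field F] {ν : AddValuation F (WithTop ℚ)}

/-- The order of a nonzero residue modulo `x` is well defined. -/
theorem IsRegularParameters.le_of_unit_mul_pow_add_eq {R : LocalSubring F} {a b : F}
    (h : IsRegularParameters R a b) {x y γ δ Ω Ω' : R.toSubring} (hx : (x : F) = a)
    (hy : (y : F) = b) (hγ : IsUnit γ) {m m' : ℕ}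
    (e : γ * y ^ m + x * Ω = δ * y ^ m' + x * Ω') : m' ≤ m := by
  by_contra! hlt
  obtain ⟨n, rfl⟩ := Nat.exists_eq_add_of_lt hlt
  have hyn : y ∈ maximalIdeal R.toSubring := by
    obtain ⟨ha, hb, hab⟩ := h.2.2
    rw [hab]
    exact Ideal.subset_span (Or.inr (Subtype.ext hy))
  have hu : IsUnit (γ - δ * y ^ (n + 1)) := by
    by_contra hn
    refine (mem_maximalIdeal γ).1 ?_ hγ
    have h1 : δ * y ^ (n + 1) ∈ maximalIdeal R.toSubring :=
      Ideal.mul_mem_left _ _ (Ideal.pow_mem_of_mem _ hyn _ n.succ_pos)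
    have h2 := Ideal.add_mem _ ((mem_maximalIdeal _).2 hn) h1
    rwa [sub_add_cancel] at h2
  obtain ⟨w, hw⟩ := hu.exists_right_inv
  -- The relation reads `(γ - δ y ^ (n + 1)) y ^ m = x (Ω' - Ω)`, where the first factor is a unit.
  refine h.pow_ne_mul hy m (w * (Ω' - Ω)) hx ?_
  linear_combination (-y ^ m) * hw + w * e

theorem IsRegularParameters.eq_of_unit_mul_pow_add_eq {R : LocalSubring F} {a b : F}
    (h : IsRegularParameters R a b) {x y γ δ Ω Ω' : R.toSubring} (hx : (x : F) = a)
    (hy : (y : F) = b) (hγ : IsUnit γ) (hδ : IsUnit δ) {m m' : ℕ}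
    (e : γ * y ^ m + x * Ω = δ * y ^ m' + x * Ω') : m = m' :=
  le_antisymm (h.le_of_unit_mul_pow_add_eq hx hy hδ e.symm)
    (h.le_of_unit_mul_pow_add_eq hx hy hγ e)

theorem IsRegularParameters.eq_zero_of_unit_mul_pow_add_eq {R : LocalSubring F} {a b : F}
    (h : IsRegularParameters R a b) {x y γ Ω f : R.toSubring} (hx : (x : F) = a)
    (hy : (y : F) = b) (hγ : IsUnit γ) {m n : ℕ}
    (e : γ * y ^ m + x * Ω = x ^ n * f) : n = 0 := by
  by_contra hn
  obtain ⟨l, rfl⟩ := Nat.exists_eq_succ_of_ne_zero hn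
  obtain ⟨w, hw⟩ := hγ.exists_right_inv
  refine h.pow_ne_mul hy m (w * (x ^ l * f - Ω)) hx ?_
  rw [pow_succ] at e
  linear_combination (-y ^ m) * hw + w * e

/-- Two stable forms for the same parameters, one of them with `b = 0`, have the same exponents. -/
theorem IsStableForm.exponents_eq {p : ℕ} (hp : 2 ≤ p) {R : LocalSubring F} {a w x y : F}
    (hR : R ≤ (valuationRing ν).toLocalSubring) (h : IsRegularParameters R x y) (hx0 : x ≠ 0)
    (hx : 0 < ν x) {abar abar' α α' b β β' : ℕ} (h1 : IsStableForm p R a w x y abar α 0 β)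
    (h2 : IsStableForm p R a w x y abar' α' b β') : abar * p ^ α = abar' * p ^ α' ∧ β = β' := by
  obtain ⟨⟨τ, hτ, eτ⟩, f, ef, γ, Ω, hγ, eγ⟩ := h1
  obtain ⟨⟨τ', hτ', eτ'⟩, f', ef', γ', Ω', hγ', eγ'⟩ := h2
  obtain ⟨hxR, hyR, -⟩ := h.2.2
  constructor
  · obtain ⟨q, hq⟩ := exists_val_eq_coe ν hx0
    rw [isUnit_iff_val_eq_zero hR] at hτ hτ'
    have h3 := val_mul (q := 0) hτ (val_pow hq (abar * p ^ α))
    rw [← eτ, eτ', val_mul (q := 0) hτ' (val_pow hq (abar' * p ^ α')), WithTop.coe_eq_coe, zero_add,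
      zero_add] at h3
    rw [hq] at hx
    exact_mod_cast (mul_right_cancel₀ (WithTop.coe_pos.1 hx).ne' h3).symm
  · have e : γ * ⟨y, hyR⟩ ^ p ^ β + ⟨x, hxR⟩ * Ω = ⟨x, hxR⟩ ^ b * f' := by
      refine Subtype.ext ?_
      change (γ : F) * y ^ p ^ β + x * Ω = x ^ b * f'
      rw [← eγ, ← ef', ef, pow_zero, one_mul]
    obtain rfl := h.eq_zero_of_unit_mul_pow_add_eq rfl rfl hγ e
    have e' : f' = γ' * ⟨y, hyR⟩ ^ p ^ β' + ⟨x, hxR⟩ * Ω' := Subtype.ext eγ'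
    rw [pow_zero, one_mul, e'] at e
    exact Nat.pow_right_injective hp (h.eq_of_unit_mul_pow_add_eq rfl rfl hγ hγ' e)

end StableForms

section Exponents

variable {k : Type*} [Field k] {p c : ℕ}

theorem not_eventuallyConst_of_parity {f : ℕ → ℕ} {a b N : ℕ} (hab : a ≠ b)
    (hf : ∀ j, N ≤ j → f j = if Even j then a else b) :
    ¬ Filter.EventuallyConst f Filter.atTop := by
  rw [Filter.eventuallyConst_atTop]
  rintro ⟨i, hi⟩
  have h1 := hf (2 * (i + N)) (by omega)
  have h2 := hf (2 * (i + N) + 1) (by omega)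
  rw [hi _ (by omega), if_pos (even_two_mul _)] at h1
  rw [hi _ (by omega), if_neg (by rw [Nat.not_even_iff_odd]; exact odd_two_mul_add_one _)] at h2
  exact hab (h1.symm.trans h2)

theorem powExp_eq_pow_alphaExp (i : ℕ) : powExp p i = p ^ alphaExp (i + 1) := by
  unfold powExp alphaExp
  rcases Nat.even_or_odd i with h | h
  · rw [if_neg (Nat.not_odd_iff_even.2 h), if_neg (Nat.not_even_iff_odd.2 h.add_one), pow_zero]
  · rw [if_pos h, if_pos h.add_one, pow_one]

theorem powExp_eq_pow_betaExp (i : ℕ) : powExp p i = p ^ betaExp i := by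
  unfold powExp betaExp
  rcases Nat.even_or_odd i with h | h
  · rw [if_neg (Nat.not_odd_iff_even.2 h), if_pos h, pow_zero]
  · rw [if_pos h, if_neg (Nat.not_even_iff_odd.2 h), pow_one]

variable [hp : Fact p.Prime]

/-- The factor `ā` is one because it does not depend on `j`, so the exponents `α j` are
determined. -/
theorem eq_alphaExp_of_mul_pow_eq {N abar : ℕ} {α : ℕ → ℕ}
    (h : ∀ j, N ≤ j → p ^ alphaExp j = abar * p ^ α j) {j : ℕ} (hj : N ≤ j) : α j = alphaExp j := by
  -- An odd index is where the product equals one.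
  have h1 : abar = 1 := by
    have h2 := h (2 * N + 1) (by omega)
    rw [alphaExp, if_neg (by rw [Nat.not_even_iff_odd]; exact odd_two_mul_add_one _),
      pow_zero] at h2
    exact Nat.eq_one_of_mul_eq_one_right h2.symm
  have h2 := h j hj
  rw [h1, one_mul] at h2
  exact (Nat.pow_right_injective hp.out.two_le h2).symm

variable [CharP k p] {ν : AddValuation (TopField k) (WithTop ℚ)} {S : ℕ → LocalSubring (TopField k)}

/-- The expressions for the parameters of the `(i + 1)`-st ring of the lower field in terms of those
of the `(i + 1)`-st ring of the upper field. -/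
theorem exists_unit_params_eq (h : IsKeySequence k ν (ringS k) (nS p) (eS p) (seqQ k p))
    (hS : IsQuadraticSequence ν (ringS k) S) (hc : 0 < c) (i : ℕ) :
    ∃ τ γ Ω : (S (stage (nS p) (i + 1))).toSubring, IsUnit τ ∧ IsUnit γ ∧
      (xA k p c (i + 1) : TopField k) = τ * xS k p (i + 1) ^ powExp p i ∧
      (vA k p c (i + 1) : TopField k) =
        γ * yS k p (i + 1) ^ powExp p (i + 1) + xS k p (i + 1) * Ω := by
  obtain ⟨τ, hτ, γ, hγ, Ω, hΩ, hτ0, hγ0, e1, e2⟩ := exists_params_eq h hS hc i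
  have hdom := hS.2.1 (stage (nS p) (i + 1))
  exact ⟨⟨τ, hτ⟩, ⟨γ, hγ⟩, ⟨Ω, hΩ⟩, (isUnit_iff_val_eq_zero hdom _).2 hτ0,
    (isUnit_iff_val_eq_zero hdom _).2 hγ0, e1, e2⟩

theorem isStableForm_stage (h : IsKeySequence k ν (ringS k) (nS p) (eS p) (seqQ k p))
    (hS : IsQuadraticSequence ν (ringS k) S) (hc : 0 < c) (i : ℕ) :
    IsStableForm p (S (stage (nS p) (i + 1))) (xA k p c (i + 1)) (vA k p c (i + 1))
      (xS k p (i + 1)) (yS k p (i + 1)) 1 (alphaExp (i + 1)) 0 (betaExp (i + 1)) := by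
  obtain ⟨τ, γ, Ω, hτ, hγ, e1, e2⟩ := exists_unit_params_eq h hS hc i
  have hgen := h.generatesCenter_stage (isKeyExponents_S p) hS i
  refine ⟨⟨τ, hτ, ?_⟩, γ * ⟨_, hgen.right_mem⟩ ^ powExp p (i + 1) + ⟨_, hgen.left_mem⟩ * Ω, ?_,
    γ, Ω, hγ, ?_⟩
  · rw [one_mul, ← powExp_eq_pow_alphaExp]
    exact e1
  · rw [pow_zero, one_mul]
    exact e2
  · rw [← powExp_eq_pow_betaExp]
    rfl

end Exponents

end

end DefectTower

open DefectTower in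
theorem mainTheorem10 (k : Type*) [Field k] [IsAlgClosed k] (p : ℕ) [Fact p.Prime] [CharP k p]
    (c : ℕ) (hc : 0 < c) (hpc : p - 1 ∣ c) :
    -- `K ⊂ K₁ ⊂ K*` is a tower of two Artin–Schreier extensions
    IsArtinSchreierExtension p (KBase k p c) (KOne k p c) ∧
    IsArtinSchreierExtension p (KOne k p c) ⊤ ∧
    -- the generating sequence `Q` in `S` determines a unique valuation `ν*` of `K*`
    (∃! ν : AddValuation (TopField k) (WithTop ℚ),
      IsValuationGeneratedBy k ν (ringS k) (seqQ k p) (keyValue (nS p) (eS p))) ∧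
    ∀ ν : AddValuation (TopField k) (WithTop ℚ),
      IsValuationGeneratedBy k ν (ringS k) (seqQ k p) (keyValue (nS p) (eS p)) →
    ∀ ν₁ : AddValuation (KOne k p c) (WithTop ℚ),
      ν₁ = ν.comap (algebraMap (KOne k p c) (TopField k)) →
    -- its restriction `ν₁` to `K₁` is the valuation with generating sequence `U` in `A`
    IsValuationGeneratedBy k ν₁ (ringA k p c) (seqU k p c) (keyValue (nA p) (eA p)) ∧
    -- the sequences of quadratic transforms of `A` along `ν₁` and of `S` along `ν*`
    (∃! A : ℕ → LocalSubring (KOne k p c), IsQuadraticSequence ν₁ (ringA k p c) A) ∧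
    (∃! S : ℕ → LocalSubring (TopField k), IsQuadraticSequence ν (ringS k) S) ∧
    ∀ (A' : ℕ → LocalSubring (KOne k p c)) (S' : ℕ → LocalSubring (TopField k)),
      IsQuadraticSequence ν₁ (ringA k p c) A' → IsQuadraticSequence ν (ringS k) S' →
    ∀ (A : ℕ → LocalSubring (KOne k p c)) (S : ℕ → LocalSubring (TopField k)),
      (∀ j, A j = A' (stage (nA p) j)) → (∀ j, S j = S' (stage (nS p) j)) →
    -- regular parameters
    (∀ j, 1 ≤ j → IsRegularParameters (A j) (xA k p c j) (vA k p c j) ∧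
      IsRegularParameters (S j) (xS k p j) (yS k p j)) ∧
    -- `S_j` dominates `A_j` and is a finite extension of it
    (∀ j, 1 ≤ j → (A j).map (algebraMap (KOne k p c) (TopField k)) ≤ S j ∧
      ∃ h : ((A j).map (algebraMap (KOne k p c) (TopField k))).toSubring ≤ (S j).toSubring,
        (Subring.inclusion h).Finite) ∧
    -- the expressions for odd `j`
    (∀ j, 1 ≤ j → Odd j → ∃ τ γ Ω : (S (j + 1)).toSubring, IsUnit τ ∧ IsUnit γ ∧
      (xA k p c (j + 1) : TopField k) = τ * xS k p (j + 1) ^ p ∧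
      (vA k p c (j + 1) : TopField k) = γ * yS k p (j + 1) + xS k p (j + 1) * Ω) ∧
    -- the expressions for even `j`
    (∀ j, 1 ≤ j → Even j → ∃ τ γ Ω : (S (j + 1)).toSubring, IsUnit τ ∧ IsUnit γ ∧
      (xA k p c (j + 1) : TopField k) = τ * xS k p (j + 1) ∧
      (vA k p c (j + 1) : TopField k) = γ * yS k p (j + 1) ^ p + xS k p (j + 1) * Ω) ∧
    -- these are stable forms with `ā = 1`, `b_j = 0` and the stated `α_j`, `β_j`
    (∀ j, 1 ≤ j → IsStableForm p (S j) (xA k p c j) (vA k p c j) (xS k p j) (yS k p j)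
      1 (alphaExp j) 0 (betaExp j)) ∧
    -- the exponents of stable forms are determined; `α_j` and `β_j` are not eventually constant
    (∀ (N abar : ℕ) (α b β : ℕ → ℕ), 1 ≤ N →
      (∀ j, N ≤ j → IsStableForm p (S j) (xA k p c j) (vA k p c j) (xS k p j) (yS k p j)
        abar (α j) (b j) (β j)) →
      (∀ j, N ≤ j → α j = alphaExp j ∧ β j = betaExp j) ∧
      ¬ Filter.EventuallyConst α Filter.atTop ∧ ¬ Filter.EventuallyConst β Filter.atTop) := by
  obtain ⟨d, hcd⟩ := hpc
  have hd : 0 < d := Nat.pos_of_ne_zero fun h0 => by simp [hcd, h0] at hc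
  refine ⟨isArtinSchreierExtension_KBase k, isArtinSchreierExtension_top hcd,
    existsUnique_valuation, ?_⟩
  rintro ν hgen _ rfl
  have h := isKeySequence_seqQ hgen.isResidueRational hgen.2.1
  have hU := isKeySequence_seqU h hc
  obtain ⟨A₀, hA₀⟩ := IsModel.exists_isQuadraticSequence hU.residue (two_le_trdeg_KOne k p c)
    (isModel_ringA h hc)
  obtain ⟨S₀, hS₀⟩ := IsModel.exists_isQuadraticSequence h.residue two_le_trdeg_topField
    (isModel_ringS h.residue h.val)
  refine ⟨hU.isValuationGeneratedBy (isKeyExponents_A p), ⟨A₀, hA₀, fun _ hA => hA.unique hA₀⟩,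
    ⟨S₀, hS₀, fun _ hS => hS.unique hS₀⟩, ?_⟩
  intro A' S' hA' hS' A S hA hS
  obtain rfl : A = fun j => A' (stage (nA p) j) := funext hA
  obtain rfl : S = fun j => S' (stage (nS p) j) := funext hS
  have hstable : ∀ j, 1 ≤ j → IsStableForm p (S' (stage (nS p) j)) (xA k p c j) (vA k p c j)
      (xS k p j) (yS k p j) 1 (alphaExp j) 0 (betaExp j) := fun j hj => by
    obtain ⟨i, rfl⟩ := Nat.exists_eq_add_of_le' hj
    exact isStableForm_stage h hS' hc i
  refine ⟨fun j hj => ?_, fun j hj => ?_, fun j hj hodd => ?_, fun j hj heven => ?_, hstable, ?_⟩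
  · obtain ⟨i, rfl⟩ := Nat.exists_eq_add_of_le' hj
    exact ⟨isRegularParameters_stage_KOne h hc hA' i, isRegularParameters_stage h hS' i⟩
  · obtain ⟨i, rfl⟩ := Nat.exists_eq_add_of_le' hj
    have hle := map_stage_le h hc hS' hA' i
    exact ⟨hle, hle.1, finite_stage h hd hcd hc hS' hA' i hle.1⟩
  · have hj1 : powExp p j = p := if_pos hodd
    have hj2 : powExp p (j + 1) = 1 := if_neg (Nat.not_odd_iff_even.2 hodd.add_one)
    simpa only [hj1, hj2, pow_one] using exists_unit_params_eq h hS' hc j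
  · have hj1 : powExp p j = 1 := if_neg (Nat.not_odd_iff_even.2 heven)
    have hj2 : powExp p (j + 1) = p := if_pos heven.add_one
    simpa only [hj1, hj2, pow_one] using exists_unit_params_eq h hS' hc j
  · intro N abar α b β hN hforms
    have hexp : ∀ j, N ≤ j → p ^ alphaExp j = abar * p ^ α j ∧ betaExp j = β j := fun j hj => by
      obtain ⟨i, rfl⟩ := Nat.exists_eq_add_of_le' (hN.trans hj)
      have h1 := (hstable _ (hN.trans hj)).exponents_eq (Fact.out : p.Prime).two_le (hS'.2.1 _)
        (isRegularParameters_stage h hS' i) (h.secondParam_ne_zero (isKeyExponents_S p) i)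
        (h.val_secondParam_pos (isKeyExponents_S p) i) (hforms _ hj)
      rwa [one_mul] at h1
    have hα : ∀ j, N ≤ j → α j = alphaExp j := fun j =>
      eq_alphaExp_of_mul_pow_eq fun j hj => (hexp j hj).1
    have hβ : ∀ j, N ≤ j → β j = betaExp j := fun j hj => (hexp j hj).2.symm
    exact ⟨fun j hj => ⟨hα j hj, hβ j hj⟩, not_eventuallyConst_of_parity one_ne_zero hα,
      not_eventuallyConst_of_parity zero_ne_one hβ⟩
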